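/- For a finite set $P$ of points in the Euclidean plane and $p\in P$, let $\omega(p)$ be the largest closed disk centered at $p$ that contains no other point of $P$ in its interior, and let $\mathcal D(P)=\{\omega(p) : p\in P\}$. Let $w(P)$ denote the length of a Euclidean minimum spanning tree of $P$, and for a bipartition $P=R\cup B$ into two disjoint nonempty sets call $\frac{w(R)+w(B)}{w(P)}$ its MST-ratio. Let $P$ be a set of $n\ge 12$ points in the plane. Then there are at least $\frac{n(n-1)}{132}$ unordered pairs of disjoint disks in $\mathcal D(P)$. Moreover, there are at least $\frac{n(n-1)}{132}$ unordered bipartitions $\{R,B\}$ of $P$ into two nonempty sets whose MST-ratio is greater than $1$. -/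

import Mathlib

namespace PlanarMST

/-- The Euclidean plane. -/
abbrev Plane : Type := EuclideanSpace ℝ (Fin 2)

/-! ### The nearest-neighbour disks -/

/-- The radii `s ≥ 0` for which the closed disk of radius `s` centred at `p` contains no point
of `P` other than `p` in its interior. -/
def emptyRadii (P : Finset Plane) (p : Plane) : Set ℝ :=
  {s | 0 ≤ s ∧ ∀ q ∈ P, q ≠ p → q ∉ interior (Metric.closedBall p s)}

/-- The radius `r(p)` of the largest closed disk centred at `p` that contains no point of `P`
other than `p` in its interior. The maximum exists as soon as `P` contains a point other than
`p`, see `isGreatest_diskRadius`. -/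
noncomputable def diskRadius (P : Finset Plane) (p : Plane) : ℝ := sSup (emptyRadii P p)

/-- The disk `ω(p)`. -/
noncomputable def disk (P : Finset Plane) (p : Plane) : Set Plane :=
  Metric.closedBall p (diskRadius P p)

open Classical in
/-- The family `D(P)` of the disks `ω(p)`, `p ∈ P`. -/
noncomputable def diskFamily (P : Finset Plane) : Finset (Set Plane) :=
  P.image (disk P)

open Classical in
/-- The unordered pairs of disjoint disks in `D(P)`. -/
noncomputable def disjointDiskPairs (P : Finset Plane) : Finset (Sym2 (Set Plane)) :=
  (diskFamily P).sym2.filter (fun e => ∃ D D', e = s(D, D') ∧ Disjoint D D')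

/-! ### Minimum spanning trees and bipartitions -/

/-- The Euclidean length of an edge with endpoints in `P`. -/
noncomputable def edgeLength (P : Finset Plane) : Sym2 P → ℝ :=
  Sym2.lift ⟨fun a b => dist (a : Plane) (b : Plane), fun a b => dist_comm (a : Plane) b⟩

open Classical in
/-- The total Euclidean length of the edges of a graph with vertex set `P`. -/
noncomputable def graphLength (P : Finset Plane) (G : SimpleGraph P) : ℝ :=
  ∑ e ∈ G.edgeFinset, edgeLength P e

/-- The length `w(P)` of a Euclidean minimum spanning tree of `P` (a minimum for nonempty `P`, see
`isLeast_mstLength`; there is no spanning tree for empty `P`, and then the value is `0`). -/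
noncomputable def mstLength (P : Finset Plane) : ℝ :=
  sInf {l | ∃ T : SimpleGraph P, T.IsTree ∧ graphLength P T = l}

/-- `R` and `B` form a non-trivial bipartition of `P`. -/
structure IsBipartition (P R B : Finset Plane) : Prop where
  red_nonempty : R.Nonempty
  blue_nonempty : B.Nonempty
  disjoint : Disjoint R B
  cover : ∀ x, x ∈ P ↔ x ∈ R ∨ x ∈ B

/-- The MST-ratio of the bipartition of `P` into `R` and `B`. -/
noncomputable def mstRatio (P R B : Finset Plane) : ℝ :=
  (mstLength R + mstLength B) / mstLength P

open Classical in
/-- The non-trivial bipartitions `{R, B}` of `P`, up to swapping the two parts, whose MST-ratio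
is greater than `1`. -/
noncomputable def largeRatioBipartitions (P : Finset Plane) : Finset (Sym2 (Finset Plane)) :=
  P.powerset.sym2.filter
    (fun e => ∃ R B, e = s(R, B) ∧ IsBipartition P R B ∧ 1 < mstRatio P R B)

/-! ### The extrema in the definitions are attained -/

theorem mem_emptyRadii (P : Finset Plane) (p : Plane) (s : ℝ) :
    s ∈ emptyRadii P p ↔ 0 ≤ s ∧ ∀ q ∈ P, q ≠ p → s ≤ dist q p := by
  unfold emptyRadii
  simp only [Set.mem_ofPred_eq]
  refine and_congr_right fun hs => forall₂_congr fun q hq => forall_congr' fun hqp => ?_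
  rcases hs.eq_or_lt with rfl | h
  · simp [Metric.closedBall_zero]
  · rw [interior_closedBall p h.ne', Metric.mem_ball, not_lt]

theorem isGreatest_diskRadius (P : Finset Plane) (p : Plane) (h : ∃ q ∈ P, q ≠ p) :
    IsGreatest (emptyRadii P p) (diskRadius P p) := by
  classical
  obtain ⟨q₀, hq₀, hne₀⟩ := h
  obtain ⟨q, hq, hmin⟩ := (P.erase p).exists_min_image (fun q => dist q p)
    ⟨q₀, Finset.mem_erase.2 ⟨hne₀, hq₀⟩⟩
  have hg : IsGreatest (emptyRadii P p) (dist q p) := by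
    refine ⟨(mem_emptyRadii _ _ _).2 ⟨dist_nonneg, fun x hx hxp =>
      hmin x (Finset.mem_erase.2 ⟨hxp, hx⟩)⟩, fun s hs => ?_⟩
    exact ((mem_emptyRadii _ _ _).1 hs).2 q (Finset.mem_of_mem_erase hq)
      (Finset.ne_of_mem_erase hq)
  unfold diskRadius
  rw [hg.csSup_eq]
  exact hg

theorem isLeast_mstLength (P : Finset Plane) (h : P.Nonempty) :
    IsLeast {l | ∃ T : SimpleGraph P, T.IsTree ∧ graphLength P T = l} (mstLength P) := by
  classical
  have hne : Nonempty P := h.to_subtype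
  obtain ⟨T, -, hT⟩ := (SimpleGraph.connected_top (V := P)).exists_isTree_le
  have hfin : {l | ∃ T : SimpleGraph P, T.IsTree ∧ graphLength P T = l}.Finite :=
    (Set.finite_range (graphLength P)).subset (by rintro _ ⟨T, -, rfl⟩; exact ⟨T, rfl⟩)
  exact ⟨Set.Nonempty.csInf_mem ⟨_, T, hT, rfl⟩ hfin,
    fun l hl => csInf_le hfin.bddBelow hl⟩

end PlanarMST

namespace PlanarMST

/-! ### Lengths of spanning graphs -/

/-! Call two points separated when the radii of their disks sum to less than their distance.
Everything rests on one fact: among any twelve points two are separated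
(`exists_separated_of_card_eq`). Deleting points only enlarges disks, so a pair separated in a
twelve-point subset is separated in `P`. There are C(n,12) such subsets and each pair lies in
C(n-2,10) of them, which gives at least n(n-1)/132 separated pairs (`card_separatedPairs_ge`).
Separated points have disjoint disks. They also give a bipartition with R = {p, q}: the nearest
neighbours of p and q lie in B, so w(P) ≤ w(B) + r(p) + r(q) < w(B) + w(R).

For twelve points without a separated pair, put the centre of a smallest disk at the origin and
scale its radius to 1. The other eleven points, in polar coordinates, form a `Config`, and
`Config.card_le` allows only ten. The points are divided according to whether they have a `Witness`,
that is, another point that is not farther from the origin and lies within about 35.5° in direction;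
those that have one are called far.

At most seven points have no witness (`Config.card_near_le`). Eight of them would leave angular gaps
of at least 0.6196. Two gaps of at most 55° cannot have bisectors within 38.5° of opposite, since
the contacts between their end points are incompatible (`Config.not_opposite`). This forces so many
wide gaps that their sum exceeds 2π.

At most three points are far (`Config.card_far_le`). By `Config.neg_le_cos` the far points span an
angle of at most 2.4925. For four of them, lower bounds for the consecutive angles, linear in the
inverse distances and in the differences between distance and radius, contradict either the contact
of the two extreme points or their contacts with each other's witnesses (`Config.not_four_sorted`).

The nonlinear inequalities behind both halves involve a few bounded variables and are settled by
branch and bound in interval arithmetic (`exists_neg_of_check`). -/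

theorem edgeLength_nonneg (P : Finset Plane) (e : Sym2 P) : 0 ≤ edgeLength P e := by
  induction e with
  | h a b => exact dist_nonneg (x := (a : Plane)) (y := (b : Plane))

open Classical in
/-- The edges of a graph on `P`. -/
noncomputable def edges (P : Finset Plane) (G : SimpleGraph P) : Finset (Sym2 P) :=
  Finset.univ.filter (fun e => e ∈ G.edgeSet)

theorem mem_edges {P : Finset Plane} {G : SimpleGraph P} {e : Sym2 P} :
    e ∈ edges P G ↔ e ∈ G.edgeSet := by
  simp [edges]

theorem graphLength_eq (P : Finset Plane) (G : SimpleGraph P) :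
    graphLength P G = ∑ e ∈ edges P G, edgeLength P e := by
  classical
  unfold graphLength
  refine Finset.sum_congr ?_ fun _ _ => rfl
  ext e
  rw [SimpleGraph.mem_edgeFinset, mem_edges]

theorem graphLength_mono (P : Finset Plane) {G H : SimpleGraph P} (h : G ≤ H) :
    graphLength P G ≤ graphLength P H := by
  rw [graphLength_eq, graphLength_eq]
  refine Finset.sum_le_sum_of_subset_of_nonneg ?_ fun e _ _ => edgeLength_nonneg P e
  intro e he
  exact mem_edges.2 (SimpleGraph.edgeSet_mono h (mem_edges.1 he))

theorem dist_le_graphLength (P : Finset Plane) {G : SimpleGraph P} {a b : P} (h : G.Adj a b) :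
    dist (a : Plane) b ≤ graphLength P G := by
  rw [graphLength_eq]
  have : s(a, b) ∈ edges P G := mem_edges.2 h
  exact Finset.single_le_sum (f := edgeLength P) (fun e _ => edgeLength_nonneg P e) this

theorem graphLength_sup_le (P : Finset Plane) (G H : SimpleGraph P) :
    graphLength P (G ⊔ H) ≤ graphLength P G + graphLength P H := by
  classical
  rw [graphLength_eq, graphLength_eq, graphLength_eq]
  have : edges P (G ⊔ H) = edges P G ∪ edges P H := by
    ext e
    rw [Finset.mem_union, mem_edges, mem_edges, mem_edges, SimpleGraph.edgeSet_sup,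
      Set.mem_union]
  rw [this, ← Finset.sum_union_inter]
  exact le_add_of_nonneg_right (Finset.sum_nonneg fun e _ => edgeLength_nonneg P e)

theorem graphLength_edge_le (P : Finset Plane) (a b : P) :
    graphLength P (SimpleGraph.edge a b) ≤ dist (a : Plane) b := by
  rw [graphLength_eq]
  have : edges P (SimpleGraph.edge a b) ⊆ {s(a, b)} := by
    intro e he
    rw [mem_edges] at he
    rw [Finset.mem_singleton]
    induction e with
    | h c d =>
      rw [SimpleGraph.mem_edgeSet, SimpleGraph.edge_adj] at he
      rcases he.1 with ⟨rfl, rfl⟩ | ⟨rfl, rfl⟩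
      · rfl
      · exact Sym2.eq_swap
  refine (Finset.sum_le_sum_of_subset_of_nonneg this fun e _ _ => edgeLength_nonneg P e).trans ?_
  rw [Finset.sum_singleton]
  exact le_refl (dist (a : Plane) (b : Plane))

/-- The inclusion of a subset as an embedding of subtypes. -/
def inclusion {B P : Finset Plane} (hBP : B ⊆ P) : B ↪ P :=
  ⟨fun b => ⟨b, hBP b.2⟩, fun _ _ h => Subtype.ext (congrArg (fun x : P => (x : Plane)) h)⟩

theorem graphLength_map_le {P B : Finset Plane} (hBP : B ⊆ P) (T : SimpleGraph B) :
    graphLength P (T.map (inclusion hBP)) ≤ graphLength B T := by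
  classical
  rw [graphLength_eq, graphLength_eq]
  have : edges P (T.map (inclusion hBP)) = (edges B T).map (inclusion hBP).sym2Map := by
    ext e
    rw [mem_edges, SimpleGraph.edgeSet_map, Finset.mem_map]
    constructor
    · rintro ⟨x, hx, rfl⟩
      exact ⟨x, mem_edges.2 hx, rfl⟩
    · rintro ⟨x, hx, rfl⟩
      exact ⟨x, mem_edges.1 hx, rfl⟩
  rw [this, Finset.sum_map]
  refine le_of_eq (Finset.sum_congr rfl fun e _ => ?_)
  induction e with
  | h a b => rfl

theorem mstLength_le (P : Finset Plane) {G : SimpleGraph P} (hG : G.Connected) :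
    mstLength P ≤ graphLength P G := by
  obtain ⟨T, hT, hTt⟩ := hG.exists_isTree_le
  have hne : P.Nonempty := by
    obtain ⟨a⟩ := hG.nonempty
    exact ⟨a, a.2⟩
  exact ((isLeast_mstLength P hne).2 ⟨T, hTt, rfl⟩).trans (graphLength_mono P hT)

theorem mstLength_pos (P : Finset Plane) (hP : 1 < P.card) : 0 < mstLength P := by
  classical
  obtain ⟨a, ha, b, hb, hab⟩ := Finset.one_lt_card.1 hP
  obtain ⟨T, hT, hl⟩ := (isLeast_mstLength P ⟨a, ha⟩).1
  have : Nontrivial P := ⟨⟨a, ha⟩, ⟨b, hb⟩, by simpa using hab⟩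
  obtain ⟨c, hc⟩ := hT.1.preconnected.exists_adj_of_nontrivial ⟨a, ha⟩
  rw [← hl]
  refine lt_of_lt_of_le ?_ (dist_le_graphLength P hc)
  rw [dist_pos]
  intro h
  exact hc.ne (Subtype.ext h)

theorem dist_le_mstLength_pair {R : Finset Plane} {p q : Plane} (hpq : p ≠ q)
    (hR : ∀ x, x ∈ R ↔ x = p ∨ x = q) : dist p q ≤ mstLength R := by
  have hp : p ∈ R := (hR p).2 (Or.inl rfl)
  have hq : q ∈ R := (hR q).2 (Or.inr rfl)
  obtain ⟨T, hT, hl⟩ := (isLeast_mstLength R ⟨p, hp⟩).1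
  have : Nontrivial R := ⟨⟨p, hp⟩, ⟨q, hq⟩, fun h => hpq (congrArg (fun x : R => (x : Plane)) h)⟩
  obtain ⟨⟨c, hcR⟩, hc⟩ := hT.1.preconnected.exists_adj_of_nontrivial ⟨p, hp⟩
  have hle := dist_le_graphLength R hc
  rcases (hR c).1 hcR with h | h
  · exact absurd (Subtype.ext h.symm) hc.ne
  · rw [hl] at hle
    exact (congrArg (dist p) h).symm.trans_le hle

/-- Attaching two points of `P` to a spanning tree of the rest. -/
theorem mstLength_le_add (P : Finset Plane) [DecidableEq Plane] {p q p' q' : Plane}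
    (hp : p ∈ P) (hq : q ∈ P) (hp' : p' ∈ P \ {p, q}) (hq' : q' ∈ P \ {p, q}) :
    mstLength P ≤ mstLength (P \ {p, q}) + dist p p' + dist q q' := by
  set B := P \ {p, q} with hB
  have hBP : B ⊆ P := Finset.sdiff_subset
  obtain ⟨T, hT, hl⟩ := (isLeast_mstLength B ⟨p', hp'⟩).1
  set f : B ↪ P := inclusion hBP with hf
  set G : SimpleGraph P := T.map f ⊔ SimpleGraph.edge ⟨p, hp⟩ ⟨p', hBP hp'⟩ ⊔
    SimpleGraph.edge ⟨q, hq⟩ ⟨q', hBP hq'⟩ with hG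
  have hpp' : p ≠ p' := by
    rintro rfl; simp [hB] at hp'
  have hqq' : q ≠ q' := by
    rintro rfl; simp [hB] at hq'
  have hreach : ∀ a b : B, G.Reachable (f a) (f b) := by
    intro a b
    have h1 : (T.map f).Reachable (f a) (f b) :=
      (hT.1.preconnected a b).map (SimpleGraph.Embedding.map f T).toHom
    exact h1.mono (le_sup_left.trans le_sup_left)
  have hpadj : G.Adj ⟨p, hp⟩ ⟨p', hBP hp'⟩ := by
    refine Or.inl (Or.inr ?_)
    simp [SimpleGraph.edge_adj, hpp']
  have hqadj : G.Adj ⟨q, hq⟩ ⟨q', hBP hq'⟩ := by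
    refine Or.inr ?_
    simp [SimpleGraph.edge_adj, hqq']
  have hbase : ∀ x : P, G.Reachable x ⟨p', hBP hp'⟩ := by
    intro x
    by_cases hxp : (x : Plane) = p
    · have : x = ⟨p, hp⟩ := Subtype.ext hxp
      rw [this]; exact hpadj.reachable
    by_cases hxq : (x : Plane) = q
    · have : x = ⟨q, hq⟩ := Subtype.ext hxq
      rw [this]
      exact hqadj.reachable.trans (hreach ⟨q', hq'⟩ ⟨p', hp'⟩)
    · have hxB : (x : Plane) ∈ B := by simp [hB, hxp, hxq]
      exact hreach ⟨x, hxB⟩ ⟨p', hp'⟩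
  have hconn : G.Connected := by
    have : Nonempty P := ⟨⟨p, hp⟩⟩
    exact ⟨fun x y => (hbase x).trans (hbase y).symm⟩
  refine (mstLength_le P hconn).trans ?_
  rw [← hl]
  refine (graphLength_sup_le P _ _).trans (add_le_add ((graphLength_sup_le P _ _).trans
    (add_le_add (graphLength_map_le hBP T) (graphLength_edge_le P _ _)))
    (graphLength_edge_le P _ _))

/-! ### Radii of the disks -/

theorem diskRadius_le_dist {P : Finset Plane} {p q : Plane} (hq : q ∈ P) (hqp : q ≠ p) :
    diskRadius P p ≤ dist q p :=
  ((mem_emptyRadii _ _ _).1 (isGreatest_diskRadius P p ⟨q, hq, hqp⟩).1).2 q hq hqp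

theorem exists_dist_eq_diskRadius {P : Finset Plane} {p : Plane} (h : ∃ q ∈ P, q ≠ p) :
    ∃ q ∈ P, q ≠ p ∧ dist q p = diskRadius P p := by
  classical
  obtain ⟨q₀, hq₀, hne₀⟩ := h
  obtain ⟨q, hq, hmin⟩ := (P.erase p).exists_min_image (fun q => dist q p)
    ⟨q₀, Finset.mem_erase.2 ⟨hne₀, hq₀⟩⟩
  have hqP := Finset.mem_of_mem_erase hq
  have hqp := Finset.ne_of_mem_erase hq
  refine ⟨q, hqP, hqp, le_antisymm ?_ (diskRadius_le_dist hqP hqp)⟩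
  refine (isGreatest_diskRadius P p ⟨q, hqP, hqp⟩).2 ((mem_emptyRadii _ _ _).2
    ⟨dist_nonneg, fun x hx hxp => hmin x (Finset.mem_erase.2 ⟨hxp, hx⟩)⟩)

theorem diskRadius_pos {P : Finset Plane} {p : Plane} (h : ∃ q ∈ P, q ≠ p) :
    0 < diskRadius P p := by
  obtain ⟨q, -, hqp, hd⟩ := exists_dist_eq_diskRadius h
  rw [← hd]
  exact dist_pos.2 hqp

/-- The nearest neighbour within `Q` still competes in `P`. This carries separation from a subset to
the whole set. -/
theorem diskRadius_anti {P Q : Finset Plane} (hQP : Q ⊆ P) {p : Plane} (h : ∃ q ∈ Q, q ≠ p) :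
    diskRadius P p ≤ diskRadius Q p := by
  obtain ⟨q, hq, hqp, hd⟩ := exists_dist_eq_diskRadius h
  rw [← hd]
  exact diskRadius_le_dist (hQP hq) hqp

/-- Needed because disks are counted as sets: distinct points must not share a disk. -/
theorem disk_injOn (P : Finset Plane) : Set.InjOn (disk P) P := by
  intro p hp q hq hpq
  by_contra hne
  have hrp : diskRadius P p ≤ dist p q := by
    rw [dist_comm]; exact diskRadius_le_dist hq (Ne.symm hne)
  have hrq : diskRadius P q ≤ dist p q := diskRadius_le_dist hp hne
  have h0 : 0 < diskRadius P p := diskRadius_pos ⟨q, hq, Ne.symm hne⟩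
  have hd : 0 < dist p q := dist_pos.2 hne
  -- This is the point of the disk of `p` opposite to `q`; its distance to `q` is `dist p q +
  -- diskRadius P p`, which exceeds the radius at `q`.
  have hx : AffineMap.lineMap q p (1 + diskRadius P p / dist p q) ∈ disk P q := by
    rw [← hpq]
    unfold disk
    rw [Metric.mem_closedBall, dist_lineMap_right, Real.norm_eq_abs, dist_comm q p]
    rw [show (1 : ℝ) - (1 + diskRadius P p / dist p q) = -(diskRadius P p / dist p q) by ring,
      abs_neg, abs_of_pos (by positivity), div_mul_cancel₀ _ hd.ne']
  unfold disk at hx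
  rw [Metric.mem_closedBall, dist_lineMap_left, Real.norm_eq_abs, abs_of_pos (by positivity),
    add_mul, div_mul_eq_mul_div, dist_comm q p, mul_div_assoc, div_self hd.ne'] at hx
  linarith

/-! ### Averaging over subsets -/

/-- The unordered pairs of points whose disks are separated. -/
noncomputable def separatedPairs (P : Finset Plane) : Finset (Sym2 Plane) := by
  classical
  exact P.sym2.filter (fun e => ∃ p q, e = s(p, q) ∧ p ≠ q ∧
    diskRadius P p + diskRadius P q < dist p q)

theorem mem_separatedPairs {P : Finset Plane} {e : Sym2 Plane} : e ∈ separatedPairs P ↔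
    ∃ p q, e = s(p, q) ∧ p ∈ P ∧ q ∈ P ∧ p ≠ q ∧ diskRadius P p + diskRadius P q < dist p q := by
  classical
  unfold separatedPairs
  constructor
  · intro h
    obtain ⟨h1, p, q, rfl, h2, h3⟩ := Finset.mem_filter.1 h
    rw [Finset.mk_mem_sym2_iff] at h1
    exact ⟨p, q, rfl, h1.1, h1.2, h2, h3⟩
  · rintro ⟨p, q, rfl, hp, hq, h2, h3⟩
    exact Finset.mem_filter.2 ⟨Finset.mk_mem_sym2_iff.2 ⟨hp, hq⟩, p, q, rfl, h2, h3⟩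

/-- Removing `p` and `q` injects these twelve-point sets into the ten-point subsets of the rest. -/
theorem card_filter_sym2_le (P : Finset Plane) {p q : Plane} (hp : p ∈ P) (hq : q ∈ P)
    (hpq : p ≠ q) [DecidablePred fun Q : Finset Plane => s(p, q) ∈ Q.sym2] :
    ((P.powersetCard 12).filter (fun Q => s(p, q) ∈ Q.sym2)).card ≤ (P.card - 2).choose 10 := by
  classical
  have hsub : ({p, q} : Finset Plane) ⊆ P := by
    intro x hx
    rcases Finset.mem_insert.1 hx with rfl | hx
    · exact hp
    · rw [Finset.mem_singleton.1 hx]; exact hq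
  have h2 : ({p, q} : Finset Plane).card = 2 := Finset.card_pair hpq
  have hc : (P \ {p, q}).card = P.card - 2 := by
    rw [Finset.card_sdiff_of_subset hsub, h2]
  rw [← hc, ← Finset.card_powersetCard]
  have hmem : ∀ Q ∈ (P.powersetCard 12).filter (fun Q => s(p, q) ∈ Q.sym2),
      Q ⊆ P ∧ Q.card = 12 ∧ ({p, q} : Finset Plane) ⊆ Q := by
    intro Q hQ
    obtain ⟨h1, h3⟩ := Finset.mem_filter.1 hQ
    obtain ⟨h4, h5⟩ := Finset.mem_powersetCard.1 h1
    rw [Finset.mk_mem_sym2_iff] at h3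
    refine ⟨h4, h5, ?_⟩
    intro x hx
    rcases Finset.mem_insert.1 hx with rfl | hx
    · exact h3.1
    · rw [Finset.mem_singleton.1 hx]; exact h3.2
  refine Finset.card_le_card_of_injOn (fun Q => Q \ {p, q}) ?_ ?_
  · intro Q hQ
    obtain ⟨h1, h3, h4⟩ := hmem Q hQ
    refine Finset.mem_coe.2 (Finset.mem_powersetCard.2 ⟨Finset.sdiff_subset_sdiff h1 le_rfl, ?_⟩)
    rw [Finset.card_sdiff_of_subset h4, h2, h3]
  · intro Q hQ Q' hQ' h
    obtain ⟨-, -, h4⟩ := hmem Q hQ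
    obtain ⟨-, -, h4'⟩ := hmem Q' hQ'
    have h' : Q \ {p, q} = Q' \ {p, q} := h
    rw [← Finset.sdiff_union_of_subset h4, ← Finset.sdiff_union_of_subset h4', h']

/-- Double counting of incidences between separated pairs of `P` and twelve-point subsets containing
them; each subset contributes at least one. -/
theorem card_separatedPairs_ge
    (key : ∀ Q : Finset Plane, Q.card = 12 → ∃ p ∈ Q, ∃ q ∈ Q, p ≠ q ∧
      diskRadius Q p + diskRadius Q q < dist p q)
    (P : Finset Plane) (hP : 12 ≤ P.card) :
    P.card * (P.card - 1) ≤ 132 * (separatedPairs P).card := by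
  classical
  have hdc : P.card.choose 12 ≤ (separatedPairs P).card * (P.card - 2).choose 10 := by
    rw [← Finset.card_powersetCard]
    calc (P.powersetCard 12).card = ∑ Q ∈ P.powersetCard 12, 1 := by simp
      _ ≤ ∑ Q ∈ P.powersetCard 12, ((separatedPairs P).filter (fun e => e ∈ Q.sym2)).card := by
          refine Finset.sum_le_sum fun Q hQ => ?_
          obtain ⟨hQP, hQc⟩ := Finset.mem_powersetCard.1 hQ
          obtain ⟨p, hp, q, hq, hpq, hlt⟩ := key Q hQc
          refine Finset.card_pos.2 ⟨s(p, q), Finset.mem_filter.2 ⟨mem_separatedPairs.2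
            ⟨p, q, rfl, hQP hp, hQP hq, hpq, ?_⟩, Finset.mk_mem_sym2_iff.2 ⟨hp, hq⟩⟩⟩
          have h1 := diskRadius_anti hQP (p := p) ⟨q, hq, hpq.symm⟩
          have h2 := diskRadius_anti hQP (p := q) ⟨p, hp, hpq⟩
          linarith
      _ = ∑ e ∈ separatedPairs P, ((P.powersetCard 12).filter (fun Q => e ∈ Q.sym2)).card := by
          simp only [Finset.card_filter]
          exact Finset.sum_comm
      _ ≤ ∑ e ∈ separatedPairs P, (P.card - 2).choose 10 := by
          refine Finset.sum_le_sum fun e he => ?_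
          obtain ⟨p, q, rfl, hp, hq, hpq, -⟩ := mem_separatedPairs.1 he
          exact card_filter_sym2_le P hp hq hpq
      _ = (separatedPairs P).card * (P.card - 2).choose 10 := by
          rw [Finset.sum_const, smul_eq_mul]
  -- Two absorption identities give (m+2)(m+1)·C(m,10) = 12·11·C(m+2,12), the source of 132.
  obtain ⟨m, hm⟩ : ∃ m, P.card = m + 2 := ⟨P.card - 2, by omega⟩
  rw [hm] at hdc ⊢
  have e1 := Nat.add_one_mul_choose_eq (m + 1) 11
  have e2 := Nat.add_one_mul_choose_eq m 10
  have hpos : 0 < m.choose 10 := Nat.choose_pos (by omega)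
  have hsimp : m + 2 - 2 = m := by omega
  have hsimp' : m + 2 - 1 = m + 1 := by omega
  rw [hsimp] at hdc
  rw [hsimp']
  norm_num at e1 e2
  have h3 : (m + 2) * (m + 1) * m.choose 10 = 132 * (m + 2).choose 12 := by
    calc (m + 2) * (m + 1) * m.choose 10 = (m + 2) * ((m + 1) * m.choose 10) := by ring
      _ = (m + 2) * ((m + 1).choose 11 * 11) := by rw [e2]
      _ = ((m + 2) * (m + 1).choose 11) * 11 := by ring
      _ = ((m + 2).choose 12 * 12) * 11 := by rw [← e1]
      _ = 132 * (m + 2).choose 12 := by ring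
  refine Nat.le_of_mul_le_mul_right ?_ hpos
  rw [h3, mul_assoc]
  exact Nat.mul_le_mul_left 132 hdc

/-! ### Separated pairs yield disjoint disks and bipartitions of large ratio -/

theorem card_separatedPairs_le_disjointDiskPairs (P : Finset Plane) :
    (separatedPairs P).card ≤ (disjointDiskPairs P).card := by
  classical
  refine Finset.card_le_card_of_injOn (Sym2.map (disk P)) ?_ ?_
  · intro e he
    obtain ⟨p, q, rfl, hp, hq, hpq, hlt⟩ := mem_separatedPairs.1 he
    refine Finset.mem_coe.2 (Finset.mem_filter.2 ⟨?_, disk P p, disk P q, by simp, ?_⟩)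
    · rw [Sym2.map_mk, Finset.mk_mem_sym2_iff]
      exact ⟨Finset.mem_image_of_mem _ hp, Finset.mem_image_of_mem _ hq⟩
    · exact Metric.closedBall_disjoint_closedBall hlt
  · intro e he e' he' h
    obtain ⟨p, q, rfl, hp, hq, -, -⟩ := mem_separatedPairs.1 he
    obtain ⟨p', q', rfl, hp', hq', -, -⟩ := mem_separatedPairs.1 he'
    rw [Sym2.map_mk, Sym2.map_mk, Sym2.eq_iff] at h
    have inj := disk_injOn P
    rcases h with ⟨h1, h2⟩ | ⟨h1, h2⟩
    · rw [inj hp hp' h1, inj hq hq' h2]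
    · rw [inj hp hq' h1, inj hq hp' h2, Sym2.eq_swap]

/-- A separated pair is sent to the bipartition into itself and its complement. With at least five
points the complement of a pair is not a pair, so the unordered bipartition determines the pair. -/
theorem card_separatedPairs_le_largeRatioBipartitions (P : Finset Plane) (hP : 5 ≤ P.card) :
    (separatedPairs P).card ≤ (largeRatioBipartitions P).card := by
  classical
  have hpair : ∀ e ∈ separatedPairs P, ∃ p q, e = s(p, q) ∧ e.toFinset = {p, q} ∧
      p ∈ P ∧ q ∈ P ∧ p ≠ q ∧ diskRadius P p + diskRadius P q < dist p q := by
    intro e he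
    obtain ⟨p, q, rfl, h⟩ := mem_separatedPairs.1 he
    exact ⟨p, q, rfl, by ext x; simp [Sym2.mem_toFinset], h⟩
  refine Finset.card_le_card_of_injOn (fun e => s(e.toFinset, P \ e.toFinset)) ?_ ?_
  · intro e he
    obtain ⟨p, q, -, hf, hp, hq, hpq, hlt⟩ := hpair e he
    have hsub : ({p, q} : Finset Plane) ⊆ P := by
      intro x hx
      rcases Finset.mem_insert.1 hx with rfl | hx
      · exact hp
      · rw [Finset.mem_singleton.1 hx]; exact hq
    have hBc : (P \ {p, q}).card = P.card - 2 := by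
      rw [Finset.card_sdiff_of_subset hsub, Finset.card_pair hpq]
    simp only [hf]
    refine Finset.mem_coe.2 (Finset.mem_filter.2 ⟨?_, {p, q}, P \ {p, q}, rfl, ⟨?_, ?_, ?_, ?_⟩, ?_⟩)
    · rw [Finset.mk_mem_sym2_iff]
      exact ⟨Finset.mem_powerset.2 hsub, Finset.mem_powerset.2 Finset.sdiff_subset⟩
    · exact ⟨p, by simp⟩
    · exact Finset.card_pos.1 (by omega)
    · exact Finset.disjoint_sdiff
    · intro x
      constructor
      · intro hx
        by_cases h : x ∈ ({p, q} : Finset Plane)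
        · exact Or.inl h
        · exact Or.inr (Finset.mem_sdiff.2 ⟨hx, h⟩)
      · rintro (h | h)
        · exact hsub h
        · exact (Finset.mem_sdiff.1 h).1
    · have hrp := diskRadius_pos (P := P) (p := p) ⟨q, hq, hpq.symm⟩
      have hrq := diskRadius_pos (P := P) (p := q) ⟨p, hp, hpq⟩
      obtain ⟨p', hp', hne, hd⟩ := exists_dist_eq_diskRadius (P := P) (p := p) ⟨q, hq, hpq.symm⟩
      obtain ⟨q', hq', hne', hd'⟩ := exists_dist_eq_diskRadius (P := P) (p := q) ⟨p, hp, hpq⟩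
      -- The nearest neighbour of `p` is at distance `diskRadius P p`, too close to be `q`; so it
      -- stays in the blue part.
      have hp'q : p' ≠ q := by
        rintro rfl
        rw [dist_comm] at hd; linarith
      have hq'p : q' ≠ p := by
        rintro rfl
        linarith
      have hle := mstLength_le_add P hp hq (p' := p') (q' := q')
        (by simp [hp', hne, hp'q]) (by simp [hq', hne', hq'p])
      have hR : dist p q ≤ mstLength ({p, q} : Finset Plane) :=
        dist_le_mstLength_pair hpq (by simp)
      unfold mstRatio
      rw [lt_div_iff₀ (mstLength_pos P (by omega)), one_mul]
      rw [dist_comm p p', dist_comm q q', hd, hd'] at hle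
      linarith
  · intro e he e' he' h
    obtain ⟨p, q, rfl, hf, hp, hq, hpq, -⟩ := hpair e he
    obtain ⟨p', q', rfl, hf', hp', hq', hpq', -⟩ := hpair e' he'
    simp only [hf, hf', Sym2.eq_iff] at h
    have hset : ({p, q} : Finset Plane) = {p', q'} := by
      rcases h with ⟨h, -⟩ | ⟨h, -⟩
      · exact h
      · exfalso
        have h1 := congrArg Finset.card h
        have hsub : ({p', q'} : Finset Plane) ⊆ P := by
          intro x hx
          rcases Finset.mem_insert.1 hx with rfl | hx
          · exact hp'
          · rw [Finset.mem_singleton.1 hx]; exact hq'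
        rw [Finset.card_sdiff_of_subset hsub, Finset.card_pair hpq, Finset.card_pair hpq'] at h1
        omega
    have h1 : p ∈ ({p', q'} : Finset Plane) := by rw [← hset]; simp
    have h2 : q ∈ ({p', q'} : Finset Plane) := by rw [← hset]; simp
    simp only [Finset.mem_insert, Finset.mem_singleton] at h1 h2
    rcases h1 with rfl | rfl <;> rcases h2 with rfl | rfl
    · exact absurd rfl hpq
    · rfl
    · exact Sym2.eq_swap
    · exact absurd rfl hpq

/-! ### Taylor bounds for the cosine -/

theorem nonneg_of_hasDerivAt {f f' : ℝ → ℝ} (h : ∀ x, HasDerivAt f (f' x) x) (h0 : f 0 = 0)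
    (hf' : ∀ x, 0 ≤ x → 0 ≤ f' x) : ∀ x, 0 ≤ x → 0 ≤ f x := by
  intro x hx
  have hm : MonotoneOn f (Set.Ici 0) := by
    refine monotoneOn_of_deriv_nonneg (convex_Ici 0)
      (fun y _ => (h y).continuousAt.continuousWithinAt)
      (fun y _ => (h y).differentiableAt.differentiableWithinAt) fun y hy => ?_
    rw [(h y).deriv]
    rw [interior_Ici] at hy
    exact hf' y (le_of_lt hy)
  simpa [h0] using hm (Set.mem_Ici.2 le_rfl) (Set.mem_Ici.2 hx) hx

/-- `cosTaylor n` has n+1 terms but `sinTaylor n` only n; the derivative of `sinTaylor (n + 1)` is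
`cosTaylor n`, that of `cosTaylor n` is `-sinTaylor n`. -/
noncomputable def cosTaylor (n : ℕ) (x : ℝ) : ℝ :=
  ∑ k ∈ Finset.range (n + 1), (-1) ^ k * x ^ (2 * k) / (2 * k).factorial

noncomputable def sinTaylor (n : ℕ) (x : ℝ) : ℝ :=
  ∑ k ∈ Finset.range n, (-1) ^ k * x ^ (2 * k + 1) / (2 * k + 1).factorial

theorem hasDerivAt_sinTaylor (n : ℕ) (x : ℝ) :
    HasDerivAt (sinTaylor (n + 1)) (cosTaylor n x) x := by
  unfold sinTaylor cosTaylor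
  refine HasDerivAt.fun_sum fun k _ => ?_
  have h := ((hasDerivAt_pow (2 * k + 1) x).const_mul ((-1 : ℝ) ^ k)).div_const
    ((2 * k + 1).factorial : ℝ)
  refine h.congr_deriv ?_
  rw [Nat.factorial_succ]
  have : ((2 * k).factorial : ℝ) ≠ 0 := by positivity
  push_cast
  field_simp

theorem hasDerivAt_cosTaylor (n : ℕ) (x : ℝ) :
    HasDerivAt (cosTaylor n) (-sinTaylor n x) x := by
  unfold sinTaylor cosTaylor
  simp_rw [Finset.sum_range_succ' _ n]
  have h : HasDerivAt (fun x : ℝ => ∑ k ∈ Finset.range n,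
      (-1) ^ (k + 1) * x ^ (2 * (k + 1)) / (2 * (k + 1)).factorial)
      (-∑ k ∈ Finset.range n, (-1) ^ k * x ^ (2 * k + 1) / (2 * k + 1).factorial) x := by
    rw [← Finset.sum_neg_distrib]
    refine HasDerivAt.fun_sum fun k _ => ?_
    have h := ((hasDerivAt_pow (2 * (k + 1)) x).const_mul ((-1 : ℝ) ^ (k + 1))).div_const
      ((2 * (k + 1)).factorial : ℝ)
    refine h.congr_deriv ?_
    have e : 2 * (k + 1) = (2 * k + 1) + 1 := by ring
    rw [e, Nat.factorial_succ]
    have : ((2 * k + 1).factorial : ℝ) ≠ 0 := by positivity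
    push_cast
    field_simp
    ring
  simpa using h.add_const (1 : ℝ)

/-- Each bound follows from the preceding one by integration from 0, starting with cos ≤ 1; the sign
alternates. -/
theorem taylor_bounds (n : ℕ) : (∀ x : ℝ, 0 ≤ x → 0 ≤ (-1) ^ n * (cosTaylor n x - Real.cos x)) ∧
    (∀ x : ℝ, 0 ≤ x → 0 ≤ (-1) ^ n * (sinTaylor (n + 1) x - Real.sin x)) := by
  have key : ∀ n : ℕ, (∀ x : ℝ, 0 ≤ x → 0 ≤ (-1) ^ n * (cosTaylor n x - Real.cos x)) →
      (∀ x : ℝ, 0 ≤ x → 0 ≤ (-1) ^ n * (sinTaylor (n + 1) x - Real.sin x)) := by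
    intro n h
    exact nonneg_of_hasDerivAt
      (fun x => ((hasDerivAt_sinTaylor n x).sub (Real.hasDerivAt_sin x)).const_mul _)
      (by simp [sinTaylor]) h
  induction n with
  | zero =>
    have h0 : ∀ x : ℝ, 0 ≤ x → 0 ≤ (-1) ^ 0 * (cosTaylor 0 x - Real.cos x) := by
      intro x _
      simpa [cosTaylor] using Real.cos_le_one x
    exact ⟨h0, key 0 h0⟩
  | succ n ih =>
    have h0 : ∀ x : ℝ, 0 ≤ x → 0 ≤ (-1) ^ (n + 1) * (cosTaylor (n + 1) x - Real.cos x) := by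
      refine nonneg_of_hasDerivAt
        (fun x => ((hasDerivAt_cosTaylor (n + 1) x).sub (Real.hasDerivAt_cos x)).const_mul _)
        (by simp [cosTaylor, Finset.sum_range_succ']) fun x hx => ?_
      have := ih.2 x hx
      rw [pow_succ]
      linarith
    exact ⟨h0, key _ h0⟩

theorem cos_upper (x : ℝ) : Real.cos x ≤ 1 - x ^ 2 / 2 + x ^ 4 / 24 - x ^ 6 / 720
    + x ^ 8 / 40320 - x ^ 10 / 3628800 + x ^ 12 / 479001600 := by
  have h := (taylor_bounds 6).1 |x| (abs_nonneg x)
  have e : ∀ k : ℕ, |x| ^ (2 * k) = x ^ (2 * k) := fun k => by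
    rw [pow_mul, pow_mul, sq_abs]
  simp only [cosTaylor, Finset.sum_range_succ, Finset.sum_range_zero, e, Real.cos_abs,
    Nat.factorial] at h
  norm_num at h
  linarith

theorem cos_lower (x : ℝ) : 1 - x ^ 2 / 2 + x ^ 4 / 24 - x ^ 6 / 720
    + x ^ 8 / 40320 - x ^ 10 / 3628800 ≤ Real.cos x := by
  have h := (taylor_bounds 5).1 |x| (abs_nonneg x)
  have e : ∀ k : ℕ, |x| ^ (2 * k) = x ^ (2 * k) := fun k => by
    rw [pow_mul, pow_mul, sq_abs]
  simp only [cosTaylor, Finset.sum_range_succ, Finset.sum_range_zero, e, Real.cos_abs,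
    Nat.factorial] at h
  norm_num at h
  linarith

/-! ### Interval arithmetic with six decimals -/

/-- Arithmetic expressions in the variables `0, 1, …`; `const n` stands for `n / 10 ^ 6`, and
`ratio a b` for `a / b` clamped to the unit interval. -/
inductive Term where
  | var (i : Nat)
  | const (n : Int)
  | add (a b : Term)
  | sub (a b : Term)
  | mul (a b : Term)
  | sq (a : Term)
  | cos (a : Term)
  | ratio (a b : Term)

/-- The value of an expression. -/
noncomputable def Term.val (x : List ℝ) : Term → ℝ
  | .var i => x.getD i 0
  | .const n => n / 1000000
  | .add a b => a.val x + b.val x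
  | .sub a b => a.val x - b.val x
  | .mul a b => a.val x * b.val x
  | .sq a => a.val x ^ 2
  | .cos a => Real.cos (a.val x)
  | .ratio a b => max 0 (min 1 (a.val x / b.val x))

/-- An interval with endpoints `lo / 10 ^ 6` and `hi / 10 ^ 6`. -/
structure Itv where
  lo : Int
  hi : Int

def Itv.Mem (I : Itv) (x : ℝ) : Prop := (I.lo : ℝ) ≤ 1000000 * x ∧ 1000000 * x ≤ I.hi

/-- This arithmetic is spelled out with recursors and the basic `Nat` operations so that `decide
+kernel` can evaluate the large certificates by reduction. -/
noncomputable def isNonneg (a : Int) : Bool :=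
  Int.rec (motive := fun _ => Bool) (fun _ => true) (fun _ => false) a

noncomputable def choose {α : Type} (b : Bool) (x y : α) : α :=
  Bool.rec (motive := fun _ => α) y x b

noncomputable def toNat (a : Int) : Nat :=
  Int.rec (motive := fun _ => Nat) (fun m => m) (fun _ => 0) a

noncomputable def subNat (m n : Nat) : Int :=
  Nat.rec (motive := fun _ => Int) (Int.ofNat (Nat.sub m n)) (fun k _ => Int.negSucc k)
    (Nat.sub n m)

noncomputable def ineg (a : Int) : Int :=
  Int.rec (motive := fun _ => Int) (fun m => subNat 0 m) (fun m => Int.ofNat (Nat.succ m)) a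

noncomputable def iadd (a b : Int) : Int :=
  Int.rec (motive := fun _ => Int)
    (fun m => Int.rec (motive := fun _ => Int) (fun n => Int.ofNat (Nat.add m n))
      (fun n => subNat m (Nat.succ n)) b)
    (fun m => Int.rec (motive := fun _ => Int) (fun n => subNat n (Nat.succ m))
      (fun n => Int.negSucc (Nat.succ (Nat.add m n))) b) a

noncomputable def isub (a b : Int) : Int := iadd a (ineg b)

noncomputable def imul (a b : Int) : Int :=
  Int.rec (motive := fun _ => Int)
    (fun m => Int.rec (motive := fun _ => Int) (fun n => Int.ofNat (Nat.mul m n))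
      (fun n => subNat 0 (Nat.mul m (Nat.succ n))) b)
    (fun m => Int.rec (motive := fun _ => Int) (fun n => subNat 0 (Nat.mul (Nat.succ m) n))
      (fun n => Int.ofNat (Nat.mul (Nat.succ m) (Nat.succ n))) b) a

noncomputable def floorDiv (a : Int) (b : Nat) : Int :=
  Int.rec (motive := fun _ => Int) (fun m => Int.ofNat (Nat.div m b))
    (fun m => Int.negSucc (Nat.div m b)) a

noncomputable def ceilDiv (a : Int) (b : Nat) : Int := ineg (floorDiv (ineg a) b)

noncomputable def imax (a b : Int) : Int := choose (isNonneg (isub a b)) a b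
noncomputable def imin (a b : Int) : Int := choose (isNonneg (isub a b)) b a

/-- For nonnegative lower ends two products suffice; otherwise all four corners are compared. -/
noncomputable def mulItv (I J : Itv) : Itv :=
  choose (choose (isNonneg I.lo) (isNonneg J.lo) false)
    ⟨floorDiv (imul I.lo J.lo) 1000000, ceilDiv (imul I.hi J.hi) 1000000⟩
    ⟨floorDiv (imin (imin (imul I.lo J.lo) (imul I.lo J.hi))
        (imin (imul I.hi J.lo) (imul I.hi J.hi))) 1000000,
      ceilDiv (imax (imax (imul I.lo J.lo) (imul I.lo J.hi))
        (imax (imul I.hi J.lo) (imul I.hi J.hi))) 1000000⟩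

noncomputable def absItv (I : Itv) : Itv :=
  ⟨imax 0 (imax I.lo (ineg I.hi)), imax I.hi (ineg I.lo)⟩

noncomputable def sqItv (I : Itv) : Itv :=
  ⟨floorDiv (imul (absItv I).lo (absItv I).lo) 1000000,
    ceilDiv (imul (absItv I).hi (absItv I).hi) 1000000⟩

/-- Lower bound for the cosine of `n / 10 ^ 6`, where `u = n ^ 2 ≤ (10 ^ 6 * π) ^ 2`. -/
noncomputable def cosLo (u : Nat) : Int :=
  floorDiv (subNat (3628800 * 10 ^ 60) (Nat.mul u (Nat.sub (1814400 * 10 ^ 48)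
    (Nat.mul u (Nat.sub (151200 * 10 ^ 36) (Nat.mul u (Nat.sub (5040 * 10 ^ 24)
    (Nat.mul u (Nat.sub (90 * 10 ^ 12) u))))))))) (3628800 * 10 ^ 54)

/-- Upper bound for the cosine of `n / 10 ^ 6`, where `u = n ^ 2 ≤ (10 ^ 6 * π) ^ 2`. -/
noncomputable def cosHi (u : Nat) : Int :=
  ceilDiv (subNat (479001600 * 10 ^ 72) (Nat.mul u (Nat.sub (239500800 * 10 ^ 60)
    (Nat.mul u (Nat.sub (19958400 * 10 ^ 48) (Nat.mul u (Nat.sub (665280 * 10 ^ 36)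
    (Nat.mul u (Nat.sub (11880 * 10 ^ 24) (Nat.mul u (Nat.sub (132 * 10 ^ 12) u)))))))))))
    (479001600 * 10 ^ 66)

/-- Cosine is even and decreasing on [0, π], so the ends of the absolute value are exchanged. Beyond
3.141592 the trivial interval [-1, 1] is returned. -/
noncomputable def cosItv (I : Itv) : Itv :=
  choose (isNonneg (isub 3141592 (absItv I).hi))
    ⟨cosLo (Nat.mul (toNat (absItv I).hi) (toNat (absItv I).hi)),
      cosHi (Nat.mul (toNat (absItv I).lo) (toNat (absItv I).lo))⟩
    ⟨-1000000, 1000000⟩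

/-- Unless the denominator is certainly positive, the clamped quotient is only known to lie in [0,
1]. -/
noncomputable def ratioItv (I J : Itv) : Itv :=
  ⟨choose (isNonneg (isub J.lo 1))
    (imin 1000000 (floorDiv (imul 1000000 (imax 0 I.lo)) (toNat J.hi))) 0,
    choose (isNonneg (isub J.lo 1))
    (imax 0 (imin 1000000 (ceilDiv (imul 1000000 (imax 0 I.hi)) (toNat J.lo)))) 1000000⟩

noncomputable def getItv (l : List Itv) : Nat → Itv :=
  List.rec (motive := fun _ => Nat → Itv) (fun _ => ⟨0, 0⟩)
    (fun I _ ih n => Nat.rec (motive := fun _ => Itv) I (fun k _ => ih k) n) l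

noncomputable def Term.eval (box : List Itv) (t : Term) : Itv :=
  Term.rec (motive := fun _ => Itv) (fun i => getItv box i) (fun n => ⟨n, n⟩)
    (fun _ _ I J => ⟨iadd I.lo J.lo, iadd I.hi J.hi⟩)
    (fun _ _ I J => ⟨isub I.lo J.hi, isub I.hi J.lo⟩)
    (fun _ _ I J => mulItv I J)
    (fun _ I => sqItv I)
    (fun _ I => cosItv I)
    (fun _ _ I J => ratioItv I J) t

/-- Some expression of the list is negative on the whole box. -/
noncomputable def someNeg (box : List Itv) (cs : List Term) : Bool :=
  List.rec (motive := fun _ => Bool) false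
    (fun t _ ih => choose (isNonneg (t.eval box).hi) ih true) cs

noncomputable def maxWidth (box : List Itv) : Int :=
  List.rec (motive := fun _ => Int) 0 (fun I _ ih => imax (isub I.hi I.lo) ih) box

/-- With `w` the maximal width, exactly one interval is bisected: the first of that width. -/
noncomputable def halves (w : Int) (box : List Itv) : List Itv × List Itv :=
  List.rec (motive := fun _ => List Itv × List Itv) ([], [])
    (fun I l ih => choose (isNonneg (isub (isub I.hi I.lo) w))
      (⟨I.lo, floorDiv (iadd I.lo I.hi) 2⟩ :: l, ⟨floorDiv (iadd I.lo I.hi) 2, I.hi⟩ :: l)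
      (I :: ih.1, I :: ih.2)) box

/-- Branch and bound: on every point of the box some expression of the list is negative. -/
noncomputable def check (cs : List Term) (n : Nat) : List Itv → Bool :=
  Nat.rec (motive := fun _ => List Itv → Bool) (fun _ => false)
    (fun _ ih box => choose (someNeg box cs) true
      (choose (ih (halves (maxWidth box) box).1) (ih (halves (maxWidth box) box).2) false)) n

/-! ### Soundness of the interval arithmetic -/

theorem choose_isNonneg {α : Type} (a : Int) (x y : α) :
    choose (isNonneg a) x y = if 0 ≤ a then x else y := by
  cases a with
  | ofNat n => rfl
  | negSucc n => rfl

theorem isNonneg_iff (a : Int) : isNonneg a = true ↔ 0 ≤ a := by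
  cases a with
  | ofNat n => simp [isNonneg]
  | negSucc n => simp [isNonneg, Int.negSucc_not_nonneg]

theorem choose_eq {α : Type} (b : Bool) (x y : α) : choose b x y = if b = true then x else y := by
  cases b <;> rfl

theorem toNat_eq (a : Int) (h : 0 ≤ a) : (toNat a : Int) = a := by
  cases a with
  | ofNat n => rfl
  | negSucc n => exact absurd h (by simp [Int.negSucc_not_nonneg])

theorem subNat_eq (m n : Nat) : subNat m n = (m : Int) - n := by
  unfold subNat
  change Nat.rec (motive := fun _ => Int) (Int.ofNat (Nat.sub m n)) (fun k _ => Int.negSucc k)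
    (n - m) = _
  rcases h : n - m with _ | k
  · change ((m - n : Nat) : Int) = _
    omega
  · change Int.negSucc k = _
    rw [Int.negSucc_eq]
    omega

theorem ineg_eq (a : Int) : ineg a = -a := by
  cases a with
  | ofNat n => exact (subNat_eq 0 n).trans (by simp)
  | negSucc n => rfl

theorem iadd_eq (a b : Int) : iadd a b = a + b := by
  rcases a with m | m <;> rcases b with n | n
  · rfl
  · exact (subNat_eq m (n + 1)).trans (by simp [Int.negSucc_eq]; ring)
  · exact (subNat_eq n (m + 1)).trans (by simp [Int.negSucc_eq]; ring)
  · change Int.negSucc (m + n + 1) = _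
    simp only [Int.negSucc_eq]; push_cast; ring

theorem isub_eq (a b : Int) : isub a b = a - b := by
  rw [isub, iadd_eq, ineg_eq, sub_eq_add_neg]

theorem imul_eq (a b : Int) : imul a b = a * b := by
  rcases a with m | m <;> rcases b with n | n
  · rfl
  · refine (subNat_eq 0 (m * (n + 1))).trans ?_
    simp only [Int.negSucc_eq, Int.ofNat_eq_natCast]; push_cast; ring
  · refine (subNat_eq 0 ((m + 1) * n)).trans ?_
    simp only [Int.negSucc_eq, Int.ofNat_eq_natCast]; push_cast; ring
  · change (((m + 1) * (n + 1) : Nat) : Int) = _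
    simp only [Int.negSucc_eq]; push_cast; ring

theorem imax_eq (a b : Int) : imax a b = max a b := by
  rw [imax, choose_isNonneg, isub_eq]
  split <;> omega

theorem imin_eq (a b : Int) : imin a b = min a b := by
  rw [imin, choose_isNonneg, isub_eq]
  split <;> omega

theorem floorDiv_mul_le (a : Int) {b : Nat} (hb : 0 < b) : floorDiv a b * b ≤ a := by
  rcases a with m | m
  · change ((m / b : Nat) : Int) * b ≤ (m : Int)
    exact_mod_cast Nat.div_mul_le_self m b
  · change Int.negSucc (m / b) * b ≤ Int.negSucc m
    have h := Nat.lt_mul_div_succ m hb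
    have h' : (m : Int) + 1 ≤ b * ((m / b : Nat) + 1) := by exact_mod_cast h
    simp only [Int.negSucc_eq]
    linarith

theorem floorDiv_le {a : Int} {b : Nat} (hb : 0 < b) {x : ℝ} (h : (a : ℝ) ≤ b * x) :
    (floorDiv a b : ℝ) ≤ x := by
  have h1 : (floorDiv a b : ℝ) * b ≤ a := by exact_mod_cast floorDiv_mul_le a hb
  have hb' : (0 : ℝ) < b := by exact_mod_cast hb
  nlinarith

theorem le_ceilDiv {a : Int} {b : Nat} (hb : 0 < b) {x : ℝ} (h : b * x ≤ a) :
    x ≤ (ceilDiv a b : ℝ) := by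
  have h1 : (floorDiv (ineg a) b : ℝ) ≤ -x :=
    floorDiv_le hb (by rw [ineg_eq]; push_cast; linarith)
  rw [ceilDiv, ineg_eq]
  push_cast
  linarith

theorem mul_mem_corners {a b c d x y : ℝ} (h1 : a ≤ x) (h2 : x ≤ b) (h3 : c ≤ y) (h4 : y ≤ d) :
    min (min (a * c) (a * d)) (min (b * c) (b * d)) ≤ x * y ∧
      x * y ≤ max (max (a * c) (a * d)) (max (b * c) (b * d)) := by
  have key : ∀ z : ℝ, min (z * c) (z * d) ≤ z * y ∧ z * y ≤ max (z * c) (z * d) := by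
    intro z
    rcases le_total 0 z with hz | hz
    · exact ⟨(min_le_left _ _).trans (mul_le_mul_of_nonneg_left h3 hz),
        (mul_le_mul_of_nonneg_left h4 hz).trans (le_max_right _ _)⟩
    · exact ⟨(min_le_right _ _).trans (mul_le_mul_of_nonpos_left h4 hz),
        (mul_le_mul_of_nonpos_left h3 hz).trans (le_max_left _ _)⟩
  rcases le_total 0 y with hy | hy
  · exact ⟨(min_le_left _ _).trans ((key a).1.trans (mul_le_mul_of_nonneg_right h1 hy)),
      (mul_le_mul_of_nonneg_right h2 hy).trans ((key b).2.trans (le_max_right _ _))⟩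
  · exact ⟨(min_le_right _ _).trans ((key b).1.trans (mul_le_mul_of_nonpos_right h2 hy)),
      (mul_le_mul_of_nonpos_right h1 hy).trans ((key a).2.trans (le_max_left _ _))⟩

theorem Itv.Mem.mul {I J : Itv} {x y : ℝ} (hx : I.Mem x) (hy : J.Mem y) :
    (mulItv I J).Mem (x * y) := by
  obtain ⟨h1, h2⟩ := hx
  obtain ⟨h3, h4⟩ := hy
  have e : ((1000000 : Nat) : ℝ) * (1000000 * (x * y)) = (1000000 * x) * (1000000 * y) := by
    push_cast; ring
  have p : (0 : Nat) < 1000000 := by norm_num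
  unfold mulItv
  have hc : ∀ x y : Int, choose (isNonneg x) (isNonneg y) false = true ↔ 0 ≤ x ∧ 0 ≤ y := by
    intro x y
    rw [choose_isNonneg, ← isNonneg_iff y]
    by_cases hx : 0 ≤ x <;> simp [hx]
  rw [choose_eq]
  split
  · rename_i h
    rw [hc] at h
    have a1 : (0 : ℝ) ≤ I.lo := by exact_mod_cast h.1
    have a2 : (0 : ℝ) ≤ J.lo := by exact_mod_cast h.2
    refine ⟨floorDiv_le p ?_, le_ceilDiv p ?_⟩ <;> rw [e] <;> simp only [imul_eq] <;> push_cast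
    · exact mul_le_mul h1 h3 a2 (a1.trans h1)
    · exact mul_le_mul h2 h4 (a2.trans h3) ((a1.trans h1).trans h2)
  · have := mul_mem_corners h1 h2 h3 h4
    refine ⟨floorDiv_le p ?_, le_ceilDiv p ?_⟩ <;> rw [e] <;>
      simp only [imax_eq, imin_eq, imul_eq] <;> push_cast
    · exact this.1
    · exact this.2

theorem Itv.Mem.abs {I : Itv} {x : ℝ} (hx : I.Mem x) : (absItv I).Mem |x| := by
  obtain ⟨h1, h2⟩ := hx
  have e : 1000000 * |x| = |1000000 * x| := by rw [abs_mul]; norm_num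
  unfold absItv Itv.Mem
  rw [e]
  simp only [imax_eq, ineg_eq]
  push_cast
  exact ⟨max_le (abs_nonneg _) (max_le (h1.trans (le_abs_self _))
    ((neg_le_neg h2).trans (neg_le_abs _))), abs_le_max_abs_abs' h1 h2⟩
where
  abs_le_max_abs_abs' {a b z : ℝ} (h1 : a ≤ z) (h2 : z ≤ b) : |z| ≤ max b (-a) :=
    abs_le'.2 ⟨h2.trans (le_max_left _ _), (neg_le_neg h1).trans (le_max_right _ _)⟩

theorem absItv_lo_nonneg (I : Itv) : 0 ≤ (absItv I).lo := by
  simp [absItv, imax_eq]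

theorem Itv.Mem.sq {I : Itv} {x : ℝ} (hx : I.Mem x) : (sqItv I).Mem (x ^ 2) := by
  obtain ⟨h1, h2⟩ := hx.abs
  have h0 : (0 : ℝ) ≤ (absItv I).lo := by exact_mod_cast absItv_lo_nonneg I
  have e : ((1000000 : Nat) : ℝ) * (1000000 * x ^ 2) = (1000000 * |x|) * (1000000 * |x|) := by
    rw [← sq_abs x]; push_cast; ring
  have p : (0 : Nat) < 1000000 := by norm_num
  refine ⟨floorDiv_le p ?_, le_ceilDiv p ?_⟩ <;> rw [e, imul_eq] <;> push_cast
  · exact mul_le_mul h1 h1 h0 (h0.trans h1)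
  · exact mul_le_mul h2 h2 (h0.trans h1) ((h0.trans h1).trans h2)

theorem cast_natSub {a b : Nat} {c : ℝ} (h : (b : ℝ) ≤ c) (ha : (a : ℝ) = c) :
    ((Nat.sub a b : Nat) : ℝ) = c - b := by
  have h' : b ≤ a := by rw [← ha] at h; exact_mod_cast h
  rw [← ha, ← Nat.cast_sub h']
  rfl

theorem cast_natMul (a b : Nat) : ((Nat.mul a b : Nat) : ℝ) = a * b := Nat.cast_mul a b

theorem cosLo_le {n : Nat} {x : ℝ} (h : (n : ℝ) = 1000000 * x) (hn : n ≤ 3141592) :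
    (cosLo (Nat.mul n n) : ℝ) ≤ 1000000 * Real.cos x := by
  refine floorDiv_le (by norm_num) ?_
  have hu : ((Nat.mul n n : Nat) : ℝ) = (1000000 * x) ^ 2 := by rw [cast_natMul, h]; ring
  have hv : ((Nat.mul n n : Nat) : ℝ) ≤ 10 * 10 ^ 12 := by
    have : (n : ℝ) ≤ 3141592 := by exact_mod_cast hn
    rw [cast_natMul]
    nlinarith [(Nat.cast_nonneg n : (0 : ℝ) ≤ n)]
  generalize Nat.mul n n = u at hu hv
  have hu0 : (0 : ℝ) ≤ u := Nat.cast_nonneg u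
  -- Truncated subtraction is harmless in this Horner scheme: since x² ≤ 10, every inner bracket
  -- lies between 0 and its constant, and ten times that constant is at most the next one.
  have step : ∀ (v : Nat) (w c M : ℝ), (v : ℝ) = w → w ≤ M → 10 * 10 ^ 12 * M ≤ c → ∀ a : Nat,
      (a : ℝ) = c → ((Nat.sub a (Nat.mul u v) : Nat) : ℝ) = c - u * w ∧ c - u * w ≤ c := by
    intro v w c M hvw hM hc a ha
    have hw : 0 ≤ w := hvw ▸ Nat.cast_nonneg v
    have h1 : (u : ℝ) * w ≤ c := (mul_le_mul hv hM hw (by norm_num)).trans hc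
    refine ⟨?_, by nlinarith⟩
    rw [cast_natSub (by rw [cast_natMul, hvw]; exact h1) ha, cast_natMul, hvw]
  have e1 := cast_natSub (a := 90 * 10 ^ 12) (c := 90 * 10 ^ 12)
    (hv.trans (by norm_num)) (by norm_num)
  have e2 := step _ _ (5040 * 10 ^ 24) (90 * 10 ^ 12) e1 (by linarith) (by norm_num)
    (5040 * 10 ^ 24) (by norm_num)
  have e3 := step _ _ (151200 * 10 ^ 36) (5040 * 10 ^ 24) e2.1 e2.2 (by norm_num)
    (151200 * 10 ^ 36) (by norm_num)
  have e4 := step _ _ (1814400 * 10 ^ 48) (151200 * 10 ^ 36) e3.1 e3.2 (by norm_num)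
    (1814400 * 10 ^ 48) (by norm_num)
  rw [subNat_eq, Int.cast_sub, Int.cast_natCast, Int.cast_natCast, cast_natMul u, e4.1, hu]
  push_cast
  have := cos_lower x
  linear_combination (3628800 * 10 ^ 60 : ℝ) * this

theorem le_cosHi {n : Nat} {x : ℝ} (h : (n : ℝ) = 1000000 * x) (hn : n ≤ 3141592) :
    1000000 * Real.cos x ≤ cosHi (Nat.mul n n) := by
  refine le_ceilDiv (by norm_num) ?_
  have hu : ((Nat.mul n n : Nat) : ℝ) = (1000000 * x) ^ 2 := by rw [cast_natMul, h]; ring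
  have hv : ((Nat.mul n n : Nat) : ℝ) ≤ 10 * 10 ^ 12 := by
    have : (n : ℝ) ≤ 3141592 := by exact_mod_cast hn
    rw [cast_natMul]
    nlinarith [(Nat.cast_nonneg n : (0 : ℝ) ≤ n)]
  generalize Nat.mul n n = u at hu hv
  have hu0 : (0 : ℝ) ≤ u := Nat.cast_nonneg u
  have step : ∀ (v : Nat) (w c M : ℝ), (v : ℝ) = w → w ≤ M → 10 * 10 ^ 12 * M ≤ c → ∀ a : Nat,
      (a : ℝ) = c → ((Nat.sub a (Nat.mul u v) : Nat) : ℝ) = c - u * w ∧ c - u * w ≤ c := by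
    intro v w c M hvw hM hc a ha
    have hw : 0 ≤ w := hvw ▸ Nat.cast_nonneg v
    have h1 : (u : ℝ) * w ≤ c := (mul_le_mul hv hM hw (by norm_num)).trans hc
    refine ⟨?_, by nlinarith⟩
    rw [cast_natSub (by rw [cast_natMul, hvw]; exact h1) ha, cast_natMul, hvw]
  have e1 := cast_natSub (a := 132 * 10 ^ 12) (c := 132 * 10 ^ 12)
    (hv.trans (by norm_num)) (by norm_num)
  have e2 := step _ _ (11880 * 10 ^ 24) (132 * 10 ^ 12) e1 (by linarith) (by norm_num)
    (11880 * 10 ^ 24) (by norm_num)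
  have e3 := step _ _ (665280 * 10 ^ 36) (11880 * 10 ^ 24) e2.1 e2.2 (by norm_num)
    (665280 * 10 ^ 36) (by norm_num)
  have e4 := step _ _ (19958400 * 10 ^ 48) (665280 * 10 ^ 36) e3.1 e3.2 (by norm_num)
    (19958400 * 10 ^ 48) (by norm_num)
  have e5 := step _ _ (239500800 * 10 ^ 60) (19958400 * 10 ^ 48) e4.1 e4.2 (by norm_num)
    (239500800 * 10 ^ 60) (by norm_num)
  rw [subNat_eq, Int.cast_sub, Int.cast_natCast, Int.cast_natCast, cast_natMul u, e5.1, hu]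
  push_cast
  have := cos_upper x
  linear_combination (479001600 * 10 ^ 72 : ℝ) * this

theorem Itv.Mem.cos {I : Itv} {x : ℝ} (hx : I.Mem x) : (cosItv I).Mem (Real.cos x) := by
  obtain ⟨h1, h2⟩ := hx.abs
  have h0' := absItv_lo_nonneg I
  have h0 : (0 : ℝ) ≤ (absItv I).lo := by exact_mod_cast h0'
  have hle : (absItv I).lo ≤ (absItv I).hi := by exact_mod_cast h1.trans h2
  unfold cosItv
  rw [choose_isNonneg, ← Real.cos_abs x, isub_eq]
  split
  · rename_i h
    have hh : (absItv I).hi ≤ 3141592 := sub_nonneg.1 h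
    have n1 := toNat_eq _ h0'
    have n2 := toNat_eq _ (h0'.trans hle)
    have c1 : (toNat (absItv I).lo : ℝ) = (absItv I).lo := by exact_mod_cast n1
    have c2 : (toNat (absItv I).hi : ℝ) = (absItv I).hi := by exact_mod_cast n2
    have h3 : ((absItv I).hi : ℝ) ≤ 3141592 := by exact_mod_cast hh
    have hpi := Real.pi_gt_d6
    have m1 := Real.cos_le_cos_of_nonneg_of_le_pi (x := ((absItv I).lo : ℝ) / 1000000) (y := |x|)
      (by positivity) (by linarith) (by linarith)
    have m2 := Real.cos_le_cos_of_nonneg_of_le_pi (x := |x|) (y := ((absItv I).hi : ℝ) / 1000000)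
      (abs_nonneg x) (by linarith) (by linarith)
    constructor
    · have := cosLo_le (n := toNat (absItv I).hi) (x := ((absItv I).hi : ℝ) / 1000000)
        (by rw [c2]; ring) (by omega)
      simp only
      linarith
    · have := le_cosHi (n := toNat (absItv I).lo) (x := ((absItv I).lo : ℝ) / 1000000)
        (by rw [c1]; ring) (by omega)
      simp only
      linarith
  · constructor
    · have := Real.neg_one_le_cos |x|
      simp only; push_cast; linarith
    · have := Real.cos_le_one |x|
      simp only; push_cast; linarith

theorem Itv.Mem.ratio {I J : Itv} {x y : ℝ} (hx : I.Mem x) (hy : J.Mem y) :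
    (ratioItv I J).Mem (max 0 (min 1 (x / y))) := by
  refine ⟨?_, ?_⟩
  · simp only [ratioItv]
    rw [choose_isNonneg, isub_eq]
    split
    · rename_i h
      have hJ : (1 : ℝ) ≤ J.lo := by
        have : 1 ≤ J.lo := by omega
        exact_mod_cast this
      have hy' : 0 < y := by linarith [hy.1]
      have hJ2 : (0 : ℝ) < J.hi := by linarith [hy.1, hy.2]
      have hJ3 : 0 < J.hi := by exact_mod_cast hJ2
      have hN : (toNat J.hi : ℝ) = J.hi := by exact_mod_cast toNat_eq J.hi hJ3.le
      have hN' : 0 < toNat J.hi := by have := toNat_eq J.hi hJ3.le; omega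
      simp only [imax_eq, imin_eq, imul_eq, Int.cast_min]
      rw [mul_max_of_nonneg (0 : ℝ) (min 1 (x / y)) (by norm_num : (0 : ℝ) ≤ 1000000), mul_zero,
        mul_min_of_nonneg (1 : ℝ) (x / y) (by norm_num), mul_one]
      rcases le_total I.lo 0 with hI | hI
      · refine le_max_of_le_left ((min_le_right _ _).trans ?_)
        exact floorDiv_le hN' (by simp [hI])
      · refine le_max_of_le_right (min_le_min (by norm_num) (floorDiv_le hN' ?_))
        rw [max_eq_right hI, hN]
        push_cast
        have hI' : (0 : ℝ) ≤ I.lo := by exact_mod_cast hI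
        rw [show (J.hi : ℝ) * (1000000 * (x / y)) = 1000000 * (x * J.hi) / y by ring,
          le_div_iff₀ hy']
        have h1 := mul_le_mul_of_nonneg_right hx.1 hJ2.le
        have h2 := mul_le_mul_of_nonneg_left hy.2 hI'
        nlinarith
    · push_cast; positivity
  · simp only [ratioItv]
    rw [choose_isNonneg, isub_eq]
    have hone : (1000000 : ℝ) * max 0 (min 1 (x / y)) ≤ 1000000 := by
      have : max 0 (min 1 (x / y)) ≤ 1 := max_le zero_le_one (min_le_left _ _)
      linarith
    split
    · rename_i h
      have hJ : 0 < J.lo := by omega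
      have hJ' : (0 : ℝ) < J.lo := by exact_mod_cast hJ
      have hy' : 0 < y := by linarith [hy.1]
      have hN : (toNat J.lo : ℝ) = J.lo := by exact_mod_cast toNat_eq J.lo hJ.le
      have hN' : 0 < toNat J.lo := by have := toNat_eq J.lo hJ.le; omega
      simp only [imax_eq, imin_eq, imul_eq]
      push_cast
      rw [mul_max_of_nonneg _ _ (by norm_num), mul_zero]
      refine max_le_max le_rfl ?_
      rw [mul_min_of_nonneg _ _ (by norm_num), mul_one]
      refine min_le_min le_rfl (le_ceilDiv hN' ?_)
      rw [hN]
      push_cast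
      have hI : 1000000 * x ≤ max 0 (I.hi : ℝ) := hx.2.trans (le_max_right _ _)
      have hI0 : 0 ≤ max 0 (I.hi : ℝ) := le_max_left _ _
      rw [show (J.lo : ℝ) * (1000000 * (x / y)) = 1000000 * (x * J.lo) / y by ring,
        div_le_iff₀ hy']
      have h1 := mul_le_mul_of_nonneg_right hI hJ'.le
      have h2 := mul_le_mul_of_nonneg_left hy.1 hI0
      nlinarith
    · push_cast
      exact hone

theorem getItv_mem {box : List Itv} {xs : List ℝ} (h : List.Forall₂ Itv.Mem box xs) (i : Nat) :
    (getItv box i).Mem (xs.getD i 0) := by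
  induction h generalizing i with
  | nil => simp [getItv, Itv.Mem]
  | cons h _ ih =>
    cases i with
    | zero => simpa [getItv] using h
    | succ i => simpa [getItv] using ih i

theorem Term.eval_mem {box : List Itv} {xs : List ℝ} (h : List.Forall₂ Itv.Mem box xs)
    (t : Term) : (t.eval box).Mem (t.val xs) := by
  induction t with
  | var i => exact getItv_mem h i
  | const n =>
    constructor <;> simp only [Term.eval, Term.val] <;> linarith
  | add a b iha ihb =>
    obtain ⟨h1, h2⟩ := iha
    obtain ⟨h3, h4⟩ := ihb
    simp only [Term.eval, Term.val, iadd_eq, isub_eq] at *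
    constructor <;> push_cast <;> linarith
  | sub a b iha ihb =>
    obtain ⟨h1, h2⟩ := iha
    obtain ⟨h3, h4⟩ := ihb
    simp only [Term.eval, Term.val, iadd_eq, isub_eq] at *
    constructor <;> push_cast <;> linarith
  | mul a b iha ihb => exact iha.mul ihb
  | sq a ih => exact ih.sq
  | cos a ih => exact ih.cos
  | ratio a b iha ihb => exact iha.ratio ihb

theorem exists_neg_of_someNeg {box : List Itv} {xs : List ℝ}
    (h : List.Forall₂ Itv.Mem box xs) : ∀ {cs : List Term}, someNeg box cs = true →
      ∃ t ∈ cs, t.val xs < 0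
  | [], hc => by simp [someNeg] at hc
  | t :: cs, hc => by
    have hc' : choose (isNonneg (t.eval box).hi) (someNeg box cs) true = true := hc
    rw [choose_isNonneg] at hc'
    split at hc'
    · obtain ⟨u, hu, hv⟩ := exists_neg_of_someNeg h hc'
      exact ⟨u, List.mem_cons_of_mem _ hu, hv⟩
    · rename_i hn
      have h1 := (t.eval_mem h).2
      have h2 : ((t.eval box).hi : ℝ) < 0 := by exact_mod_cast not_le.1 hn
      exact ⟨t, List.mem_cons_self, by linarith⟩

theorem halves_cover (w : Int) {box : List Itv} {xs : List ℝ}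
    (h : List.Forall₂ Itv.Mem box xs) : List.Forall₂ Itv.Mem (halves w box).1 xs ∨
      List.Forall₂ Itv.Mem (halves w box).2 xs := by
  induction h with
  | nil => exact Or.inl .nil
  | @cons I x l xs hx hl ih =>
    have e : halves w (I :: l) = choose (isNonneg (isub (isub I.hi I.lo) w))
      (⟨I.lo, floorDiv (iadd I.lo I.hi) 2⟩ :: l, ⟨floorDiv (iadd I.lo I.hi) 2, I.hi⟩ :: l)
      (I :: (halves w l).1, I :: (halves w l).2) := rfl
    rw [e, choose_isNonneg]
    split
    · rcases le_total (1000000 * x) (floorDiv (iadd I.lo I.hi) 2 : ℝ) with hm | hm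
      · exact Or.inl (.cons ⟨hx.1, hm⟩ hl)
      · exact Or.inr (.cons ⟨hm, hx.2⟩ hl)
    · exact ih.imp (fun h => .cons hx h) (fun h => .cons hx h)

/-- In each application the terms are quantities whose nonnegativity follows from the geometric
hypotheses, so a successful check is a contradiction. -/
theorem exists_neg_of_check {cs : List Term} {n : Nat} {box : List Itv} {xs : List ℝ}
    (hc : check cs n box = true) (h : List.Forall₂ Itv.Mem box xs) : ∃ t ∈ cs, t.val xs < 0 := by
  induction n generalizing box with
  | zero => simp [check] at hc
  | succ n ih =>
    have hc' : choose (someNeg box cs) true (choose (check cs n (halves (maxWidth box) box).1)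
      (check cs n (halves (maxWidth box) box).2) false) = true := hc
    rw [choose_eq, choose_eq] at hc'
    split at hc'
    · rename_i hs
      exact exists_neg_of_someNeg h hs
    · split at hc'
      · rename_i h1
        exact (halves_cover _ h).elim (ih h1) (ih hc')
      · simp at hc'

/-! ### Configurations in polar coordinates -/

/-- Polar coordinates `(d i, θ i)` and radii `r i` of pairwise touching disks around a disk of
radius `1` at the origin, such that no disk contains the centre of another one in its interior. -/
structure Config {ι : Type*} (d r θ : ι → ℝ) : Prop where
  one_le_d : ∀ i, 1 ≤ d i
  one_le_r : ∀ i, 1 ≤ r i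
  r_le : ∀ i, r i ≤ d i
  sub_le : ∀ i, d i - 1 ≤ r i
  sq_le : ∀ i j, i ≠ j → r i ^ 2 ≤ d i ^ 2 + d j ^ 2 - 2 * d i * d j * Real.cos (θ i - θ j)
  le_sq : ∀ i j, i ≠ j → d i ^ 2 + d j ^ 2 - 2 * d i * d j * Real.cos (θ i - θ j) ≤
    (r i + r j) ^ 2

theorem Config.comp {ι κ : Type*} {d r θ : ι → ℝ} (h : Config d r θ) (f : κ → ι)
    (hf : Function.Injective f) : Config (d ∘ f) (r ∘ f) (θ ∘ f) where
  one_le_d _ := h.one_le_d _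
  one_le_r _ := h.one_le_r _
  r_le _ := h.r_le _
  sub_le _ := h.sub_le _
  sq_le _ _ hij := h.sq_le _ _ (hf.ne hij)
  le_sq _ _ hij := h.le_sq _ _ (hf.ne hij)

theorem Config.congr {ι : Type*} {d r θ θ' : ι → ℝ} (h : Config d r θ)
    (hc : ∀ i j, Real.cos (θ' i - θ' j) = Real.cos (θ i - θ j)) : Config d r θ' where
  one_le_d := h.one_le_d
  one_le_r := h.one_le_r
  r_le := h.r_le
  sub_le := h.sub_le
  sq_le i j hij := by rw [hc]; exact h.sq_le i j hij
  le_sq i j hij := by rw [hc]; exact h.le_sq i j hij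

/-- If `x` has a nearer point in almost the same direction, then no point nearer than that one is
almost opposite to `x`. -/
theorem Config.neg_le_cos {ι : Type*} {d r θ : ι → ℝ} (h : Config d r θ) {x y w : ι}
    (hxy : x ≠ y) (hxw : x ≠ w) (hd : d y ≤ d x) (hw : d w ≤ d y)
    (hc : 0.814 ≤ Real.cos (θ x - θ y)) : -0.297 ≤ Real.cos (θ x - θ w) := by
  have h1 := h.sq_le x y hxy
  have h2 := h.le_sq x w hxw
  have hx1 := h.one_le_d x
  have hy1 := h.one_le_d y
  have hw1 := h.one_le_d w
  have hrw := h.r_le w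
  have hrw1 := h.one_le_r w
  have hrx1 := h.one_le_r x
  set X := d x
  set Y := d y
  set W := d w
  set R := r x
  have hR2 : R ^ 2 ≤ X ^ 2 + Y ^ 2 - 2 * X * Y * 0.814 := by
    nlinarith [mul_pos (by linarith : 0 < X) (by linarith : 0 < Y)]
  -- A linear majorant of √(X² + Y² - 1.628XY) on 0 ≤ Y ≤ X, nearly tight at Y = X because 1.111² =
  -- 1.234321.
  have hR : R ≤ 1.111 * X - Y / 2 := by
    refine (abs_le.1 (abs_le_of_sq_le_sq ?_ (by linarith))).2
    nlinarith [mul_nonneg (by linarith : 0 ≤ Y) (sub_nonneg.2 hd), sq_nonneg (X - Y)]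
  have h3 : X ^ 2 + W ^ 2 - 2 * X * W * Real.cos (θ x - θ w) ≤ (R + W) ^ 2 :=
    h2.trans (pow_le_pow_left₀ (by linarith) (by linarith) 2)
  by_contra hcon
  have h4 : -2 * X * W * Real.cos (θ x - θ w) > 0.594 * X * W := by
    nlinarith [mul_pos (by linarith : 0 < X) (by linarith : 0 < W)]
  have h5 : X ^ 2 + 0.594 * X * W < R ^ 2 + 2 * R * W := by nlinarith
  -- Inserting both bounds on R, and 2·1.111 - 0.594 = 1.628, leaves 0 < (Y - W)(Y - 1.628X),
  -- impossible for W ≤ Y ≤ X.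
  nlinarith [mul_le_mul_of_nonneg_right hR (by linarith : 0 ≤ W),
    mul_nonneg (by linarith : 0 ≤ Y) (sub_nonneg.2 hw),
    mul_nonneg (by linarith : 0 ≤ W) (sub_nonneg.2 hw),
    mul_nonneg (by linarith : 0 ≤ X) (sub_nonneg.2 hw)]

/-! ### Two narrow pairs in opposite directions -/

/-- An upper bound for `√(1 - 2 * t * cos 55° + t ^ 2)`. -/
noncomputable def chordBound (t : ℝ) : ℝ := 0.555556 * ((t - 0.573574) ^ 2 + 1.481014)

/-- An upper bound for the radius of the nearer point of a pair, relative to its distance. -/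
noncomputable def nearBound (t : ℝ) : ℝ := max 0 (min 1 (chordBound t / t))

/-- The arithmetic-geometric mean inequality 2·r·(0.9x) ≤ r² + 0.81x² replaces the square root by a
quadratic polynomial; 0.555556 rounds up 1/1.8 and 1.481014 rounds up 1 - 0.573574² + 0.81. -/
theorem le_mul_chordBound {x y r : ℝ} (hx : 0 < x)
    (h : r ^ 2 ≤ x ^ 2 + y ^ 2 - 2 * x * y * 0.573574) : r ≤ x * chordBound (y / x) := by
  have e : x * chordBound (y / x) = 0.555556 * ((y - 0.573574 * x) ^ 2 + 1.481014 * x ^ 2) / x := by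
    unfold chordBound; field_simp
  rw [e, le_div_iff₀ hx]
  nlinarith [sq_nonneg (r - 0.9 * x)]

theorem le_mul_nearBound {x y r : ℝ} (hx : 0 < x) (hy : 0 < y) (hr : r ≤ y)
    (h : r ^ 2 ≤ x ^ 2 + y ^ 2 - 2 * x * y * 0.573574) : r ≤ y * nearBound (y / x) := by
  have h1 := le_mul_chordBound hx h
  have h2 : r ≤ y * min 1 (chordBound (y / x) / (y / x)) := by
    rw [mul_min_of_nonneg _ _ hy.le, mul_one]
    refine le_min hr (h1.trans_eq ?_)
    field_simp
  exact h2.trans (mul_le_mul_of_nonneg_left (le_max_right _ _) hy.le)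

/-- Expand (r₁ + r₂)², bound the squares through the β's and the product through the α's, then
halve. In the applications -k is the cosine of the angle between the two points. -/
theorem contact_bound {d₁ d₂ r₁ r₂ α₁ α₂ β₁ β₂ k : ℝ} (h1 : 0 ≤ r₁) (h2 : 0 ≤ r₂)
    (hα1 : r₁ ≤ d₁ * α₁) (hα2 : r₂ ≤ d₂ * α₂) (hβ1 : r₁ ^ 2 ≤ d₁ ^ 2 * (1 - 2 * β₁))
    (hβ2 : r₂ ^ 2 ≤ d₂ ^ 2 * (1 - 2 * β₂))
    (h : d₁ ^ 2 + d₂ ^ 2 + 2 * d₁ * d₂ * k ≤ (r₁ + r₂) ^ 2) :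
    0 ≤ (α₁ * α₂ - k) * (d₁ * d₂) - β₁ * d₁ ^ 2 - β₂ * d₂ ^ 2 := by
  have := mul_le_mul hα1 hα2 h2 (h1.trans hα1)
  linarith

/-- A point `y` and a point `x` that is not nearer, seen under an angle of at most `55°`. -/
structure NarrowPair (x y rx ry : ℝ) : Prop where
  pos : 0 < y
  le : y ≤ x
  far_nonneg : 0 ≤ rx
  near_nonneg : 0 ≤ ry
  near_le : ry ≤ y
  far_sq_le : rx ^ 2 ≤ x ^ 2 + y ^ 2 - 2 * x * y * 0.573574
  near_sq_le : ry ^ 2 ≤ x ^ 2 + y ^ 2 - 2 * x * y * 0.573574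

/-! ### Contact inequalities in scale-free variables -/

section contacts

variable {x y z w rx ry rz rw k : ℝ}

/-- Dividing `contact_bound` by a positive factor leaves only y/x, w/z and the share y/(y+w), all in
[0, 1]. This compactness makes the four contact inequalities accessible to branch and bound. For a
nearer point the trivial bound `rw ≤ w` is used here. -/
theorem NarrowPair.far_near (hP : NarrowPair x y rx ry) (hQ : NarrowPair z w rz rw)
    (h : x ^ 2 + w ^ 2 + 2 * x * w * k ≤ (rx + rw) ^ 2) :
    0 ≤ (chordBound (y / x) - k) * (1 - y / (y + w)) -
      y / (y + w) * (0.573574 - 0.5 * (y / x)) := by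
  have hx := hP.pos.trans_le hP.le
  have hy := hP.pos
  have hw := hQ.pos
  have := contact_bound (α₂ := 1) (β₂ := 0) (β₁ := y / x * (0.573574 - 0.5 * (y / x)))
    hP.far_nonneg hQ.near_nonneg (le_mul_chordBound hx hP.far_sq_le)
    (by linarith [hQ.near_le]) (hP.far_sq_le.trans_eq (by field_simp; ring))
    (by nlinarith [hQ.near_le, hQ.near_nonneg]) h
  have e : (chordBound (y / x) * 1 - k) * (x * w) - y / x * (0.573574 - 0.5 * (y / x)) * x ^ 2
      - 0 * w ^ 2 = x * (y + w) * ((chordBound (y / x) - k) * (1 - y / (y + w)) -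
      y / (y + w) * (0.573574 - 0.5 * (y / x))) := by
    field_simp
    ring
  rw [e] at this
  exact nonneg_of_mul_nonneg_right this (by positivity)

theorem NarrowPair.near_far (hP : NarrowPair x y rx ry) (hQ : NarrowPair z w rz rw)
    (h : y ^ 2 + z ^ 2 + 2 * y * z * k ≤ (ry + rz) ^ 2) :
    0 ≤ (chordBound (w / z) - k) * (y / (y + w)) -
      (1 - y / (y + w)) * (0.573574 - 0.5 * (w / z)) := by
  have hy := hP.pos
  have hw := hQ.pos
  have := hQ.far_near hP (k := k) (by linarith)
  have e : w / (w + y) = 1 - y / (y + w) := by field_simp; ring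
  rw [e] at this
  linarith

theorem NarrowPair.far_far (hP : NarrowPair x y rx ry) (hQ : NarrowPair z w rz rw)
    (h : x ^ 2 + z ^ 2 + 2 * x * z * k ≤ (rx + rz) ^ 2) :
    0 ≤ (chordBound (y / x) * chordBound (w / z) - k) * (y / (y + w) * (1 - y / (y + w))) -
      ((0.573574 - 0.5 * (y / x)) * (w / z) * (y / (y + w)) ^ 2 +
        (0.573574 - 0.5 * (w / z)) * (y / x) * (1 - y / (y + w)) ^ 2) := by
  have hx := hP.pos.trans_le hP.le
  have hz := hQ.pos.trans_le hQ.le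
  have hy := hP.pos
  have hw := hQ.pos
  have := contact_bound (β₁ := y / x * (0.573574 - 0.5 * (y / x)))
    (β₂ := w / z * (0.573574 - 0.5 * (w / z)))
    hP.far_nonneg hQ.far_nonneg (le_mul_chordBound hx hP.far_sq_le)
    (le_mul_chordBound hz hQ.far_sq_le) (hP.far_sq_le.trans_eq (by field_simp; ring))
    (hQ.far_sq_le.trans_eq (by field_simp; ring)) h
  generalize chordBound (y / x) * chordBound (w / z) - k = C at *
  have e : C * (x * z) - y / x * (0.573574 - 0.5 * (y / x)) * x ^ 2
      - w / z * (0.573574 - 0.5 * (w / z)) * z ^ 2 = x * z * (y + w) ^ 2 / (y * w) *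
      (C * (y / (y + w) * (1 - y / (y + w))) -
      ((0.573574 - 0.5 * (y / x)) * (w / z) * (y / (y + w)) ^ 2 +
        (0.573574 - 0.5 * (w / z)) * (y / x) * (1 - y / (y + w)) ^ 2)) := by
    field_simp
    ring
  rw [e] at this
  exact nonneg_of_mul_nonneg_right this (by positivity)

theorem NarrowPair.near_near (hP : NarrowPair x y rx ry) (hQ : NarrowPair z w rz rw)
    (h : y ^ 2 + w ^ 2 + 2 * y * w * k ≤ (ry + rw) ^ 2) :
    0 ≤ (nearBound (y / x) * nearBound (w / z) - k) * (y / (y + w) * (1 - y / (y + w))) -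
      0.5 * ((1 - nearBound (y / x) ^ 2) * (y / (y + w)) ^ 2 +
        (1 - nearBound (w / z) ^ 2) * (1 - y / (y + w)) ^ 2) := by
  have hx := hP.pos.trans_le hP.le
  have hz := hQ.pos.trans_le hQ.le
  have hy := hP.pos
  have hw := hQ.pos
  have hy' := le_mul_nearBound hx hy hP.near_le hP.near_sq_le
  have hw' := le_mul_nearBound hz hw hQ.near_le hQ.near_sq_le
  have := contact_bound (β₁ := (1 - nearBound (y / x) ^ 2) / 2)
    (β₂ := (1 - nearBound (w / z) ^ 2) / 2)
    hP.near_nonneg hQ.near_nonneg hy' hw'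
    ((pow_le_pow_left₀ hP.near_nonneg hy' 2).trans_eq (by ring))
    ((pow_le_pow_left₀ hQ.near_nonneg hw' 2).trans_eq (by ring)) h
  generalize nearBound (y / x) * nearBound (w / z) - k = C at *
  generalize nearBound (y / x) ^ 2 = K at *
  generalize nearBound (w / z) ^ 2 = K' at *
  have e : C * (y * w) - (1 - K) / 2 * y ^ 2 - (1 - K') / 2 * w ^ 2 = (y + w) ^ 2 *
      (C * (y / (y + w) * (1 - y / (y + w))) - 0.5 * ((1 - K) * (y / (y + w)) ^ 2 +
        (1 - K') * (1 - y / (y + w)) ^ 2)) := by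
    field_simp
    ring
  rw [e] at this
  exact nonneg_of_mul_nonneg_right this (by positivity)

theorem NarrowPair.mem_box (hP : NarrowPair x y rx ry) (hQ : NarrowPair z w rz rw) {δ e : ℝ}
    (hδ : 0 ≤ δ) (hδ' : δ ≤ 0.671952) (he : 0 ≤ e) (he' : e ≤ 0.170166) :
    List.Forall₂ Itv.Mem [⟨0, 1000000⟩, ⟨0, 1000000⟩, ⟨0, 1000000⟩, ⟨0, 671952⟩, ⟨0, 170166⟩]
      [y / x, w / z, y / (y + w), δ, e] := by
  have hx := hP.pos.trans_le hP.le
  have hz := hQ.pos.trans_le hQ.le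
  have hy := hP.pos
  have hw := hQ.pos
  have unit : ∀ t : ℝ, 0 ≤ t → t ≤ 1 → Itv.Mem ⟨0, 1000000⟩ t := fun t h0 h1 => by
    constructor <;> push_cast <;> linarith
  refine .cons (unit _ (by positivity) ((div_le_one hx).2 hP.le)) (.cons (unit _ (by positivity)
    ((div_le_one hz).2 hQ.le)) (.cons (unit _ (by positivity) ((div_le_one (by positivity)).2
    (by linarith))) (.cons ?_ (.cons ?_ .nil))))
  · constructor <;> push_cast <;> linarith
  · constructor <;> push_cast <;> linarith

end contacts

/-- This replaces the half sum `E` of the two angles by its largest possible value. If δ ≤ E the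
cosine is monotone; otherwise |E - δ| ≤ 0.0524, whose cosine exceeds 0.998. -/
theorem mul_cos_sub_le {E E₀ δ : ℝ} (h0 : 0.6196 ≤ E) (hE : E ≤ E₀) (hE₀ : E₀ ≤ 0.959931)
    (hδ : 0 ≤ δ) (hδ' : δ ≤ 0.671952) :
    0.998 * Real.cos (E₀ - δ) ≤ Real.cos (E - δ) := by
  have hpi := Real.pi_gt_d6
  rcases le_total δ E with h | h
  · have h1 : Real.cos (E₀ - δ) ≤ Real.cos (E - δ) :=
      Real.cos_le_cos_of_nonneg_of_le_pi (by linarith) (by linarith) (by linarith)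
    have h2 : 0 ≤ Real.cos (E₀ - δ) :=
      Real.cos_nonneg_of_neg_pi_div_two_le_of_le (by linarith) (by linarith)
    linarith
  · have := Real.one_sub_sq_div_two_le_cos (x := E - δ)
    have := Real.cos_le_one (E₀ - δ)
    nlinarith

/-- Contacts of two opposite narrow pairs whose nearer points are on corresponding sides; the
variables are the two ratios of distances, the share of the first nearer point, the deviation of
the bisectors from being opposite, and half the difference of the two angles. -/
def alignedTermsPos : List Term :=
  [.sub (.mul (.sub (.mul (.const 555556) (.add (.sq (.sub (.var 0) (.const 573574))) (.const
  1481014))) (.cos (.add (.sub (.const 959931) (.var 4)) (.var 3)))) (.sub (.const 1000000) (.var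
  2))) (.mul (.var 2) (.sub (.const 573574) (.mul (.const 500000) (.var 0)))), .sub (.mul (.sub
  (.mul (.const 555556) (.add (.sq (.sub (.var 1) (.const 573574))) (.const 1481014))) (.mul
  (.const 998000) (.cos (.sub (.sub (.const 959931) (.var 4)) (.var 3))))) (.var 2)) (.mul (.sub
  (.const 1000000) (.var 2)) (.sub (.const 573574) (.mul (.const 500000) (.var 1)))), .sub (.mul
  (.sub (.mul (.mul (.const 555556) (.add (.sq (.sub (.var 0) (.const 573574))) (.const 1481014)))
  (.mul (.const 555556) (.add (.sq (.sub (.var 1) (.const 573574))) (.const 1481014)))) (.cos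
  (.add (.var 3) (.var 4)))) (.mul (.var 2) (.sub (.const 1000000) (.var 2)))) (.add (.mul (.mul
  (.sub (.const 573574) (.mul (.const 500000) (.var 0))) (.var 1)) (.sq (.var 2))) (.mul (.mul
  (.sub (.const 573574) (.mul (.const 500000) (.var 1))) (.var 0)) (.sq (.sub (.const 1000000)
  (.var 2))))), .sub (.mul (.sub (.mul (.ratio (.mul (.const 555556) (.add (.sq (.sub (.var 0)
  (.const 573574))) (.const 1481014))) (.var 0)) (.ratio (.mul (.const 555556) (.add (.sq (.sub
  (.var 1) (.const 573574))) (.const 1481014))) (.var 1))) (.cos (.sub (.var 3) (.var 4)))) (.mul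
  (.var 2) (.sub (.const 1000000) (.var 2)))) (.mul (.const 500000) (.add (.mul (.sub (.const
  1000000) (.sq (.ratio (.mul (.const 555556) (.add (.sq (.sub (.var 0) (.const 573574))) (.const
  1481014))) (.var 0)))) (.sq (.var 2))) (.mul (.sub (.const 1000000) (.sq (.ratio (.mul (.const
  555556) (.add (.sq (.sub (.var 1) (.const 573574))) (.const 1481014))) (.var 1)))) (.sq (.sub
  (.const 1000000) (.var 2))))))]

/-- The terms of `alignedTermsPos` for a negative difference of the two angles. -/
def alignedTermsNeg : List Term :=
  [.sub (.mul (.sub (.mul (.const 555556) (.add (.sq (.sub (.var 0) (.const 573574))) (.const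
  1481014))) (.cos (.add (.sub (.const 959931) (.var 4)) (.var 3)))) (.sub (.const 1000000) (.var
  2))) (.mul (.var 2) (.sub (.const 573574) (.mul (.const 500000) (.var 0)))), .sub (.mul (.sub
  (.mul (.const 555556) (.add (.sq (.sub (.var 1) (.const 573574))) (.const 1481014))) (.mul
  (.const 998000) (.cos (.sub (.sub (.const 959931) (.var 4)) (.var 3))))) (.var 2)) (.mul (.sub
  (.const 1000000) (.var 2)) (.sub (.const 573574) (.mul (.const 500000) (.var 1)))), .sub (.mul
  (.sub (.mul (.mul (.const 555556) (.add (.sq (.sub (.var 0) (.const 573574))) (.const 1481014)))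
  (.mul (.const 555556) (.add (.sq (.sub (.var 1) (.const 573574))) (.const 1481014)))) (.cos
  (.sub (.var 3) (.var 4)))) (.mul (.var 2) (.sub (.const 1000000) (.var 2)))) (.add (.mul (.mul
  (.sub (.const 573574) (.mul (.const 500000) (.var 0))) (.var 1)) (.sq (.var 2))) (.mul (.mul
  (.sub (.const 573574) (.mul (.const 500000) (.var 1))) (.var 0)) (.sq (.sub (.const 1000000)
  (.var 2))))), .sub (.mul (.sub (.mul (.ratio (.mul (.const 555556) (.add (.sq (.sub (.var 0)
  (.const 573574))) (.const 1481014))) (.var 0)) (.ratio (.mul (.const 555556) (.add (.sq (.sub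
  (.var 1) (.const 573574))) (.const 1481014))) (.var 1))) (.cos (.add (.var 3) (.var 4)))) (.mul
  (.var 2) (.sub (.const 1000000) (.var 2)))) (.mul (.const 500000) (.add (.mul (.sub (.const
  1000000) (.sq (.ratio (.mul (.const 555556) (.add (.sq (.sub (.var 0) (.const 573574))) (.const
  1481014))) (.var 0)))) (.sq (.var 2))) (.mul (.sub (.const 1000000) (.sq (.ratio (.mul (.const
  555556) (.add (.sq (.sub (.var 1) (.const 573574))) (.const 1481014))) (.var 1)))) (.sq (.sub
  (.const 1000000) (.var 2))))))]

/-- Contacts of two opposite narrow pairs whose nearer points face each other. -/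
def innerTerms : List Term :=
  [.sub (.mul (.sub (.mul (.const 555556) (.add (.sq (.sub (.var 0) (.const 573574))) (.const
  1481014))) (.cos (.add (.var 3) (.var 4)))) (.sub (.const 1000000) (.var 2))) (.mul (.var 2)
  (.sub (.const 573574) (.mul (.const 500000) (.var 0)))), .sub (.mul (.sub (.mul (.const 555556)
  (.add (.sq (.sub (.var 1) (.const 573574))) (.const 1481014))) (.cos (.sub (.var 3) (.var 4))))
  (.var 2)) (.mul (.sub (.const 1000000) (.var 2)) (.sub (.const 573574) (.mul (.const 500000)
  (.var 1)))), .sub (.mul (.sub (.mul (.mul (.const 555556) (.add (.sq (.sub (.var 0) (.const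
  573574))) (.const 1481014))) (.mul (.const 555556) (.add (.sq (.sub (.var 1) (.const 573574)))
  (.const 1481014)))) (.mul (.const 998000) (.cos (.sub (.sub (.const 959931) (.var 4)) (.var
  3))))) (.mul (.var 2) (.sub (.const 1000000) (.var 2)))) (.add (.mul (.mul (.sub (.const 573574)
  (.mul (.const 500000) (.var 0))) (.var 1)) (.sq (.var 2))) (.mul (.mul (.sub (.const 573574)
  (.mul (.const 500000) (.var 1))) (.var 0)) (.sq (.sub (.const 1000000) (.var 2)))))]

/-- Contacts of two opposite narrow pairs whose farther points face each other. -/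
def outerTerms : List Term :=
  [.sub (.mul (.sub (.mul (.const 555556) (.add (.sq (.sub (.var 0) (.const 573574))) (.const
  1481014))) (.cos (.add (.var 3) (.var 4)))) (.sub (.const 1000000) (.var 2))) (.mul (.var 2)
  (.sub (.const 573574) (.mul (.const 500000) (.var 0)))), .sub (.mul (.sub (.mul (.const 555556)
  (.add (.sq (.sub (.var 1) (.const 573574))) (.const 1481014))) (.cos (.sub (.var 3) (.var 4))))
  (.var 2)) (.mul (.sub (.const 1000000) (.var 2)) (.sub (.const 573574) (.mul (.const 500000)
  (.var 1)))), .sub (.mul (.sub (.mul (.ratio (.mul (.const 555556) (.add (.sq (.sub (.var 0)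
  (.const 573574))) (.const 1481014))) (.var 0)) (.ratio (.mul (.const 555556) (.add (.sq (.sub
  (.var 1) (.const 573574))) (.const 1481014))) (.var 1))) (.mul (.const 998000) (.cos (.sub (.sub
  (.const 959931) (.var 4)) (.var 3))))) (.mul (.var 2) (.sub (.const 1000000) (.var 2)))) (.mul
  (.const 500000) (.add (.mul (.sub (.const 1000000) (.sq (.ratio (.mul (.const 555556) (.add (.sq
  (.sub (.var 0) (.const 573574))) (.const 1481014))) (.var 0)))) (.sq (.var 2))) (.mul (.sub
  (.const 1000000) (.sq (.ratio (.mul (.const 555556) (.add (.sq (.sub (.var 1) (.const 573574)))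
  (.const 1481014))) (.var 1)))) (.sq (.sub (.const 1000000) (.var 2))))))]

/-- The box: three ratios in [0, 1], a deviation of at most 38.5° = 0.671952, and half the
difference of two angles in [0.6196, 0.959931], which is at most 0.170166. -/
theorem check_alignedTermsPos : check alignedTermsPos 60
    [⟨0, 1000000⟩, ⟨0, 1000000⟩, ⟨0, 1000000⟩, ⟨0, 671952⟩, ⟨0, 170166⟩] = true := by
  decide +kernel

theorem check_alignedTermsNeg : check alignedTermsNeg 60
    [⟨0, 1000000⟩, ⟨0, 1000000⟩, ⟨0, 1000000⟩, ⟨0, 671952⟩, ⟨0, 170166⟩] = true := by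
  decide +kernel

theorem check_innerTerms : check innerTerms 60
    [⟨0, 1000000⟩, ⟨0, 1000000⟩, ⟨0, 1000000⟩, ⟨0, 671952⟩, ⟨0, 170166⟩] = true := by
  decide +kernel

theorem check_outerTerms : check outerTerms 60
    [⟨0, 1000000⟩, ⟨0, 1000000⟩, ⟨0, 1000000⟩, ⟨0, 671952⟩, ⟨0, 170166⟩] = true := by
  decide +kernel

section opposite

variable {x y z w rx ry rz rw u v δ : ℝ}

theorem not_aligned (hP : NarrowPair x y rx ry) (hQ : NarrowPair z w rz rw)
    (hu : 0.6196 ≤ u) (hu' : u ≤ 0.959931) (hv : 0.6196 ≤ v) (hv' : v ≤ 0.959931)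
    (hδ : 0 ≤ δ) (hδ' : δ ≤ 0.671952)
    (hxw : x ^ 2 + w ^ 2 + 2 * x * w * Real.cos (δ + (u + v) / 2) ≤ (rx + rw) ^ 2)
    (hyz : y ^ 2 + z ^ 2 + 2 * y * z * Real.cos ((u + v) / 2 - δ) ≤ (ry + rz) ^ 2)
    (hxz : x ^ 2 + z ^ 2 + 2 * x * z * Real.cos (δ + (u - v) / 2) ≤ (rx + rz) ^ 2)
    (hyw : y ^ 2 + w ^ 2 + 2 * y * w * Real.cos (δ - (u - v) / 2) ≤ (ry + rw) ^ 2) : False := by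
  have hpi := Real.pi_gt_d6
  have hx := hP.pos.trans_le hP.le
  have hz := hQ.pos.trans_le hQ.le
  have hy := hP.pos
  have hw := hQ.pos
  -- Half sum plus half the absolute difference is the larger angle, hence at most 0.959931. This
  -- eliminates the half sum, and e remains as the only variable besides δ.
  have key : ∀ e, 0 ≤ e → e ≤ 0.170166 → (u + v) / 2 ≤ 0.959931 - e →
      0 ≤ (chordBound (y / x) - Real.cos (0.959931 - e + δ)) * (1 - y / (y + w)) -
        y / (y + w) * (0.573574 - 0.5 * (y / x)) ∧
      0 ≤ (chordBound (w / z) - 0.998 * Real.cos (0.959931 - e - δ)) * (y / (y + w)) -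
      (1 - y / (y + w)) * (0.573574 - 0.5 * (w / z)) := by
    intro e he he' hE
    constructor
    · have h1 : Real.cos (0.959931 - e + δ) ≤ Real.cos (δ + (u + v) / 2) :=
        Real.cos_le_cos_of_nonneg_of_le_pi (by linarith) (by linarith) (by linarith)
      exact hP.far_near hQ (le_trans (by gcongr) hxw)
    · have h1 := mul_cos_sub_le (E := (u + v) / 2) (E₀ := 0.959931 - e) (δ := δ) (by linarith) hE
        (by linarith) hδ hδ'
      exact hP.near_far hQ (le_trans (by gcongr) hyz)
  have h3 := hP.far_far hQ hxz
  have h4 := hP.near_near hQ hyw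
  rcases le_total v u with huv | huv
  · obtain ⟨h1, h2⟩ := key ((u - v) / 2) (by linarith) (by linarith) (by linarith)
    obtain ⟨t, ht, hneg⟩ := exists_neg_of_check check_alignedTermsPos
      (hP.mem_box hQ hδ hδ' (e := (u - v) / 2) (by linarith) (by linarith))
    simp only [alignedTermsPos, List.mem_cons, List.not_mem_nil, or_false] at ht
    unfold nearBound at *
    unfold chordBound at *
    rcases ht with rfl | rfl | rfl | rfl
    · simp only [Term.val, List.getD_cons_zero, List.getD_cons_succ] at hneg
      norm_num at hneg h1
      linarith
    · simp only [Term.val, List.getD_cons_zero, List.getD_cons_succ] at hneg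
      norm_num at hneg h2
      linarith
    · simp only [Term.val, List.getD_cons_zero, List.getD_cons_succ] at hneg
      norm_num at hneg h3
      linarith
    · simp only [Term.val, List.getD_cons_zero, List.getD_cons_succ] at hneg
      norm_num at hneg h4
      linarith
  · obtain ⟨h1, h2⟩ := key ((v - u) / 2) (by linarith) (by linarith) (by linarith)
    rw [show δ + (u - v) / 2 = δ - (v - u) / 2 by ring] at h3
    rw [show δ - (u - v) / 2 = δ + (v - u) / 2 by ring] at h4
    obtain ⟨t, ht, hneg⟩ := exists_neg_of_check check_alignedTermsNeg
      (hP.mem_box hQ hδ hδ' (e := (v - u) / 2) (by linarith) (by linarith))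
    simp only [alignedTermsNeg, List.mem_cons, List.not_mem_nil, or_false] at ht
    unfold nearBound at *
    unfold chordBound at *
    rcases ht with rfl | rfl | rfl | rfl
    · simp only [Term.val, List.getD_cons_zero, List.getD_cons_succ] at hneg
      norm_num at hneg h1
      linarith
    · simp only [Term.val, List.getD_cons_zero, List.getD_cons_succ] at hneg
      norm_num at hneg h2
      linarith
    · simp only [Term.val, List.getD_cons_zero, List.getD_cons_succ] at hneg
      norm_num at hneg h3
      linarith
    · simp only [Term.val, List.getD_cons_zero, List.getD_cons_succ] at hneg
      norm_num at hneg h4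
      linarith

theorem not_inner_of_le (hP : NarrowPair x y rx ry) (hQ : NarrowPair z w rz rw)
    (hu : 0.6196 ≤ u) (huv : u ≤ v) (hv' : v ≤ 0.959931) (hδ : 0 ≤ δ) (hδ' : δ ≤ 0.671952)
    (hxw : x ^ 2 + w ^ 2 + 2 * x * w * Real.cos (δ + (v - u) / 2) ≤ (rx + rw) ^ 2)
    (hyz : y ^ 2 + z ^ 2 + 2 * y * z * Real.cos (δ - (v - u) / 2) ≤ (ry + rz) ^ 2)
    (hxz : x ^ 2 + z ^ 2 + 2 * x * z * Real.cos ((u + v) / 2 - δ) ≤ (rx + rz) ^ 2) : False := by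
  have hx := hP.pos.trans_le hP.le
  have hz := hQ.pos.trans_le hQ.le
  have h1 := hP.far_near hQ hxw
  have h2 := hP.near_far hQ hyz
  have hc := mul_cos_sub_le (E := (u + v) / 2) (E₀ := 0.959931 - (v - u) / 2) (δ := δ)
    (by linarith) (by linarith) (by linarith) hδ hδ'
  have h3 := hP.far_far hQ (k := 0.998 * Real.cos (0.959931 - (v - u) / 2 - δ))
    (le_trans (by gcongr) hxz)
  obtain ⟨t, ht, hneg⟩ := exists_neg_of_check check_innerTerms
    (hP.mem_box hQ hδ hδ' (e := (v - u) / 2) (by linarith) (by linarith))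
  simp only [innerTerms, List.mem_cons, List.not_mem_nil, or_false] at ht
  unfold chordBound at *
  rcases ht with rfl | rfl | rfl
  · simp only [Term.val, List.getD_cons_zero, List.getD_cons_succ] at hneg
    norm_num at hneg h1
    linarith
  · simp only [Term.val, List.getD_cons_zero, List.getD_cons_succ] at hneg
    norm_num at hneg h2
    linarith
  · simp only [Term.val, List.getD_cons_zero, List.getD_cons_succ] at hneg
    norm_num at hneg h3
    linarith

theorem not_outer_of_le (hP : NarrowPair x y rx ry) (hQ : NarrowPair z w rz rw)
    (hv : 0.6196 ≤ v) (huv : v ≤ u) (hu' : u ≤ 0.959931) (hδ : 0 ≤ δ) (hδ' : δ ≤ 0.671952)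
    (hxw : x ^ 2 + w ^ 2 + 2 * x * w * Real.cos (δ + (u - v) / 2) ≤ (rx + rw) ^ 2)
    (hyz : y ^ 2 + z ^ 2 + 2 * y * z * Real.cos (δ - (u - v) / 2) ≤ (ry + rz) ^ 2)
    (hyw : y ^ 2 + w ^ 2 + 2 * y * w * Real.cos ((u + v) / 2 - δ) ≤ (ry + rw) ^ 2) : False := by
  have hy := hP.pos
  have hw := hQ.pos
  have h1 := hP.far_near hQ hxw
  have h2 := hP.near_far hQ hyz
  have hc := mul_cos_sub_le (E := (u + v) / 2) (E₀ := 0.959931 - (u - v) / 2) (δ := δ)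
    (by linarith) (by linarith) (by linarith) hδ hδ'
  have h3 := hP.near_near hQ (k := 0.998 * Real.cos (0.959931 - (u - v) / 2 - δ))
    (le_trans (by gcongr) hyw)
  obtain ⟨t, ht, hneg⟩ := exists_neg_of_check check_outerTerms
    (hP.mem_box hQ hδ hδ' (e := (u - v) / 2) (by linarith) (by linarith))
  simp only [outerTerms, List.mem_cons, List.not_mem_nil, or_false] at ht
  unfold nearBound at *
  unfold chordBound at *
  rcases ht with rfl | rfl | rfl
  · simp only [Term.val, List.getD_cons_zero, List.getD_cons_succ] at hneg
    norm_num at hneg h1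
    linarith
  · simp only [Term.val, List.getD_cons_zero, List.getD_cons_succ] at hneg
    norm_num at hneg h2
    linarith
  · simp only [Term.val, List.getD_cons_zero, List.getD_cons_succ] at hneg
    norm_num at hneg h3
    linarith

end opposite

theorem cos_ge_of_le {u : ℝ} (h0 : 0 ≤ u) (h : u ≤ 0.959931) : 0.573574 ≤ Real.cos u := by
  have h1 : Real.cos 0.959931 ≤ Real.cos u :=
    Real.cos_le_cos_of_nonneg_of_le_pi h0 (by linarith [Real.pi_gt_d6]) h
  have h2 := cos_lower 0.959931
  norm_num at h2
  linarith

section midpoints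

variable {ι : Type*} {d r θ : ι → ℝ} {i j i₁ i₂ j₁ j₂ : ι} {u v δ k : ℝ}

theorem Config.narrowPair (h : Config d r θ) (hij : i ≠ j) (hd : d j ≤ d i)
    (hc : 0.573574 ≤ Real.cos (θ i - θ j)) : NarrowPair (d i) (d j) (r i) (r j) := by
  have h1 := h.one_le_d i
  have h2 := h.one_le_d j
  have e : Real.cos (θ j - θ i) = Real.cos (θ i - θ j) := by rw [← Real.cos_neg, neg_sub]
  have hm : 2 * d i * d j * 0.573574 ≤ 2 * d i * d j * Real.cos (θ i - θ j) := by gcongr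
  have h3 := h.sq_le i j hij
  have h4 := h.sq_le j i hij.symm
  rw [e] at h4
  exact ⟨by linarith, hd, by linarith [h.one_le_r i], by linarith [h.one_le_r j], h.r_le j,
    by linarith, by linarith⟩

theorem Config.contact (h : Config d r θ) (hij : i ≠ j) (hc : Real.cos (θ i - θ j) = -k) :
    d i ^ 2 + d j ^ 2 + 2 * d i * d j * k ≤ (r i + r j) ^ 2 := by
  have := h.le_sq i j hij
  rw [hc] at this
  linarith

/-- The bisectors of two pairs of angle at most `55°` are not almost opposite. -/
theorem Config.not_opposite_aux (h : Config d r θ) (hi : i₁ ≠ i₂) (hj : j₁ ≠ j₂)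
    (h11 : i₁ ≠ j₁) (h12 : i₁ ≠ j₂) (h21 : i₂ ≠ j₁) (h22 : i₂ ≠ j₂)
    (hu : 0.6196 ≤ u) (hu' : u ≤ 0.959931) (hv : 0.6196 ≤ v) (hv' : v ≤ 0.959931)
    (hδ : 0 ≤ δ) (hδ' : δ ≤ 0.671952)
    (ci : Real.cos (θ i₁ - θ i₂) = Real.cos u) (cj : Real.cos (θ j₁ - θ j₂) = Real.cos v)
    (c11 : Real.cos (θ i₁ - θ j₁) = -Real.cos (δ - (u - v) / 2))
    (c22 : Real.cos (θ i₂ - θ j₂) = -Real.cos (δ + (u - v) / 2))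
    (c21 : Real.cos (θ i₂ - θ j₁) = -Real.cos (δ + (u + v) / 2))
    (c12 : Real.cos (θ i₁ - θ j₂) = -Real.cos ((u + v) / 2 - δ)) : False := by
  have sym : ∀ a b : ι, Real.cos (θ b - θ a) = Real.cos (θ a - θ b) := fun a b => by
    rw [← Real.cos_neg, neg_sub]
  have gi : 0.573574 ≤ Real.cos (θ i₁ - θ i₂) := by rw [ci]; exact cos_ge_of_le (by linarith) hu'
  have gj : 0.573574 ≤ Real.cos (θ j₁ - θ j₂) := by rw [cj]; exact cos_ge_of_le (by linarith) hv'
  have k11 := h.contact h11 c11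
  have k22 := h.contact h22 c22
  have k21 := h.contact h21 c21
  have k12 := h.contact h12 c12
  -- The cases say which end of each pair is nearer: equal orders are aligned, opposite orders put
  -- the nearer or the farther points face to face. Exchanging the pairs fixes the sign of u - v
  -- where needed.
  rcases le_total (d i₁) (d i₂) with hdi | hdi <;> rcases le_total (d j₁) (d j₂) with hdj | hdj
  · have P := h.narrowPair hi.symm hdi (by rw [sym]; exact gi)
    have Q := h.narrowPair hj.symm hdj (by rw [sym]; exact gj)
    exact not_aligned P Q hu hu' hv hv' hδ hδ' k21 k12 k22 k11
  · have P := h.narrowPair hi.symm hdi (by rw [sym]; exact gi)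
    have Q := h.narrowPair hj hdj gj
    rcases le_total v u with huv | huv
    · exact not_outer_of_le P Q hv huv hu' hδ hδ' k22 k11 k12
    · refine not_outer_of_le Q P hu huv hv' hδ hδ' ?_ ?_ ?_
      · rw [show δ + (v - u) / 2 = δ - (u - v) / 2 by ring]; linarith
      · rw [show δ - (v - u) / 2 = δ + (u - v) / 2 by ring]; linarith
      · rw [add_comm v]; linarith
  · have P := h.narrowPair hi hdi gi
    have Q := h.narrowPair hj.symm hdj (by rw [sym]; exact gj)
    rcases le_total u v with huv | huv
    · refine not_inner_of_le P Q hu huv hv' hδ hδ' ?_ ?_ k12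
      · rw [show δ + (v - u) / 2 = δ - (u - v) / 2 by ring]; exact k11
      · rw [show δ - (v - u) / 2 = δ + (u - v) / 2 by ring]; exact k22
    · refine not_inner_of_le Q P hv huv hu' hδ hδ' ?_ ?_ ?_
      · linarith
      · linarith
      · rw [add_comm v]; linarith
  · have P := h.narrowPair hi hdi gi
    have Q := h.narrowPair hj hdj gj
    refine not_aligned Q P hv hv' hu hu' hδ hδ' ?_ ?_ ?_ ?_
    · rw [add_comm v]; linarith
    · rw [add_comm v]; linarith
    · rw [show δ + (v - u) / 2 = δ - (u - v) / 2 by ring]; linarith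
    · rw [show δ - (v - u) / 2 = δ + (u - v) / 2 by ring]; linarith

/-- The bisectors of two pairs of angle at most `55°` are not almost opposite. -/
theorem Config.not_opposite (h : Config d r θ) (hi : i₁ ≠ i₂) (hj : j₁ ≠ j₂)
    (h11 : i₁ ≠ j₁) (h12 : i₁ ≠ j₂) (h21 : i₂ ≠ j₁) (h22 : i₂ ≠ j₂)
    (hu : 0.6196 ≤ θ i₂ - θ i₁) (hu' : θ i₂ - θ i₁ ≤ 0.959931)
    (hv : 0.6196 ≤ θ j₂ - θ j₁) (hv' : θ j₂ - θ j₁ ≤ 0.959931)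
    (h1 : 2 * Real.pi - 1.343904 ≤ θ j₁ + θ j₂ - θ i₁ - θ i₂)
    (h2 : θ j₁ + θ j₂ - θ i₁ - θ i₂ ≤ 2 * Real.pi + 1.343904) : False := by
  have step : ∀ a b : ℝ, (a = b - Real.pi ∨ a = Real.pi - b ∨ a = -Real.pi - b ∨
      a = b + Real.pi) →
      Real.cos a = -Real.cos b := by
    rintro a b (rfl | rfl | rfl | rfl)
    · exact Real.cos_sub_pi b
    · exact Real.cos_pi_sub b
    · rw [← Real.cos_neg, show -(-Real.pi - b) = b + Real.pi by ring, Real.cos_add_pi]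
    · exact Real.cos_add_pi b
  have flip : ∀ a b : ℝ, a = -b → Real.cos a = Real.cos b := fun a b h => by
    rw [h, Real.cos_neg]
  -- Half of this sum is the angle between the bisectors, and δ is its distance to π; beyond π the
  -- two pairs exchange roles.
  rcases le_total (θ j₁ + θ j₂ - θ i₁ - θ i₂) (2 * Real.pi) with hs | hs
  · refine h.not_opposite_aux hi hj h11 h12 h21 h22 hu hu' hv hv'
      (δ := Real.pi - (θ j₁ + θ j₂ - θ i₁ - θ i₂) / 2) (by linarith) (by linarith)
      (flip _ _ (by ring)) (flip _ _ (by ring)) (step _ _ ?_) (step _ _ ?_) (step _ _ ?_)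
      (step _ _ ?_)
    · left; ring
    · left; ring
    · left; ring
    · right; right; left; ring
  · refine h.not_opposite_aux hj hi h11.symm h21.symm h12.symm h22.symm hv hv' hu hu'
      (δ := (θ j₁ + θ j₂ - θ i₁ - θ i₂) / 2 - Real.pi) (by linarith) (by linarith)
      (flip _ _ (by ring)) (flip _ _ (by ring)) (step _ _ ?_) (step _ _ ?_) (step _ _ ?_)
      (step _ _ ?_)
    · right; right; right; ring
    · right; right; right; ring
    · right; right; right; ring
    · right; left; ring

end midpoints

/-! ### Eight directions with large gaps -/

/-- Call a gap wide if it is at least 0.959931. For gaps four places apart the last two alternatives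
of `M` fail, since 8·0.6196 > 2π - 1.343904; so each of the pairs (1,5), (2,6), (3,7) contains a
wide gap. Gap 0, being the largest, is then wide too, and 4·0.959931 + 4·0.6196 > 2π. The case tree
also splits on (1,6) and (2,7). -/
theorem not_eight_gaps {T : ℕ → ℝ} (hT : T 8 = T 0 + 2 * Real.pi)
    (h0 : 0.6196 ≤ T 1 - T 0) (h1 : 0.6196 ≤ T 2 - T 1) (h2 : 0.6196 ≤ T 3 - T 2)
    (h3 : 0.6196 ≤ T 4 - T 3) (h4 : 0.6196 ≤ T 5 - T 4) (h5 : 0.6196 ≤ T 6 - T 5)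
    (h6 : 0.6196 ≤ T 7 - T 6) (h7 : 0.6196 ≤ T 8 - T 7)
    (k1 : T 2 - T 1 ≤ T 1 - T 0) (k2 : T 3 - T 2 ≤ T 1 - T 0) (k3 : T 4 - T 3 ≤ T 1 - T 0)
    (k5 : T 6 - T 5 ≤ T 1 - T 0)
    (k7 : T 8 - T 7 ≤ T 1 - T 0)
    (M : ∀ i i' j j' : ℕ, i' = i + 1 → j' = j + 1 → i' < j → j' < i + 8 → j < 8 →
      0.959931 ≤ T i' - T i ∨ 0.959931 ≤ T j' - T j ∨
        T j + T j' - T i - T i' ≤ 2 * Real.pi - 1.343904 ∨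
        2 * Real.pi + 1.343904 ≤ T j + T j' - T i - T i') : False := by
  have p1 := Real.pi_gt_d6
  have p2 := Real.pi_lt_d6
  rcases M 1 2 6 7 rfl rfl (by norm_num) (by norm_num) (by norm_num) with h0 | h0 | h0 | h0
  · rcases M 2 3 7 8 rfl rfl (by norm_num) (by norm_num) (by norm_num) with h1 | h1 | h1 | h1
    · rcases M 3 4 7 8 rfl rfl (by norm_num) (by norm_num) (by norm_num) with h2 | h2 | h2 | h2
      · linarith
      · linarith
      · linarith
      · linarith
    · rcases M 2 3 6 7 rfl rfl (by norm_num) (by norm_num) (by norm_num) with h2 | h2 | h2 | h2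
      · linarith
      · linarith
      · linarith
      · linarith
    · linarith
    · linarith
  · rcases M 2 3 7 8 rfl rfl (by norm_num) (by norm_num) (by norm_num) with h1 | h1 | h1 | h1
    · rcases M 1 2 5 6 rfl rfl (by norm_num) (by norm_num) (by norm_num) with h2 | h2 | h2 | h2
      · linarith
      · linarith
      · linarith
      · linarith
    · rcases M 1 2 5 6 rfl rfl (by norm_num) (by norm_num) (by norm_num) with h2 | h2 | h2 | h2
      · linarith
      · linarith
      · linarith
      · linarith
    · linarith
    · rcases M 1 2 5 6 rfl rfl (by norm_num) (by norm_num) (by norm_num) with h2 | h2 | h2 | h2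
      · linarith
      · rcases M 3 4 7 8 rfl rfl (by norm_num) (by norm_num) (by norm_num) with h3 | h3 | h3 | h3
        · linarith
        · linarith
        · linarith
        · linarith
      · linarith
      · linarith
  · linarith
  · rcases M 1 2 5 6 rfl rfl (by norm_num) (by norm_num) (by norm_num) with h1 | h1 | h1 | h1
    · rcases M 3 4 7 8 rfl rfl (by norm_num) (by norm_num) (by norm_num) with h2 | h2 | h2 | h2
      · rcases M 2 3 6 7 rfl rfl (by norm_num) (by norm_num) (by norm_num) with h3 | h3 | h3 | h3
        · linarith
        · linarith
        · linarith
        · linarith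
      · linarith
      · linarith
      · linarith
    · rcases M 3 4 7 8 rfl rfl (by norm_num) (by norm_num) (by norm_num) with h2 | h2 | h2 | h2
      · rcases M 2 3 6 7 rfl rfl (by norm_num) (by norm_num) (by norm_num) with h3 | h3 | h3 | h3
        · linarith
        · linarith
        · linarith
        · linarith
      · linarith
      · linarith
      · linarith
    · linarith
    · linarith

/-- Eight points in directions that differ by more than `arccos 0.814` cannot be pairwise
touching. -/
theorem Config.not_eight {ι : Type*} {d r θ : ι → ℝ} (h : Config d r θ) (x : ℕ → ι)
    (hx : ∀ i j, i < j → j < i + 8 → x i ≠ x j) (T : ℕ → ℝ)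
    (hT : ∀ i, T (i + 8) = T i + 2 * Real.pi)
    (hc : ∀ i j, Real.cos (T i - T j) = Real.cos (θ (x i) - θ (x j)))
    (hgap : ∀ i, 0.6196 ≤ T (i + 1) - T i) : False := by
  have hmono : Monotone T := monotone_nat_of_le_succ fun i => by linarith [hgap i]
  obtain ⟨s, -, hs⟩ := (Finset.range 8).exists_max_image (fun i => T (i + 1) - T i) ⟨0, by simp⟩
  -- Gaps repeat with period 8, so the largest of one period is the largest of all, and indexing can
  -- start there.
  have hmax : ∀ i, T (i + 1) - T i ≤ T (s + 1) - T s := by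
    intro i
    induction i using Nat.strong_induction_on with
    | _ i ih =>
      rcases lt_or_ge i 8 with hi | hi
      · exact hs i (Finset.mem_range.2 hi)
      · obtain ⟨k, rfl⟩ : ∃ k, i = k + 8 := ⟨i - 8, by omega⟩
        have := ih k (by omega)
        have e : T (k + 8 + 1) = T (k + 1) + 2 * Real.pi := by rw [← hT]
        rw [e, hT]
        linarith
  have g : ∀ i, 0.6196 ≤ T (s + (i + 1)) - T (s + i) := fun i => hgap (s + i)
  have k : ∀ i, T (s + (i + 1)) - T (s + i) ≤ T (s + 1) - T (s + 0) := fun i => hmax (s + i)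
  refine not_eight_gaps (T := fun i => T (s + i)) (hT s) (g 0) (g 1) (g 2) (g 3) (g 4) (g 5) (g 6)
    (g 7) (k 1) (k 2) (k 3) (k 5) (k 7) ?_
  rintro i _ j _ rfl rfl hij hji -
  by_contra! hcon
  obtain ⟨c1, c2, c3, c4⟩ := hcon
  -- the configuration of the eight points, with the angles `T`
  let f : Fin 8 → ι := fun a => x (s + i + a)
  have hf : Function.Injective f := by
    intro a b hab
    by_contra hne
    rcases lt_or_gt_of_ne (fun e => hne (Fin.ext e) : (a : ℕ) ≠ b) with hlt | hlt
    · exact hx _ _ (by omega) (by omega) hab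
    · exact hx _ _ (by omega) (by omega) hab.symm
  have C : Config (d ∘ f) (r ∘ f) (fun a : Fin 8 => T (s + i + a)) :=
    (h.comp f hf).congr fun a b => hc _ _
  have a1 := g i
  have a2 := g j
  obtain ⟨m, rfl⟩ : ∃ m, j = i + m := ⟨j - i, by omega⟩
  have hm : m < 7 := by omega
  have hm' : 1 < m := by omega
  refine C.not_opposite (i₁ := 0) (i₂ := 1) (j₁ := ⟨m, by omega⟩) (j₂ := ⟨m + 1, by omega⟩)
    (by simp) ?_ ?_ ?_ ?_ ?_ ?_ ?_ ?_ ?_ ?_ ?_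
  all_goals simp only [ne_eq, Fin.ext_iff, Fin.val_zero, Fin.val_one]
  all_goals try omega
  all_goals simp only [← add_assoc, add_zero] at *
  all_goals linarith

/-! ### Linear bounds for angles between far points -/

/-- Bounds for the cosine of the angle between two far points, in the ratio of their distances and
the inverse of the smaller distance. -/
def gapTerms : List Term :=
  [.sub (.add (.var 1) (.mul (.mul (.const 500000) (.var 0)) (.sub (.const 1000000) (.sq (.var
  1))))) (.cos (.add (.add (.const 250500) (.mul (.const 470000) (.ratio (.sub (.const 500000)
  (.var 1)) (.const 1000000)))) (.add (.const 250500) (.mul (.const 470000) (.ratio (.sub (.const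
  500000) (.mul (.var 0) (.var 1))) (.const 1000000)))))), .sub (.sub (.add (.const 1000000) (.sq
  (.var 0))) (.sq (.mul (.var 0) (.var 1)))) (.mul (.const 2000000) (.mul (.var 0) (.cos (.add
  (.add (.const 250500) (.mul (.const 470000) (.ratio (.sub (.const 500000) (.var 1)) (.const
  1000000)))) (.add (.const 250500) (.mul (.const 470000) (.ratio (.sub (.const 500000) (.mul
  (.var 0) (.var 1))) (.const 1000000))))))))]

/-- Bounds for the angle between a far point and a nearer one. -/
def nearSideTerms (b0 b1 b2 pm : Int) : List Term :=
  [.sub (.add (.mul (.var 0) (.var 1)) (.mul (.var 2) (.sub (.const 2000000) (.mul (.mul (.var 0)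
  (.var 1)) (.var 2))))) (.const 1628000), .sub (.add (.mul (.const 500000) (.var 0)) (.mul (.var
  1) (.mul (.var 2) (.sub (.const 1000000) (.mul (.const 500000) (.mul (.var 2) (.mul (.var 0)
  (.var 1)))))))) (.cos (.sub (.sub (.sub (.const b0) (.mul (.const b1) (.mul (.var 0) (.var 1))))
  (.mul (.const b2) (.var 2))) (.add (.const 250500) (.mul (.const 470000) (.ratio (.sub (.const
  500000) (.var 1)) (.const 1000000)))))), .sub (.const pm) (.mul (.var 0) (.var 1))]

/-- Bounds for the angle between a far point and one that is not nearer. -/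
def farSideTerms (b0 b1 b2 q0 : Int) : List Term :=
  [.sub (.add (.var 1) (.mul (.var 2) (.sub (.const 2000000) (.mul (.var 1) (.var 2))))) (.const
  1628000), .sub (.add (.var 1) (.mul (.mul (.const 500000) (.var 0)) (.sub (.const 1000000) (.sq
  (.var 1))))) (.cos (.sub (.sub (.sub (.const b0) (.mul (.const b1) (.var 1))) (.mul (.const b2)
  (.var 2))) (.add (.const 250500) (.mul (.const 470000) (.ratio (.sub (.const 500000) (.mul (.var
  0) (.var 1))) (.const 1000000)))))), .sub (.add (.const 1000000) (.mul (.mul (.var 0) (.mul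
  (.var 0) (.var 1))) (.mul (.var 2) (.sub (.const 2000000) (.mul (.var 2) (.var 1)))))) (.mul
  (.const 2000000) (.mul (.var 0) (.cos (.sub (.sub (.sub (.const b0) (.mul (.const b1) (.var 1)))
  (.mul (.const b2) (.var 2))) (.add (.const 250500) (.mul (.const 470000) (.ratio (.sub (.const
  500000) (.mul (.var 0) (.var 1))) (.const 1000000)))))))), .sub (.mul (.var 0) (.var 1)) (.const
  q0)]

/-- Bounds for the angle between a far point and the witness of its neighbour. -/
def turnTerms (b0 b1 b2 e0 e1 : Int) : List Term :=
  [.sub (.mul (.var 1) (.sub (.const 2000000) (.mul (.var 0) (.var 1)))) (.mul (.var 2) (.sub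
  (.const 1628000) (.mul (.var 0) (.var 2)))), .sub (.add (.sub (.const (2675800 - 2 * b0)) (.mul
  (.const (1408000 - 2 * b1)) (.var 0))) (.mul (.const 678400) (.var 2))) (.mul (.const (983700 -
  2 * b2)) (.var 1)), .sub (.add (.const e0) (.mul (.const e1) (.sq (.var 2)))) (.mul (.var 2)
  (.cos (.sub (.add (.sub (.const (1805500 - b0)) (.mul (.const (1408000 - b1)) (.var 0))) (.mul
  (.const 678400) (.var 2))) (.mul (.const (983700 - b2)) (.var 1)))))]

/-- Bounds for the angle between a far point and the witness of another far point. -/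
def crossTerms : List Term :=
  [.sub (.add (.var 0) (.mul (.var 1) (.sub (.const 2000000) (.mul (.var 0) (.var 1))))) (.const
  1628000), .sub (.add (.mul (.var 2) (.cos (.sub (.sub (.add (.const 1937000) (.mul (.const
  678400) (.var 2))) (.mul (.const 983700) (.var 1))) (.mul (.const 572200) (.var 0))))) (.var 2))
  (.mul (.var 1) (.add (.const 1000000) (.mul (.var 0) (.sub (.var 2) (.mul (.const 500000) (.var
  1))))))]

/-- The contact of two far points in terms of the sums of their inverse distances and of the
differences between distance and radius. -/
def contactTerms (b0 b1 b2 : Int) : List Term :=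
  [.add (.add (.sub (.const 1000000) (.mul (.var 1) (.var 0))) (.mul (.const 125000) (.sq (.mul
  (.var 1) (.var 0))))) (.cos (.sub (.sub (.const b0) (.mul (.const b1) (.var 0))) (.mul (.const
  b2) (.var 1)))), .sub (.var 1) (.sub (.const 1628000) (.mul (.const 375000) (.var 0)))]

/-! ### Numerical certificates for the linear bounds -/

theorem check_gapTerms :
    check (gapTerms) 80
      [⟨0, 1000000⟩, ⟨0, 614300⟩] = true := by
  decide +kernel

theorem check_nearSideTerms_mid :
    check (nearSideTerms 1437000 737400 291800 400000) 80
      [⟨0, 1000000⟩, ⟨0, 614300⟩, ⟨500000, 1000000⟩] = true := by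
  decide +kernel

theorem check_farSideTerms_mid :
    check (farSideTerms 1437000 737400 291800 0) 80
      [⟨0, 1000000⟩, ⟨0, 400000⟩, ⟨500000, 1000000⟩] = true := by
  decide +kernel

theorem check_nearSideTerms_near :
    check (nearSideTerms 1472000 846600 365400 614300) 80
      [⟨0, 1000000⟩, ⟨0, 614300⟩, ⟨500000, 1000000⟩] = true := by
  decide +kernel

theorem check_farSideTerms_near :
    check (farSideTerms 1472000 846600 365400 0) 80
      [⟨0, 1000000⟩, ⟨0, 614300⟩, ⟨500000, 1000000⟩] = true := by
  decide +kernel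

theorem check_nearSideTerms_far₀ :
    check (nearSideTerms 1767000 899500 508300 280000) 80
      [⟨0, 1000000⟩, ⟨0, 520000⟩, ⟨500000, 1000000⟩] = true := by
  decide +kernel

theorem check_farSideTerms_far₀ :
    check (farSideTerms 1767000 899500 508300 0) 80
      [⟨0, 1000000⟩, ⟨0, 280000⟩, ⟨500000, 1000000⟩] = true := by
  decide +kernel

theorem check_nearSideTerms_far₁ :
    check (nearSideTerms 1870000 952400 655300 280000) 80
      [⟨0, 1000000⟩, ⟨520000, 560000⟩, ⟨500000, 1000000⟩] = true := by
  decide +kernel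

theorem check_farSideTerms_far₁ :
    check (farSideTerms 1870000 952400 655300 520000) 80
      [⟨0, 1000000⟩, ⟨0, 280000⟩, ⟨500000, 1000000⟩] = true := by
  decide +kernel

theorem check_nearSideTerms_far₂ :
    check (nearSideTerms 1791000 1107000 689700 280000) 80
      [⟨0, 1000000⟩, ⟨560000, 614300⟩, ⟨500000, 1000000⟩] = true := by
  decide +kernel

theorem check_farSideTerms_far₂ :
    check (farSideTerms 1791000 1107000 689700 560000) 80
      [⟨0, 1000000⟩, ⟨0, 280000⟩, ⟨500000, 1000000⟩] = true := by
  decide +kernel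

theorem check_turnTerms_far₀ :
    check (turnTerms 1767000 899500 508300 750000 250000) 80
      [⟨0, 280000⟩, ⟨500000, 1000000⟩, ⟨1000000, 1390000⟩] = true := by
  decide +kernel

theorem check_turnTerms_far₁ :
    check (turnTerms 1870000 952400 655300 701539 260000) 80
      [⟨0, 280000⟩, ⟨500000, 1000000⟩, ⟨1000000, 1390000⟩] = true := by
  decide +kernel

theorem check_turnTerms_far₂ :
    check (turnTerms 1791000 1107000 689700 612858 280000) 80
      [⟨0, 280000⟩, ⟨500000, 1000000⟩, ⟨1000000, 1390000⟩] = true := by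
  decide +kernel

theorem check_crossTerms :
    check (crossTerms) 80
      [⟨0, 280000⟩, ⟨500000, 1000000⟩, ⟨1000000, 1390000⟩] = true := by
  decide +kernel

theorem check_contactTerms_mid :
    check (contactTerms 2874000 737400 291800) 80
      [⟨280000, 400000⟩, ⟨1000000, 2000000⟩] = true := by
  decide +kernel

theorem check_contactTerms_near :
    check (contactTerms 2944000 846600 365400) 80
      [⟨400000, 1228600⟩, ⟨1000000, 2000000⟩] = true := by
  decide +kernel

/-- The part of the angle between two far points that is due to the point at distance `1 / q`. -/
noncomputable def gapBound (q : ℝ) : ℝ := 0.2505 + 0.47 * max 0 (min 1 ((0.5 - q) / 1))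

theorem gapBound_ge (q : ℝ) : 0.2505 ≤ gapBound q := by
  have : (0 : ℝ) ≤ max 0 (min 1 ((0.5 - q) / 1)) := le_max_left _ _
  unfold gapBound
  linarith

theorem gapBound_le {q : ℝ} (h : 0 ≤ q) : gapBound q ≤ 0.4855 := by
  have : max 0 (min 1 ((0.5 - q) / 1)) ≤ 0.5 := by
    refine max_le (by norm_num) ((min_le_right _ _).trans ?_)
    linarith
  unfold gapBound
  linarith

theorem Itv.mem_mk {a b : Int} {x : ℝ} (h1 : (a : ℝ) / 1000000 ≤ x) (h2 : x ≤ (b : ℝ) / 1000000) :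
    Itv.Mem ⟨a, b⟩ x := by
  constructor <;> simp only <;> linarith

/-! ### Linear bounds in the inverse distances -/

section linear

variable {d e a y β γ p q : ℝ}

/-- In the variables d/e and 1/d the two hypotheses bound cos γ on a compact box. The additive form,
one summand per point, is what later lets the bounds for neighbouring angles cancel. -/
theorem gapBound_add_le_of_le (hd : 1.628 ≤ d) (hde : d ≤ e) (h0 : 0 ≤ γ)
    (h1 : 2 * d * e * Real.cos γ ≤ d ^ 2 + e ^ 2 - 1)
    (h2 : 2 * d * e * Real.cos γ ≤ d ^ 2 + 2 * e - 1) :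
    gapBound (1 / d) + gapBound (1 / e) ≤ γ := by
  by_contra! hcon
  have hpi := Real.pi_gt_d6
  have hd0 : 0 < d := by linarith
  have he0 : 0 < e := by linarith
  have g1 := gapBound_le (q := 1 / d) (by positivity)
  have g2 := gapBound_le (q := 1 / e) (by positivity)
  have hc : Real.cos (gapBound (1 / d) + gapBound (1 / e)) ≤ Real.cos γ :=
    Real.cos_le_cos_of_nonneg_of_le_pi h0 (by linarith) hcon.le
  obtain ⟨t, ht, hneg⟩ := exists_neg_of_check check_gapTerms (xs := [d / e, 1 / d])
    (.cons (Itv.mem_mk (by push_cast; simp only [zero_div]; positivity)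
      (by push_cast; rw [div_le_iff₀ he0]; linarith))
    (.cons (Itv.mem_mk (by push_cast; simp only [zero_div]; positivity)
      (by push_cast; rw [div_le_iff₀ hd0]; linarith)) .nil))
  have e1 : 1 / e = d / e * (1 / d) := by field_simp
  rw [e1] at hc
  set C := Real.cos γ
  have k1 : C ≤ 1 / d + 0.5 * (d / e) * (1 - (1 / d) ^ 2) := by
    have : 1 / d + 0.5 * (d / e) * (1 - (1 / d) ^ 2) = (d ^ 2 + 2 * e - 1) / (2 * d * e) := by
      field_simp; ring
    rw [this, le_div_iff₀ (by positivity)]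
    linarith
  have k2 : 2 * (d / e * C) ≤ 1 + (d / e) ^ 2 - (d / e * (1 / d)) ^ 2 := by
    have : 1 + (d / e) ^ 2 - (d / e * (1 / d)) ^ 2 = (d ^ 2 + e ^ 2 - 1) / e ^ 2 := by
      field_simp; ring
    rw [this, le_div_iff₀ (by positivity)]
    have : 2 * (d / e * C) * e ^ 2 = 2 * d * e * C := by field_simp
    linarith
  have hs : 0 < d / e := by positivity
  have k3 := mul_le_mul_of_nonneg_left hc hs.le
  simp only [gapTerms, List.mem_cons, List.not_mem_nil, or_false] at ht
  unfold gapBound at hc k3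
  rcases ht with rfl | rfl
  · simp only [Term.val, List.getD_cons_zero, List.getD_cons_succ] at hneg
    norm_num at hneg hc k1
    linarith
  · simp only [Term.val, List.getD_cons_zero, List.getD_cons_succ] at hneg
    norm_num at hneg k3 k2
    linarith

theorem gapBound_add_le (hd : 1.628 ≤ d) (he : 1.628 ≤ e) (h0 : 0 ≤ γ)
    (h1 : 2 * d * e * Real.cos γ ≤ d ^ 2 + e ^ 2 - 1)
    (h2 : 2 * d * e * Real.cos γ ≤ d ^ 2 + 2 * e - 1)
    (h3 : 2 * d * e * Real.cos γ ≤ e ^ 2 + 2 * d - 1) :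
    gapBound (1 / d) + gapBound (1 / e) ≤ γ := by
  rcases le_total d e with h | h
  · exact gapBound_add_le_of_le hd h h0 h1 h2
  · rw [add_comm]
    exact gapBound_add_le_of_le he h h0 (by linarith) (by linarith)

/-- A linear lower bound for the angle between a far point at distance `d`, whose radius is
`d - a`, and a far point at distance `e`. -/
theorem side_ge {b0 b1 b2 pm q0 q1 : Int} (hb0 : b0 ≤ 3000000) (hb1 : 0 ≤ b1) (hb2 : 0 ≤ b2)
    (hn : check (nearSideTerms b0 b1 b2 pm) 80 [⟨0, 1000000⟩, ⟨q0, q1⟩, ⟨500000, 1000000⟩] = true)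
    (hf : check (farSideTerms b0 b1 b2 q0) 80 [⟨0, 1000000⟩, ⟨0, pm⟩, ⟨500000, 1000000⟩] = true)
    (hd : 0 < d) (he : 0 < e) (ha : 0.5 ≤ a) (ha1 : a ≤ 1) (hp : 1 / d ≤ (pm : ℝ) / 1000000)
    (hq : (q0 : ℝ) / 1000000 ≤ 1 / e) (hq' : 1 / e ≤ (q1 : ℝ) / 1000000)
    (hF : 1.628 ≤ 1 / d + a * (2 - 1 / d * a)) (h0 : 0 ≤ β)
    (h1 : 2 * d * e * Real.cos β ≤ e ^ 2 + 2 * a * d - a ^ 2)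
    (h2 : 2 * d * e * Real.cos β ≤ d ^ 2 + 2 * e - 1) :
    b0 / 1000000 - b1 / 1000000 * (1 / d) - b2 / 1000000 * a ≤ β + gapBound (1 / e) := by
  by_contra! hcon
  have hpi := Real.pi_gt_d6
  have hb0' : (b0 : ℝ) ≤ 3000000 := by exact_mod_cast hb0
  have hb1' : (0 : ℝ) ≤ b1 := by exact_mod_cast hb1
  have hb2' : (0 : ℝ) ≤ b2 := by exact_mod_cast hb2
  have hp0 : 0 < 1 / d := by positivity
  have hq0 : 0 < 1 / e := by positivity
  have hB1 : 0 ≤ (b1 : ℝ) / 1000000 * (1 / d) := by positivity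
  have hB2 : 0 ≤ (b2 : ℝ) / 1000000 * a := by positivity
  have hc : Real.cos (b0 / 1000000 - b1 / 1000000 * (1 / d) - b2 / 1000000 * a -
      gapBound (1 / e)) ≤ Real.cos β :=
    Real.cos_le_cos_of_nonneg_of_le_pi h0 (by linarith [gapBound_ge (1 / e)]) (by linarith)
  have ma : Itv.Mem ⟨500000, 1000000⟩ a :=
    Itv.mem_mk (by push_cast; linarith) (by push_cast; linarith)
  set C := Real.cos β
  -- The smaller distance is divided by the larger, so that the ratio lies in [0, 1].
  rcases le_total e d with hde | hde
  · obtain ⟨t, ht, hneg⟩ := exists_neg_of_check hn (xs := [e / d, 1 / e, a])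
      (.cons (Itv.mem_mk (by push_cast; simp only [zero_div]; positivity)
        (by push_cast; rw [div_le_iff₀ hd]; linarith)) (.cons (Itv.mem_mk hq hq') (.cons ma .nil)))
    have e1 : 1 / d = e / d * (1 / e) := by field_simp
    have k1 : C ≤ 0.5 * (e / d) + 1 / e * (a * (1 - 0.5 * (a * (1 / d)))) := by
      have : 0.5 * (e / d) + 1 / e * (a * (1 - 0.5 * (a * (1 / d)))) =
          (e ^ 2 + 2 * a * d - a ^ 2) / (2 * d * e) := by
        field_simp; ring
      rw [this, le_div_iff₀ (by positivity)]
      linarith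
    rw [e1] at hc hF k1 hp
    unfold gapBound at hc
    simp only [nearSideTerms, List.mem_cons, List.not_mem_nil, or_false] at ht
    rcases ht with rfl | rfl | rfl
    · simp only [Term.val, List.getD_cons_zero, List.getD_cons_succ] at hneg
      norm_num at hneg hF
      linarith
    · simp only [Term.val, List.getD_cons_zero, List.getD_cons_succ] at hneg
      norm_num at hneg hc k1
      linarith
    · simp only [Term.val, List.getD_cons_zero, List.getD_cons_succ] at hneg
      linarith
  · obtain ⟨t, ht, hneg⟩ := exists_neg_of_check hf (xs := [d / e, 1 / d, a])
      (.cons (Itv.mem_mk (by push_cast; simp only [zero_div]; positivity)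
        (by push_cast; rw [div_le_iff₀ he]; linarith)) (.cons (Itv.mem_mk
        (by push_cast; simp only [zero_div]; positivity) hp) (.cons ma .nil)))
    have e1 : 1 / e = d / e * (1 / d) := by field_simp
    have k1 : C ≤ 1 / d + 0.5 * (d / e) * (1 - (1 / d) ^ 2) := by
      have : 1 / d + 0.5 * (d / e) * (1 - (1 / d) ^ 2) =
          (d ^ 2 + 2 * e - 1) / (2 * d * e) := by
        field_simp; ring
      rw [this, le_div_iff₀ (by positivity)]
      linarith
    have k2 : 2 * (d / e * C) ≤ 1 + d / e * (1 / e) * (a * (2 - a * (1 / d))) := by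
      have : 1 + d / e * (1 / e) * (a * (2 - a * (1 / d))) =
          (e ^ 2 + 2 * a * d - a ^ 2) / e ^ 2 := by
        field_simp; ring
      rw [this, le_div_iff₀ (by positivity)]
      have : 2 * (d / e * C) * e ^ 2 = 2 * d * e * C := by field_simp
      linarith
    have hs : 0 < d / e := by positivity
    rw [e1] at hc k2 hq
    have k3 := mul_le_mul_of_nonneg_left hc hs.le
    unfold gapBound at hc k3
    simp only [farSideTerms, List.mem_cons, List.not_mem_nil, or_false] at ht
    rcases ht with rfl | rfl | rfl | rfl
    · simp only [Term.val, List.getD_cons_zero, List.getD_cons_succ] at hneg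
      norm_num at hneg hF
      linarith
    · simp only [Term.val, List.getD_cons_zero, List.getD_cons_succ] at hneg
      norm_num at hneg hc k1
      linarith
    · simp only [Term.val, List.getD_cons_zero, List.getD_cons_succ] at hneg
      norm_num at hneg k3 k2
      linarith
    · simp only [Term.val, List.getD_cons_zero, List.getD_cons_succ] at hneg
      linarith

/-- The angle between a far point and its witness is bounded in terms of their distances. -/
theorem turn_ge_aux {b0 b1 b2 e0 e1 : Int} {η : ℝ} (hb0 : 1500000 ≤ b0) (hb1 : b1 ≤ 1408000)
    (hb2 : b2 ≤ 983700)
    (hc : check (turnTerms b0 b1 b2 e0 e1) 80 [⟨0, 280000⟩, ⟨500000, 1000000⟩, ⟨1000000, 1390000⟩]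
      = true)
    (hp : 0 ≤ p) (hp' : p ≤ 0.28) (ha : 0.5 ≤ a) (ha1 : a ≤ 1) (hy : 1 ≤ y) (hy' : y ≤ 1.39)
    (hF : y * (1.628 - p * y) ≤ a * (2 - p * a))
    (hside : b0 / 1000000 - b1 / 1000000 * p - b2 / 1000000 * a ≤ β + gapBound q)
    (hη : β - 0.6198 ≤ η) (hη0 : 0 ≤ η)
    (hcos : y * Real.cos η ≤ e0 / 1000000 + e1 / 1000000 * y ^ 2) :
    2.056 - 0.8358 * p + 0.6784 * y - 0.9837 * a - 0.5722 * p ≤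
      (β + gapBound q) + (η + gapBound q) := by
  by_contra! hcon
  have hpi := Real.pi_gt_d6
  have hg := gapBound_ge q
  have hb0' : (1500000 : ℝ) ≤ b0 := by exact_mod_cast hb0
  have hb1' : (b1 : ℝ) ≤ 1408000 := by exact_mod_cast hb1
  have hb2' : (b2 : ℝ) ≤ 983700 := by exact_mod_cast hb2
  have m1 : 0 ≤ (1408000 - b1) * p := mul_nonneg (by linarith) hp
  have m2 : 0 ≤ (983700 - b2) * a := mul_nonneg (by linarith) (by linarith)
  -- Subtracting the side bound and gapBound q ≥ 0.2505 from the assumed inequality bounds η from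
  -- above; 1.8055 = 2.056 - 0.2505. The second term of `turnTerms` comes instead from η ≥ β -
  -- 0.6198, with 2.6758 = 2.056 + 0.6198.
  have hcc : Real.cos ((1805500 - b0) / 1000000 - (1408000 - b1) / 1000000 * p + 678400 / 1000000 * y -
      (983700 - b2) / 1000000 * a) ≤ Real.cos η :=
    Real.cos_le_cos_of_nonneg_of_le_pi hη0 (by linarith) (by linarith)
  have hcc' := mul_le_mul_of_nonneg_left hcc (by linarith : 0 ≤ y)
  obtain ⟨t, ht, hneg⟩ := exists_neg_of_check hc (xs := [p, a, y])
    (.cons (Itv.mem_mk (by push_cast; linarith) (by push_cast; linarith))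
      (.cons (Itv.mem_mk (by push_cast; linarith) (by push_cast; linarith))
      (.cons (Itv.mem_mk (by push_cast; linarith) (by push_cast; linarith)) .nil)))
  simp only [turnTerms, List.mem_cons, List.not_mem_nil, or_false] at ht
  rcases ht with rfl | rfl | rfl
  · simp only [Term.val, List.getD_cons_zero, List.getD_cons_succ] at hneg
    norm_num at hneg hF
    linarith
  · simp only [Term.val, List.getD_cons_zero, List.getD_cons_succ] at hneg
    push_cast at hneg
    linarith
  · simp only [Term.val, List.getD_cons_zero, List.getD_cons_succ] at hneg
    push_cast at hneg
    linarith

/-- The angle `β` between a far point at distance `1 / p` and a point at distance `1 / q`, and the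
angle `η` between the latter and the witness of the former. -/
theorem turn_ge {η : ℝ} (hd : 0 < d) (hdp : 1 / d ≤ 0.28) (he : 1.628 ≤ e)
    (ha : 0.5 ≤ a) (ha1 : a ≤ 1) (hy : 1 ≤ y) (hy' : y ≤ 1.39)
    (hF : y * (1.628 - 1 / d * y) ≤ a * (2 - 1 / d * a))
    (hF1 : 1.628 ≤ 1 / d + a * (2 - 1 / d * a)) (h0 : 0 ≤ β)
    (h1 : 2 * d * e * Real.cos β ≤ e ^ 2 + 2 * a * d - a ^ 2)
    (h2 : 2 * d * e * Real.cos β ≤ d ^ 2 + 2 * e - 1)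
    (hη : β - 0.6198 ≤ η) (hη0 : 0 ≤ η)
    (h3 : 2 * y * e * Real.cos η ≤ y ^ 2 + e ^ 2 - 1)
    (h4 : 2 * y * e * Real.cos η ≤ y ^ 2 + 2 * e - 1) :
    2.056 - 0.8358 * (1 / d) + 0.6784 * y - 0.9837 * a - 0.5722 * (1 / d) ≤
      (β + gapBound (1 / e)) + (η + gapBound (1 / e)) := by
  have he0 : 0 < e := by linarith
  have hp0 : 0 < 1 / d := by positivity
  have hq0 : 0 < 1 / e := by positivity
  have hq : 1 / e ≤ 0.6143 := by rw [div_le_iff₀ he0]; linarith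
  have k3 : 2 * (y * Real.cos η) ≤ 1 / e * (y ^ 2 - 1) + e := by
    have : 2 * (y * Real.cos η) = 2 * y * e * Real.cos η / e := by field_simp
    rw [this, div_le_iff₀ he0]
    have : (1 / e * (y ^ 2 - 1) + e) * e = y ^ 2 + e ^ 2 - 1 := by field_simp; ring
    linarith
  have k4 : 2 * (y * Real.cos η) ≤ 1 / e * (y ^ 2 - 1) + 2 := by
    have : 2 * (y * Real.cos η) = 2 * y * e * Real.cos η / e := by field_simp
    rw [this, div_le_iff₀ he0]
    have : (1 / e * (y ^ 2 - 1) + 2) * e = y ^ 2 + 2 * e - 1 := by field_simp; ring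
    linarith
  have hy2 : 0 ≤ y ^ 2 - 1 := by nlinarith
  have hy3 : y ^ 2 - 1 ≤ 0.9321 := by nlinarith
  -- `q * (y ^ 2 - 1) + 1 / q` is decreasing in `q`
  have dec : ∀ x : ℝ, 0 < x → x ≤ 1 / e → 1 / e * (y ^ 2 - 1) + e ≤ x * (y ^ 2 - 1) + 1 / x := by
    intro x hx hxe
    have hxe' : x * e ≤ 1 := by rwa [le_div_iff₀ he0] at hxe
    have e1 : x * (y ^ 2 - 1) + 1 / x - (1 / e * (y ^ 2 - 1) + e) =
        (1 / e - x) * (e / x - (y ^ 2 - 1)) := by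
      field_simp; ring
    have e2 : 1 ≤ e / x := by rw [le_div_iff₀ hx]; nlinarith
    nlinarith [mul_nonneg (sub_nonneg.2 hxe) (by linarith : 0 ≤ e / x - (y ^ 2 - 1))]
  -- Each range of q = 1/e has its own linear side bound. The constants in the bound for y·cos η
  -- come from (q(y² - 1) + 1/q)/2 at q = 0.5, 0.52 and 0.56.
  rcases le_total (1 / e) 0.52 with hc | hc
  · have hs := side_ge (q1 := 520000) (by norm_num) (by norm_num) (by norm_num)
      check_nearSideTerms_far₀ check_farSideTerms_far₀ hd he0 ha ha1 (by push_cast; linarith)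
      (by push_cast; linarith) (by push_cast; linarith) hF1 h0 h1 h2
    refine turn_ge_aux (by norm_num) (by norm_num) (by norm_num) check_turnTerms_far₀ hp0.le hdp
      ha ha1 hy hy' hF hs hη hη0 ?_
    push_cast
    rcases le_total (1 / e) 0.5 with hh | hh
    · nlinarith [mul_nonneg (sub_nonneg.2 hh) hy2]
    · have := k3.trans (dec 0.5 (by norm_num) hh)
      norm_num at this
      linarith
  rcases le_total (1 / e) 0.56 with hc' | hc'
  · have hs := side_ge (q0 := 520000) (q1 := 560000) (by norm_num) (by norm_num) (by norm_num)
      check_nearSideTerms_far₁ check_farSideTerms_far₁ hd he0 ha ha1 (by push_cast; linarith)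
      (by push_cast; linarith) (by push_cast; linarith) hF1 h0 h1 h2
    refine turn_ge_aux (by norm_num) (by norm_num) (by norm_num) check_turnTerms_far₁ hp0.le hdp
      ha ha1 hy hy' hF hs hη hη0 ?_
    have := k3.trans (dec 0.52 (by norm_num) hc)
    push_cast
    norm_num at this
    linarith
  · have hs := side_ge (q0 := 560000) (q1 := 614300) (by norm_num) (by norm_num) (by norm_num)
      check_nearSideTerms_far₂ check_farSideTerms_far₂ hd he0 ha ha1 (by push_cast; linarith)
      (by push_cast; linarith) (by push_cast; linarith) hF1 h0 h1 h2
    refine turn_ge_aux (by norm_num) (by norm_num) (by norm_num) check_turnTerms_far₂ hp0.le hdp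
      ha ha1 hy hy' hF hs hη hη0 ?_
    have := k3.trans (dec 0.56 (by norm_num) hc')
    push_cast
    norm_num at this
    linarith

/-- A linear upper bound for the angle between a far point and the witness of another one. -/
theorem cross_le {Ω : ℝ} (hd : 0 < d) (hdp : 1 / d ≤ 0.28) (ha : 0.5 ≤ a) (ha1 : a ≤ 1)
    (hy : 1 ≤ y) (hy' : y ≤ 1.39) (hF1 : 1.628 ≤ 1 / d + a * (2 - 1 / d * a))
    (hΩ : Ω ≤ Real.pi)
    (h : d ^ 2 + y ^ 2 - 2 * d * y * Real.cos Ω ≤ (d - a + y) ^ 2) :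
    Ω ≤ 1.937 + 0.6784 * y - 0.9837 * a - 0.5722 * (1 / d) := by
  by_contra! hcon
  have hp0 : 0 < 1 / d := by positivity
  have hc : Real.cos Ω ≤ Real.cos (1.937 + 0.6784 * y - 0.9837 * a - 0.5722 * (1 / d)) :=
    Real.cos_le_cos_of_nonneg_of_le_pi (by linarith) hΩ hcon.le
  obtain ⟨t, ht, hneg⟩ := exists_neg_of_check check_crossTerms (xs := [1 / d, a, y])
    (.cons (Itv.mem_mk (by push_cast; linarith) (by push_cast; linarith))
      (.cons (Itv.mem_mk (by push_cast; linarith) (by push_cast; linarith))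
      (.cons (Itv.mem_mk (by push_cast; linarith) (by push_cast; linarith)) .nil)))
  have hc' := mul_le_mul_of_nonneg_left hc (by linarith : 0 ≤ y)
  set C := Real.cos Ω
  have k : a * (1 + 1 / d * (y - 0.5 * a)) ≤ y * C + y := by
    have e1 : a * (1 + 1 / d * (y - 0.5 * a)) = (2 * a * d + 2 * a * y - a ^ 2) / (2 * d) := by
      field_simp; ring
    rw [e1, div_le_iff₀ (by positivity)]
    nlinarith
  simp only [crossTerms, List.mem_cons, List.not_mem_nil, or_false] at ht
  rcases ht with rfl | rfl
  · simp only [Term.val, List.getD_cons_zero, List.getD_cons_succ] at hneg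
    norm_num at hneg hF1
    linarith
  · simp only [Term.val, List.getD_cons_zero, List.getD_cons_succ] at hneg
    norm_num at hneg hc' k
    linarith

/-- For the two extreme far points, `X` is the sum of inverse distances, `σ` the sum of differences
between distance and radius, and `φ` their angle: a linear lower bound on `φ` is incompatible with
contact. -/
theorem not_contact {b0 b1 b2 x0 x1 : Int} {X σ φ : ℝ}
    (hc : check (contactTerms b0 b1 b2) 80 [⟨x0, x1⟩, ⟨1000000, 2000000⟩] = true)
    (hX : (x0 : ℝ) / 1000000 ≤ X) (hX' : X ≤ (x1 : ℝ) / 1000000)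
    (hσ : 1 ≤ σ) (hσ2 : σ ≤ 2) (hσX : 1.628 - 0.375 * X ≤ σ)
    (hφ : b0 / 1000000 - b1 / 1000000 * X - b2 / 1000000 * σ ≤ φ) (hφ2 : φ ≤ Real.pi)
    (h0 : 0 ≤ b0 / 1000000 - b1 / 1000000 * X - b2 / 1000000 * σ)
    (h : -Real.cos φ ≤ 1 - σ * X + (σ * X) ^ 2 / 8) : False := by
  have hcc := Real.cos_le_cos_of_nonneg_of_le_pi h0 hφ2 hφ
  obtain ⟨t, ht, hneg⟩ := exists_neg_of_check hc (xs := [X, σ])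
    (.cons (Itv.mem_mk hX hX') (.cons (Itv.mem_mk (by push_cast; linarith)
      (by push_cast; linarith)) .nil))
  simp only [contactTerms, List.mem_cons, List.not_mem_nil, or_false] at ht
  rcases ht with rfl | rfl
  · simp only [Term.val, List.getD_cons_zero, List.getD_cons_succ] at hneg
    push_cast at hneg
    linarith
  · simp only [Term.val, List.getD_cons_zero, List.getD_cons_succ] at hneg
    push_cast at hneg
    linarith

end linear

/-! ### Four far points -/

theorem exists_angle (x : ℝ) : ∃ ψ : ℝ, |ψ| ≤ Real.pi ∧ ∃ k : ℤ, x = ψ + k * (2 * Real.pi) := by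
  have hp := Real.two_pi_pos
  refine ⟨toIocMod hp (-Real.pi) x, ?_, toIocDiv hp (-Real.pi) x, ?_⟩
  · have := toIocMod_mem_Ioc hp (-Real.pi) x
    exact abs_le.2 ⟨this.1.le, by linarith [this.2]⟩
  · have := toIocMod_add_toIocDiv_zsmul hp (-Real.pi) x
    rw [zsmul_eq_mul] at this
    exact this.symm

theorem abs_le_of_cos_lt {t c : ℝ} (hc : 0 ≤ c) (ht : |t| ≤ Real.pi)
    (h : Real.cos c < Real.cos t) : |t| ≤ c := by
  by_contra! hcon
  have := Real.cos_le_cos_of_nonneg_of_le_pi hc ht hcon.le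
  rw [Real.cos_abs] at this
  linarith

theorem abs_le_of_cos_ge {t : ℝ} (ht : |t| ≤ Real.pi) (h : 0.814 ≤ Real.cos t) :
    |t| ≤ 0.6198 := by
  refine abs_le_of_cos_lt (by norm_num) ht (lt_of_lt_of_le ?_ h)
  have := cos_upper 0.6198
  norm_num at this ⊢
  linarith

theorem abs_le_of_neg_le_cos {t : ℝ} (ht : |t| ≤ Real.pi) (h : -0.297 ≤ Real.cos t) :
    |t| ≤ 1.8725 := by
  refine abs_le_of_cos_lt (by norm_num) ht (lt_of_lt_of_le ?_ h)
  have := cos_upper 1.8725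
  norm_num at this ⊢
  linarith

section config

variable {ι : Type*} {d r θ : ι → ℝ}

theorem Config.neg (h : Config d r θ) : Config d r (fun i => -θ i) :=
  h.congr fun i j => by rw [← Real.cos_neg]; congr 1; ring

/-- Four lower bounds for the squared distance of two points: 1, (d j - 1)², (d i - 1)² and r i². -/
theorem Config.cos_le (h : Config d r θ) {i j : ι} (hij : i ≠ j) {t : ℝ}
    (ht : Real.cos (θ i - θ j) = Real.cos t) :
    2 * d i * d j * Real.cos t ≤ d i ^ 2 + d j ^ 2 - 1 ∧
      2 * d i * d j * Real.cos t ≤ d i ^ 2 + 2 * d j - 1 ∧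
      2 * d i * d j * Real.cos t ≤ d j ^ 2 + 2 * d i - 1 ∧
      2 * d i * d j * Real.cos t ≤ d j ^ 2 + 2 * (d i - r i) * d i - (d i - r i) ^ 2 := by
  have h1 := h.sq_le i j hij
  have h2 := h.sq_le j i hij.symm
  rw [← Real.cos_neg, neg_sub] at h2
  rw [ht] at h1 h2
  have e1 := h.one_le_r i
  have e2 := h.sub_le i
  have e3 := h.sub_le j
  have e4 := h.one_le_d i
  have e5 := h.one_le_d j
  refine ⟨by nlinarith, ?_, ?_, by nlinarith⟩
  · have := pow_le_pow_left₀ (by linarith) e3 2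
    nlinarith
  · have := pow_le_pow_left₀ (by linarith) e2 2
    nlinarith

/-- A witness of a far point: a nearer point in almost the same direction. -/
def Witness (d θ : ι → ℝ) (x y : ι) : Prop :=
  x ≠ y ∧ d y ≤ d x ∧ 0.814 ≤ Real.cos (θ x - θ y)

theorem Config.sq_le_of_witness (h : Config d r θ) {x y : ι} (hw : Witness d θ x y) :
    r x ^ 2 ≤ d x ^ 2 + d y ^ 2 - 1.628 * d x * d y := by
  have h1 := h.sq_le x y hw.1
  have h2 := h.one_le_d x
  have h3 := h.one_le_d y
  have : 2 * d x * d y * 0.814 ≤ 2 * d x * d y * Real.cos (θ x - θ y) := by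
    have := hw.2.2
    gcongr
  linarith

/-- The squared distance bound is convex in the witness distance, so it suffices to compare with 1
at both ends of [1, d x]; it falls below 1 at both if d x < 1.628. -/
theorem Config.le_of_witness (h : Config d r θ) {x y : ι} (hw : Witness d θ x y) :
    1.628 ≤ d x := by
  have h1 := h.sq_le_of_witness hw
  have h2 := h.one_le_d y
  have h3 := hw.2.1
  have h4 := h.one_le_r x
  by_contra! hcon
  have h5 := mul_nonneg (sub_nonneg.2 h2) (sub_nonneg.2 h3)
  rcases le_total (1 - 0.628 * d x) 0 with h6 | h6
  · nlinarith [mul_nonneg (neg_nonneg.2 h6) (sub_nonneg.2 h2)]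
  · nlinarith [mul_nonneg h6 (sub_nonneg.2 h3)]

/-- With a = d x - r x this is the bound on r x² divided by d x, in the shape used by the term
lists. -/
theorem Config.far_constraint (h : Config d r θ) {x y : ι} (hw : Witness d θ x y) :
    d y * (1.628 - 1 / d x * d y) ≤ (d x - r x) * (2 - 1 / d x * (d x - r x)) := by
  have h1 := h.sq_le_of_witness hw
  have h0 : 0 < d x := by linarith [h.one_le_d x]
  have e1 : d y * (1.628 - 1 / d x * d y) = (1.628 * d x * d y - d y ^ 2) / d x := by
    field_simp
  have e2 : (d x - r x) * (2 - 1 / d x * (d x - r x)) = (d x ^ 2 - r x ^ 2) / d x := by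
    field_simp; ring
  rw [e1, e2]
  exact div_le_div_of_nonneg_right (by linarith) h0.le

theorem Config.inv_le_of_witness (h : Config d r θ) {x y : ι} (hw : Witness d θ x y) :
    1 / d x ≤ 0.6143 := by
  have := h.le_of_witness hw
  rw [div_le_iff₀ (by linarith)]
  linarith

/-- Replacing the witness distance y by 1 lowers the left side of `far_constraint` by (y - 1)(1.628
- y/d - 1/d), which is nonnegative. -/
theorem Config.far_constraint' (h : Config d r θ) {x y : ι} (hw : Witness d θ x y) :
    1.628 ≤ 1 / d x + (d x - r x) * (2 - 1 / d x * (d x - r x)) := by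
  have h1 := h.far_constraint hw
  have h2 := h.inv_le_of_witness hw
  have h3 := h.one_le_d y
  have h4 : 1 / d x * d y ≤ 1 := by
    have := h.one_le_d x
    rw [div_mul_eq_mul_div, one_mul, div_le_one (by linarith)]
    exact hw.2.1
  nlinarith [mul_nonneg (sub_nonneg.2 h3) (by linarith : 0 ≤ 1.628 - 1 / d x * d y - 1 / d x)]

theorem Config.half_le_of_witness (h : Config d r θ) {x y : ι} (hw : Witness d θ x y) :
    0.5 ≤ d x - r x := by
  have h1 := h.far_constraint' hw
  have h2 := h.inv_le_of_witness hw
  have h3 := h.r_le x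
  have h4 : 0 < 1 / d x := by have := h.one_le_d x; positivity
  generalize 1 / d x = p at *
  generalize d x - r x = a at *
  by_contra! hcon
  nlinarith [mul_nonneg h4.le (sq_nonneg a)]

theorem Config.witness_le (h : Config d r θ) {x y : ι} (hw : Witness d θ x y)
    (hp : 1 / d x ≤ 0.28) : d y ≤ 1.39 := by
  have h1 := h.far_constraint hw
  have h2 := h.sub_le x
  have hx := h.one_le_d x
  have h5 : 1 / d x * d y ≤ 1 := by
    rw [div_mul_eq_mul_div, one_mul, div_le_one (by linarith)]
    exact hw.2.1
  have h4 : 0 < 1 / d x := by positivity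
  have h6 := h.half_le_of_witness hw
  generalize 1 / d x = p at *
  have h7 : d x - r x ≤ 1 := by linarith
  generalize d x - r x = a at *
  have h8 : a * (2 - p * a) ≤ 2 - p := by
    nlinarith [mul_nonneg (sub_nonneg.2 h7) (by nlinarith : 0 ≤ 2 - p * (1 + a))]
  by_contra! hcon
  rcases le_total (d y) 3.5 with hy | hy
  · nlinarith [mul_nonneg (sub_nonneg.2 hcon.le) (sub_nonneg.2 hy),
      mul_nonneg (sub_nonneg.2 hp) (by nlinarith : 0 ≤ d y ^ 2 - 1)]
  · nlinarith

/-- A very far point is thus more than 0.6198 away in direction from every other far point, so no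
far point can serve as its witness. -/
theorem Config.cos_lt_of_witness (h : Config d r θ) {x y z : ι} (hw : Witness d θ x y)
    (hz : 1.628 ≤ d z) (hp : 1 / d x ≤ 0.28) (hxz : x ≠ z) {t : ℝ}
    (ht : Real.cos (θ x - θ z) = Real.cos t) : Real.cos t < 0.81 := by
  obtain ⟨-, h2, -, h4⟩ := h.cos_le hxz ht
  have hx := h.one_le_d x
  have ha := h.sub_le x
  have ha' := h.half_le_of_witness hw
  have hd : 3.57 ≤ d x := by
    rw [div_le_iff₀ (by linarith)] at hp
    linarith
  by_contra! hcon
  have h5 : 2 * d x * d z * 0.81 ≤ 2 * d x * d z * Real.cos t := by gcongr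
  rcases le_total (d z) (d x) with hle | hle
  · nlinarith [mul_nonneg (sub_nonneg.2 hle) (sub_nonneg.2 hz),
      mul_nonneg (by linarith : 0 ≤ 1 - (d x - r x)) (by linarith : 0 ≤ d x + r x - 1)]
  · nlinarith

/-- The extreme point `x₁` of four far points, its neighbour `x₂`, and the other extreme `x₄`. -/
theorem Config.flank (h : Config d r θ) {x₁ x₂ x₄ y₁ y₂ y₄ : ι} (h12 : x₁ ≠ x₂)
    (w₁ : Witness d θ x₁ y₁) (w₂ : Witness d θ x₂ y₂) (w₄ : Witness d θ x₄ y₄)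
    (hp₁ : 1 / d x₁ ≤ 0.28) (hp₄ : 1 / d x₄ ≤ 0.28)
    (h1 : θ x₁ ≤ θ x₂) (h2 : θ x₂ ≤ θ x₄) (h3 : θ x₄ - θ x₁ ≤ 2.4925) :
    ∃ η, 2.056 - 0.8358 * (1 / d x₁) + 0.6784 * d y₁ - 0.9837 * (d x₁ - r x₁)
        - 0.5722 * (1 / d x₁) ≤
        (θ x₂ - θ x₁ + gapBound (1 / d x₂)) + (η + gapBound (1 / d x₂)) ∧
      θ x₄ - θ x₂ + η ≤
        1.937 + 0.6784 * d y₁ - 0.9837 * (d x₄ - r x₄) - 0.5722 * (1 / d x₄) := by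
  have hpi := Real.pi_gt_d6
  obtain ⟨ψ, hψ, k, hk⟩ := exists_angle (θ y₁ - θ x₁)
  have cψ : Real.cos (θ x₁ - θ y₁) = Real.cos ψ := by
    rw [← Real.cos_neg, neg_sub, hk, Real.cos_add_int_mul_two_pi]
  have hψ' := abs_le.1 (abs_le_of_cos_ge hψ (cψ ▸ w₁.2.2))
  have sh : ∀ z, Real.cos (θ y₁ - θ z) = Real.cos (θ z - θ x₁ - ψ) := by
    intro z
    rw [← Real.cos_neg, neg_sub, ← Real.cos_sub_int_mul_two_pi (θ z - θ x₁ - ψ) k]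
    congr 1
    linarith
  have sym : ∀ a b, Real.cos (θ a - θ b) = Real.cos (θ b - θ a) := fun a b => by
    rw [← Real.cos_neg, neg_sub]
  have hx₁ := h.one_le_d x₁
  have hd₂ := h.le_of_witness w₂
  have hβ := h.cos_lt_of_witness w₁ hd₂ hp₁ h12 (sym x₁ x₂)
  have hβ' : 0.6198 ≤ θ x₂ - θ x₁ := by
    by_contra! hcon
    have h4 := Real.cos_le_cos_of_nonneg_of_le_pi (x := θ x₂ - θ x₁) (y := 0.6198)
      (by linarith) (by linarith) hcon.le
    have h5 := cos_lower 0.6198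
    norm_num at h4 h5 hβ
    linarith
  have hφ : Real.cos (θ x₄ - θ x₁) < 0.81 :=
    lt_of_le_of_lt (Real.cos_le_cos_of_nonneg_of_le_pi (by linarith) (by linarith) (by linarith)) hβ
  have n2 : y₁ ≠ x₂ := by
    rintro rfl
    have := w₁.2.2
    rw [sym] at this
    linarith
  have n4 : x₄ ≠ y₁ := by
    rintro rfl
    have := w₁.2.2
    rw [sym] at this
    linarith
  obtain ⟨-, a2, -, a4⟩ := h.cos_le h12 (sym x₁ x₂)
  obtain ⟨b1, b2, -, -⟩ := h.cos_le n2 (sh x₂)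
  have hy := h.witness_le w₁ hp₁
  -- η is the angle from the witness y₁ to x₂; adding the angle from x₂ to x₄ gives the angle from
  -- y₁ to x₄, at most 2.4925 + 0.6198 < π.
  refine ⟨θ x₂ - θ x₁ - ψ, turn_ge (by linarith) hp₁ hd₂ (h.half_le_of_witness w₁)
    (by linarith [h.sub_le x₁]) (h.one_le_d y₁) hy (h.far_constraint w₁) (h.far_constraint' w₁)
    (by linarith) a4 a2 (by linarith) (by linarith) b1 b2, ?_⟩
  have := cross_le (d := d x₄) (a := d x₄ - r x₄) (y := d y₁) (Ω := θ x₄ - θ x₁ - ψ)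
    (by linarith [h.one_le_d x₄]) hp₄ (h.half_le_of_witness w₄) (by linarith [h.sub_le x₄])
    (h.one_le_d y₁) hy (h.far_constraint' w₄) (by linarith) ?_
  · linarith
  · have h5 := h.le_sq x₄ y₁ n4
    rw [sym, sh] at h5
    refine h5.trans (pow_le_pow_left₀ ?_ ?_ 2)
    · linarith [h.one_le_r x₄, h.one_le_r y₁]
    · linarith [h.r_le y₁]

theorem Config.side_ge (h : Config d r θ) {x₁ x₂ y₁ y₂ : ι} (h12 : x₁ ≠ x₂)
    (w₁ : Witness d θ x₁ y₁) (w₂ : Witness d θ x₂ y₂) {b0 b1 b2 pm : Int}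
    (hb0 : b0 ≤ 3000000) (hb1 : 0 ≤ b1) (hb2 : 0 ≤ b2)
    (hn : check (nearSideTerms b0 b1 b2 pm) 80 [⟨0, 1000000⟩, ⟨0, 614300⟩, ⟨500000, 1000000⟩] = true)
    (hf : check (farSideTerms b0 b1 b2 0) 80 [⟨0, 1000000⟩, ⟨0, pm⟩, ⟨500000, 1000000⟩] = true)
    (hp : 1 / d x₁ ≤ (pm : ℝ) / 1000000) {β : ℝ} (h0 : 0 ≤ β)
    (hβ : Real.cos (θ x₁ - θ x₂) = Real.cos β) :
    b0 / 1000000 - b1 / 1000000 * (1 / d x₁) - b2 / 1000000 * (d x₁ - r x₁) ≤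
      β + gapBound (1 / d x₂) := by
  obtain ⟨-, a2, -, a4⟩ := h.cos_le h12 hβ
  have h1 := h.one_le_d x₁
  have h2 := h.one_le_d x₂
  refine PlanarMST.side_ge hb0 hb1 hb2 hn hf (by linarith) (by linarith) (h.half_le_of_witness w₁)
    (by linarith [h.sub_le x₁]) hp ?_ ?_ (h.far_constraint' w₁) h0 a4 a2
  · push_cast; simp only [zero_div]; positivity
  · have := h.inv_le_of_witness w₂
    push_cast; linarith

theorem Config.not_four_sorted (h : Config d r θ) {x₁ x₂ x₃ x₄ y₁ y₂ y₃ y₄ : ι} (h12 : x₁ ≠ x₂)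
    (h23 : x₂ ≠ x₃) (h34 : x₃ ≠ x₄) (h14 : x₁ ≠ x₄)
    (w₁ : Witness d θ x₁ y₁) (w₂ : Witness d θ x₂ y₂) (w₃ : Witness d θ x₃ y₃)
    (w₄ : Witness d θ x₄ y₄) (h1 : θ x₁ ≤ θ x₂) (h2 : θ x₂ ≤ θ x₃) (h3 : θ x₃ ≤ θ x₄)
    (h4 : θ x₄ - θ x₁ ≤ 2.4925) : False := by
  have hpi := Real.pi_gt_d6
  have sym : ∀ a b, Real.cos (θ a - θ b) = Real.cos (θ b - θ a) := fun a b => by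
    rw [← Real.cos_neg, neg_sub]
  have hγ : gapBound (1 / d x₂) + gapBound (1 / d x₃) ≤ θ x₃ - θ x₂ := by
    obtain ⟨c1, c2, c3, -⟩ := h.cos_le h23 (sym x₂ x₃)
    exact gapBound_add_le (h.le_of_witness w₂) (h.le_of_witness w₃) (by linarith) c1 c2 c3
  have i1 := h.inv_le_of_witness w₁
  have i4 := h.inv_le_of_witness w₄
  have hx1 := h.one_le_d x₁
  have hx4 := h.one_le_d x₄
  have p1 : 0 < 1 / d x₁ := by positivity
  have p4 : 0 < 1 / d x₄ := by positivity
  rcases le_total (1 / d x₁ + 1 / d x₄) 0.28 with hX | hX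
  · obtain ⟨η, e1, e2⟩ := h.flank h12 w₁ w₂ w₄ (by linarith) (by linarith) h1 (h2.trans h3) h4
    have wneg : ∀ {x y}, Witness d θ x y → Witness d (fun i => -θ i) x y := fun w =>
      ⟨w.1, w.2.1, by rw [← Real.cos_neg]; convert w.2.2 using 2; ring⟩
    obtain ⟨η', e3, e4⟩ := h.neg.flank h34.symm (wneg w₄) (wneg w₃) (wneg w₁)
      (by linarith) (by linarith) (neg_le_neg h3) (neg_le_neg (h1.trans h2)) (by linarith)
    -- Adding both flanks and twice `hγ` cancels all angles, witness distances and radii, leaving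
    -- 2(2.056 - 1.937) ≤ 0.8358·X, which fails for X ≤ 0.28.
    linarith
  · have contact : -Real.cos (θ x₄ - θ x₁) ≤ 1 - (d x₁ - r x₁ + (d x₄ - r x₄)) *
        (1 / d x₁ + 1 / d x₄) + ((d x₁ - r x₁ + (d x₄ - r x₄)) * (1 / d x₁ + 1 / d x₄)) ^ 2 / 8 := by
      have h5 := h.le_sq x₁ x₄ h14
      rw [sym] at h5
      have e : r x₁ + r x₄ = d x₁ + d x₄ - (d x₁ - r x₁ + (d x₄ - r x₄)) := by ring
      rw [e] at h5
      generalize d x₁ - r x₁ + (d x₄ - r x₄) = σ at *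
      have h6 : -Real.cos (θ x₄ - θ x₁) ≤ 1 - σ * (1 / d x₁ + 1 / d x₄) +
          σ ^ 2 * (1 / d x₁ * (1 / d x₄)) / 2 := by
        have e2 : 1 - σ * (1 / d x₁ + 1 / d x₄) + σ ^ 2 * (1 / d x₁ * (1 / d x₄)) / 2 =
            ((d x₁ + d x₄ - σ) ^ 2 - d x₁ ^ 2 - d x₄ ^ 2) / (2 * d x₁ * d x₄) := by
          field_simp; ring
        rw [e2, le_div_iff₀ (by positivity)]
        linarith
      -- A product is at most a quarter of the squared sum, so only X and σ remain.
      nlinarith [mul_nonneg (sq_nonneg σ) (sq_nonneg (1 / d x₁ - 1 / d x₄))]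
    have a1 := h.half_le_of_witness w₁
    have a4 := h.half_le_of_witness w₄
    have a1' := h.sub_le x₁
    have a4' := h.sub_le x₄
    have f1 := h.far_constraint' w₁
    have f4 := h.far_constraint' w₄
    -- Sum of the two far constraints, with a² ≥ 1/4 in the negative terms.
    have hσ : 1.628 - 0.375 * (1 / d x₁ + 1 / d x₄) ≤ d x₁ - r x₁ + (d x₄ - r x₄) := by
      nlinarith [mul_nonneg p1.le (by nlinarith : 0 ≤ (d x₁ - r x₁) ^ 2 - 0.25),
        mul_nonneg p4.le (by nlinarith : 0 ≤ (d x₄ - r x₄) ^ 2 - 0.25)]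
    -- In both ranges the two side bounds and `hγ` add up to a lower bound for the total angle: the
    -- `gapBound` terms at x₂ and x₃ cancel.
    rcases le_total (1 / d x₁ + 1 / d x₄) 0.4 with hX' | hX'
    · have s1 := h.side_ge h12 w₁ w₂ (by norm_num) (by norm_num) (by norm_num)
        check_nearSideTerms_mid check_farSideTerms_mid (by push_cast; linarith)
        (sub_nonneg.2 h1) (sym _ _)
      have s4 := h.side_ge h34.symm w₄ w₃ (by norm_num) (by norm_num) (by norm_num)
        check_nearSideTerms_mid check_farSideTerms_mid (by push_cast; linarith)
        (sub_nonneg.2 h3) rfl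
      push_cast at s1 s4
      refine not_contact check_contactTerms_mid (X := 1 / d x₁ + 1 / d x₄)
        (σ := d x₁ - r x₁ + (d x₄ - r x₄)) (φ := θ x₄ - θ x₁) ?_ ?_ ?_ ?_ hσ ?_ ?_ ?_ contact
      all_goals push_cast
      all_goals linarith
    · have s1 := h.side_ge h12 w₁ w₂ (by norm_num) (by norm_num) (by norm_num)
        check_nearSideTerms_near check_farSideTerms_near (by push_cast; linarith)
        (sub_nonneg.2 h1) (sym _ _)
      have s4 := h.side_ge h34.symm w₄ w₃ (by norm_num) (by norm_num) (by norm_num)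
        check_nearSideTerms_near check_farSideTerms_near (by push_cast; linarith)
        (sub_nonneg.2 h3) rfl
      push_cast at s1 s4
      refine not_contact check_contactTerms_near (X := 1 / d x₁ + 1 / d x₄)
        (σ := d x₁ - r x₁ + (d x₄ - r x₄)) (φ := θ x₄ - θ x₁) ?_ ?_ ?_ ?_ hσ ?_ ?_ ?_ contact
      all_goals push_cast
      all_goals linarith

end config

/-! ### The number of near and far points -/

section count

variable {ι : Type*} {d r θ : ι → ℝ}

theorem exists_monotone_enum (S : Finset ι) (T : ι → ℝ) {n : ℕ} (hn : n ≤ S.card) :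
    ∃ x : Fin n → ι, Function.Injective x ∧ Monotone (T ∘ x) ∧ ∀ i, x i ∈ S := by
  obtain ⟨S', hS', hc⟩ := Finset.exists_subset_card_eq hn
  let e : Fin n ≃ S' := (S'.equivFinOfCardEq hc).symm
  let f : Fin n → ℝ := fun i => T (e i)
  refine ⟨fun i => (e (Tuple.sort f i) : ι), ?_, Tuple.monotone_sort f, fun i => hS' (e _).2⟩
  intro i j hij
  exact (Tuple.sort f).injective (e.injective (Subtype.ext hij))

theorem cos_shift {a b : ℝ} {k l : ℤ} {x y : ℝ} (hx : x = a + k * (2 * Real.pi))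
    (hy : y = b + l * (2 * Real.pi)) : Real.cos (a - b) = Real.cos (x - y) := by
  rw [← Real.cos_add_int_mul_two_pi (a - b) (k - l)]
  congr 1
  rw [hx, hy]
  push_cast
  ring

/-- There are at most three points with a witness. -/
theorem Config.card_far_le (h : Config d r θ) (S : Finset ι)
    (hS : ∀ x ∈ S, ∃ y, Witness d θ x y) : S.card ≤ 3 := by
  classical
  by_contra! hcard
  have hpi := Real.pi_gt_d6
  choose! y hy using hS
  -- The nearest of all witnesses serves as reference direction: no far point is almost opposite to
  -- it.
  obtain ⟨x₀, hx₀, hmin⟩ := S.exists_min_image (fun x => d (y x))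
    (Finset.card_pos.1 (by omega))
  choose T hT k hk using fun i => exists_angle (θ i - θ (y x₀))
  have hc : ∀ i j, Real.cos (T i - T j) = Real.cos (θ i - θ j) := fun i j => by
    rw [cos_shift (hk i) (hk j)]
    congr 1
    ring
  have C : Config d r T := h.congr hc
  have w : ∀ x ∈ S, Witness d T x (y x) := fun x hx => ⟨(hy x hx).1, (hy x hx).2.1, by
    rw [hc]; exact (hy x hx).2.2⟩
  have near : ∀ x ∈ S, |T x| ≤ 1.8725 := by
    intro x hx
    refine abs_le_of_neg_le_cos (hT x) ?_
    have e : Real.cos (T x) = Real.cos (θ x - θ (y x₀)) := by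
      rw [hk x, Real.cos_add_int_mul_two_pi]
    rw [e]
    rcases eq_or_ne x (y x₀) with hxy | hxy
    · rw [← hxy, sub_self, Real.cos_zero]; norm_num
    · exact h.neg_le_cos (hy x hx).1 hxy (hy x hx).2.1 (hmin x hx) (hy x hx).2.2
  -- The nearer of the two witnesses lies within 0.6198 of its own point and within 1.8725 of the
  -- other point.
  have pair_aux : ∀ x ∈ S, ∀ x' ∈ S, d (y x) ≤ d (y x') → |T x' - T x| ≤ 2.4925 := by
    intro x hx x' hx' hle
    obtain ⟨A, hA, m, hm⟩ := exists_angle (T x' - T (y x))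
    obtain ⟨B, hB, n, hn⟩ := exists_angle (T (y x) - T x)
    have hA' : |A| ≤ 1.8725 := by
      refine abs_le_of_neg_le_cos hA ?_
      rw [← Real.cos_add_int_mul_two_pi A m, ← hm]
      rcases eq_or_ne x' (y x) with hxy | hxy
      · rw [hxy, sub_self, Real.cos_zero]; norm_num
      · exact C.neg_le_cos (w x' hx').1 hxy (w x' hx').2.1 hle (w x' hx').2.2
    have hB' : |B| ≤ 0.6198 := by
      refine abs_le_of_cos_ge hB ?_
      rw [← Real.cos_add_int_mul_two_pi B n, ← hn, ← Real.cos_neg, neg_sub]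
      exact (w x hx).2.2
    have a1 := abs_le.1 hA'
    have a2 := abs_le.1 hB'
    have a3 := abs_le.1 (near x hx)
    have a4 := abs_le.1 (near x' hx')
    have e : T x' - T x = A + B + ((m + n : ℤ) : ℝ) * (2 * Real.pi) := by
      push_cast; linarith
    -- No full turn is hidden: 2·1.8725 + 1.8725 + 0.6198 < 2π.
    have z : m + n = 0 := by
      by_contra hne
      rcases lt_or_gt_of_ne hne with hlt | hlt
      · have : ((m + n : ℤ) : ℝ) ≤ -1 := by exact_mod_cast Int.le_sub_one_of_lt hlt
        nlinarith
      · have : (1 : ℝ) ≤ ((m + n : ℤ) : ℝ) := by exact_mod_cast hlt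
        nlinarith
    rw [z] at e
    push_cast at e
    exact abs_le.2 ⟨by linarith, by linarith⟩
  have pair : ∀ x ∈ S, ∀ x' ∈ S, T x' - T x ≤ 2.4925 := by
    intro x hx x' hx'
    rcases le_total (d (y x)) (d (y x')) with hle | hle
    · exact (abs_le.1 (pair_aux x hx x' hx' hle)).2
    · have := (abs_le.1 (pair_aux x' hx' x hx hle)).1
      linarith
  obtain ⟨x, hinj, hmono, hmem⟩ := exists_monotone_enum S T (n := 4) (by omega)
  have ne : ∀ i j : Fin 4, i ≠ j → x i ≠ x j := fun i j hij => hinj.ne hij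
  have le : ∀ i j : Fin 4, i ≤ j → T (x i) ≤ T (x j) := fun i j hij => hmono hij
  exact C.not_four_sorted (ne 0 1 (by decide)) (ne 1 2 (by decide)) (ne 2 3 (by decide))
    (ne 0 3 (by decide)) (w _ (hmem 0)) (w _ (hmem 1)) (w _ (hmem 2)) (w _ (hmem 3))
    (le 0 1 (by decide)) (le 1 2 (by decide)) (le 2 3 (by decide))
    (pair _ (hmem 0) _ (hmem 3))

/-- There are at most seven points without a witness. -/
theorem Config.card_near_le (h : Config d r θ) (S : Finset ι)
    (hS : ∀ x ∈ S, ∀ y, ¬ Witness d θ x y) : S.card ≤ 7 := by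
  by_contra! hcard
  have hpi := Real.pi_gt_d6
  choose T hT k hk using fun i => exists_angle (θ i)
  have hc : ∀ i j, Real.cos (T i - T j) = Real.cos (θ i - θ j) := fun i j =>
    cos_shift (hk i) (hk j)
  obtain ⟨x, hinj, hmono, hmem⟩ := exists_monotone_enum S T (n := 8) (by omega)
  have sep : ∀ i j, i ≠ j → Real.cos (T (x i) - T (x j)) < 0.814 := by
    intro i j hij
    by_contra! hcon
    rcases le_total (d (x i)) (d (x j)) with hle | hle
    · refine hS _ (hmem j) (x i) ⟨hinj.ne hij.symm, hle, ?_⟩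
      rw [← hc, ← Real.cos_neg, neg_sub]
      exact hcon
    · refine hS _ (hmem i) (x j) ⟨hinj.ne hij, hle, ?_⟩
      rw [← hc]
      exact hcon
  have gap : ∀ t : ℝ, 0 ≤ t → Real.cos t < 0.814 → 0.6196 ≤ t := by
    intro t ht hct
    by_contra! hcon
    have h4 := Real.cos_le_cos_of_nonneg_of_le_pi ht (by linarith) hcon.le
    have h5 := cos_lower 0.6196
    norm_num at h4 h5 hct
    linarith
  let X : ℕ → Fin 8 := fun i => ⟨i % 8, Nat.mod_lt _ (by norm_num)⟩
  -- The eight sorted directions are unrolled to an increasing sequence with U (i + 8) = U i + 2π,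
  -- so that the gap across the cut is treated like the others.
  let U : ℕ → ℝ := fun i => T (x (X i)) + ((i / 8 : ℕ) : ℤ) * (2 * Real.pi)
  have hU : ∀ i j, Real.cos (U i - U j) = Real.cos (T (x (X i)) - T (x (X j))) := fun i j =>
    (cos_shift (k := ((i / 8 : ℕ) : ℤ)) (l := ((j / 8 : ℕ) : ℤ)) rfl rfl).symm
  have hX : ∀ i j, i < j → j < i + 8 → X i ≠ X j := by
    intro i j h1 h2 h3
    have : i % 8 = j % 8 := congrArg Fin.val h3
    omega
  refine h.not_eight (fun i => x (X i)) (fun i j h1 h2 => hinj.ne (hX i j h1 h2)) U ?_ ?_ ?_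
  · intro i
    have e1 : X (i + 8) = X i := Fin.ext (Nat.add_mod_right i 8)
    have e2 : (i + 8) / 8 = i / 8 + 1 := Nat.add_div_right i (by norm_num)
    simp only [U, e1, e2]
    push_cast
    ring
  · intro i j
    rw [hU, hc]
  · intro i
    refine gap _ ?_ ?_
    · rcases Nat.lt_or_ge (i % 8) 7 with hi | hi
      · have e2 : (i + 1) / 8 = i / 8 := by omega
        have : X i ≤ X (i + 1) := by
          change i % 8 ≤ (i + 1) % 8
          omega
        have := hmono this
        simp only [U, e2]
        simp only [Function.comp] at this
        linarith
      · have e2 : (i + 1) / 8 = i / 8 + 1 := by omega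
        have a1 := abs_le.1 (hT (x (X i)))
        have a2 := abs_le.1 (hT (x (X (i + 1))))
        simp only [U, e2]
        push_cast
        linarith
    · rw [hU]
      exact sep _ _ (hX i (i + 1) (by omega) (by omega)).symm

theorem Config.card_le [Fintype ι] (h : Config d r θ) : Fintype.card ι ≤ 10 := by
  classical
  have h1 := h.card_far_le (Finset.univ.filter fun x => ∃ y, Witness d θ x y) (by simp)
  have h2 := h.card_near_le (Finset.univ.filter fun x => ¬ ∃ y, Witness d θ x y) (by simp)
  have h3 := Finset.card_filter_add_card_filter_not (s := (Finset.univ : Finset ι))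
    (fun x => ∃ y, Witness d θ x y)
  rw [Finset.card_univ] at h3
  omega

end count

/-! ### Two disjoint disks among twelve -/

theorem dist_sq_eq (o p q : Plane) : dist p q ^ 2 = dist p o ^ 2 + dist q o ^ 2 -
    2 * dist p o * dist q o * Real.cos (Complex.arg ⟨p 0 - o 0, p 1 - o 1⟩ -
      Complex.arg ⟨q 0 - o 0, q 1 - o 1⟩) := by
  have hn : ∀ a : Plane, dist a o = ‖(⟨a 0 - o 0, a 1 - o 1⟩ : ℂ)‖ := by
    intro a
    rw [EuclideanSpace.dist_eq, Fin.sum_univ_two, Complex.norm_def, Complex.normSq_mk,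
      Real.dist_eq, Real.dist_eq, sq_abs, sq_abs]
    ring_nf
  have hd : dist p q ^ 2 = (p 0 - q 0) ^ 2 + (p 1 - q 1) ^ 2 := by
    rw [EuclideanSpace.dist_eq, Fin.sum_univ_two, Real.dist_eq, Real.dist_eq, sq_abs, sq_abs,
      Real.sq_sqrt (by positivity)]
  rw [hn, hn, hd, Real.cos_sub]
  have e1 := Complex.norm_mul_cos_arg ⟨p 0 - o 0, p 1 - o 1⟩
  have e2 := Complex.norm_mul_sin_arg ⟨p 0 - o 0, p 1 - o 1⟩
  have e3 := Complex.norm_mul_cos_arg ⟨q 0 - o 0, q 1 - o 1⟩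
  have e4 := Complex.norm_mul_sin_arg ⟨q 0 - o 0, q 1 - o 1⟩
  have s1 := Real.sin_sq_add_cos_sq (Complex.arg ⟨p 0 - o 0, p 1 - o 1⟩)
  have s2 := Real.sin_sq_add_cos_sq (Complex.arg ⟨q 0 - o 0, q 1 - o 1⟩)
  simp only at e1 e2 e3 e4
  generalize Complex.arg ⟨p 0 - o 0, p 1 - o 1⟩ = α at *
  generalize Complex.arg ⟨q 0 - o 0, q 1 - o 1⟩ = β at *
  generalize ‖(⟨p 0 - o 0, p 1 - o 1⟩ : ℂ)‖ = u at *
  generalize ‖(⟨q 0 - o 0, q 1 - o 1⟩ : ℂ)‖ = v at *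
  have f1 : p 0 - q 0 = u * Real.cos α - v * Real.cos β := by linarith
  have f2 : p 1 - q 1 = u * Real.sin α - v * Real.sin β := by linarith
  rw [f1, f2]
  linear_combination u ^ 2 * s1 + v ^ 2 * s2

theorem exists_separated_of_card_eq (Q : Finset Plane) (hQ : Q.card = 12) :
    ∃ p ∈ Q, ∃ q ∈ Q, p ≠ q ∧ diskRadius Q p + diskRadius Q q < dist p q := by
  classical
  by_contra! hcon
  obtain ⟨o, ho, hmin⟩ := Q.exists_min_image (diskRadius Q) (Finset.card_pos.1 (by omega))
  have hne : ∃ q ∈ Q, q ≠ o := Finset.exists_mem_ne (by omega) o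
  have hρ := diskRadius_pos hne
  set ρ := diskRadius Q o
  -- Minimality of ρ gives `one_le_r`, contact with the disk of `o` gives `sub_le`, and the law of
  -- cosines turns the remaining conditions into bounds on mutual distances.
  have C : Config (ι := Q.erase o) (fun x => dist (x : Plane) o / ρ)
      (fun x => diskRadius Q x / ρ)
      (fun x => Complex.arg ⟨(x : Plane) 0 - o 0, (x : Plane) 1 - o 1⟩) := by
    have mem : ∀ x : Q.erase o, (x : Plane) ≠ o ∧ (x : Plane) ∈ Q := fun x =>
      Finset.mem_erase.1 x.2
    have law : ∀ i j : Q.erase o, (dist (i : Plane) o / ρ) ^ 2 + (dist (j : Plane) o / ρ) ^ 2 -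
        2 * (dist (i : Plane) o / ρ) * (dist (j : Plane) o / ρ) *
        Real.cos (Complex.arg ⟨(i : Plane) 0 - o 0, (i : Plane) 1 - o 1⟩ -
          Complex.arg ⟨(j : Plane) 0 - o 0, (j : Plane) 1 - o 1⟩) =
        (dist (i : Plane) j / ρ) ^ 2 := by
      intro i j
      rw [div_pow (dist (i : Plane) j), dist_sq_eq o]
      ring
    have rnonneg : ∀ i : Q.erase o, 0 ≤ diskRadius Q i := fun i => hρ.le.trans (hmin _ (mem i).2)
    refine ⟨fun i => ?_, fun i => ?_, fun i => ?_, fun i => ?_, fun i j hij => ?_, fun i j hij => ?_⟩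
    · rw [one_le_div hρ]
      exact diskRadius_le_dist (mem i).2 (mem i).1
    · rw [one_le_div hρ]
      exact hmin _ (mem i).2
    · have := diskRadius_le_dist (p := (i : Plane)) ho (mem i).1.symm
      rw [dist_comm] at this
      exact div_le_div_of_nonneg_right this hρ.le
    · have := hcon i (mem i).2 o ho (mem i).1
      rw [div_sub_one hρ.ne']
      exact div_le_div_of_nonneg_right (by linarith) hρ.le
    · rw [law]
      have hne' : (j : Plane) ≠ i := fun e => hij (Subtype.ext e.symm)
      have := diskRadius_le_dist (p := (i : Plane)) (mem j).2 hne'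
      rw [dist_comm] at this
      exact pow_le_pow_left₀ (div_nonneg (rnonneg i) hρ.le)
        (div_le_div_of_nonneg_right this hρ.le) 2
    · rw [law, ← add_div]
      have hne' : (i : Plane) ≠ j := fun e => hij (Subtype.ext e)
      exact pow_le_pow_left₀ (by positivity)
        (div_le_div_of_nonneg_right (hcon i (mem i).2 j (mem j).2 hne') hρ.le) 2
  have := C.card_le
  rw [Fintype.card_coe, Finset.card_erase_of_mem ho] at this
  omega

end PlanarMST

theorem proposition6 (P : Finset PlanarMST.Plane) (hP : 12 ≤ P.card) :
    (P.card : ℝ) * ((P.card : ℝ) - 1) / 132 ≤ ((PlanarMST.disjointDiskPairs P).card : ℝ) ∧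
      (P.card : ℝ) * ((P.card : ℝ) - 1) / 132 ≤
        ((PlanarMST.largeRatioBipartitions P).card : ℝ) := by
  have h := PlanarMST.card_separatedPairs_ge PlanarMST.exists_separated_of_card_eq P hP
  have h' : (P.card : ℝ) * ((P.card : ℝ) - 1) / 132 ≤ (PlanarMST.separatedPairs P).card := by
    rw [div_le_iff₀ (by norm_num)]
    have h2 : ((P.card * (P.card - 1) : ℕ) : ℝ) ≤ (132 * (PlanarMST.separatedPairs P).card : ℕ) := by
      exact_mod_cast h
    rw [Nat.cast_mul, Nat.cast_sub (by omega)] at h2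
    push_cast at h2
    linarith
  exact ⟨h'.trans (by exact_mod_cast PlanarMST.card_separatedPairs_le_disjointDiskPairs P),
    h'.trans (by exact_mod_cast
      PlanarMST.card_separatedPairs_le_largeRatioBipartitions P (by omega))⟩
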